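/- **Setting.** Let $d\in\{2,3\}$, $\mathrm L>0$, $\mathbb T^d=(\mathbb R/\mathrm L\mathbb Z)^d$, and let $\mathcal V$ be the space of divergence-free fields in $C^\infty(\mathbb T^d;\mathbb R^d)$ (no zero-mean condition). Let $\mathbb H$, $\widetilde{\mathbb L}^p$ ($p>2$) and $\mathbb V$ be the closures of $\mathcal V$ in $L^2$, $L^p$ and $H^1$ of $\mathbb T^d$ with values in $\mathbb R^d$; $(\cdot,\cdot)$ is the inner product of $\mathbb H$, and $\mathcal P$ is the Leray projection (for $p=2$ the orthogonal projection of $L^2(\mathbb T^d;\mathbb R^d)$ onto $\mathbb H$). Let $\mathrm A\boldsymbol y=-\mathcal P\Delta\boldsymbol y$ with $\mathrm D(\mathrm A)=\mathbb V\cap H^2(\mathbb T^d;\mathbb R^d)$. Let $\mu,\alpha,\beta>0$, $\gamma\in\mathbb R$, $1\le q<r<\infty$ and $\boldsymbol y_e\in\mathrm D(\mathrm A)$. The operators with values in $(\mathbb V\cap\widetilde{\mathbb L}^{r+1})'=\mathbb V'+\widetilde{\mathbb L}^{(r+1)/r}$, which contains $\mathbb H$ by means of $(\cdot,\cdot)$,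 are given on $\mathbb V\cap\widetilde{\mathbb L}^{r+1}$ by $$\langle\mathrm A\boldsymbol y,\boldsymbol v\rangle=\int\nabla\boldsymbol y:\nabla\boldsymbol v,\qquad \mathcal B(\boldsymbol y)=\mathcal P[(\boldsymbol y\cdot\nabla)\boldsymbol y],\qquad \mathcal C_1(\boldsymbol y)=\mathcal P(|\boldsymbol y|^{r-1}\boldsymbol y),\qquad \mathcal C_2(\boldsymbol y)=\mathcal P(|\boldsymbol y|^{q-1}\boldsymbol y),$$ $$\widetilde{\mathcal B}(\boldsymbol y)=\mathcal B(\boldsymbol y+\boldsymbol y_e)-\mathcal B(\boldsymbol y_e),\qquad \widetilde{\mathcal C}_i(\boldsymbol y)=\mathcal C_i(\boldsymbol y+\boldsymbol y_e)-\mathcal C_i(\boldsymbol y_e).$$ Let $\mathcal K\subset\mathbb H$ be closed and convex with $\boldsymbol 0\in\mathcal K$ and $(\mathrm I+\lambda\mathrm A)^{-1}\mathcal K\subset\mathcal K$ for all $\lambda>0$, and let $\partial\mathrm I_{\mathcal K}$ be the subdifferential in $\mathbb H$ of the indicator function $\mathrm I_{\mathcal K}$ of $\mathcal K$ ($0$ on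 $\mathcal K$, $+\infty$ elsewhere). For $\kappa>0$ define the multivalued operator $$\mathfrak G(\boldsymbol y)=\mu\mathrm A\boldsymbol y+\widetilde{\mathcal B}(\boldsymbol y)+\alpha\boldsymbol y+\beta\widetilde{\mathcal C}_1(\boldsymbol y)+\gamma\widetilde{\mathcal C}_2(\boldsymbol y)+\partial\mathrm I_{\mathcal K}(\boldsymbol y)+\kappa\boldsymbol y\quad(\boldsymbol y\in\mathbb V\cap\widetilde{\mathbb L}^{r+1}),\qquad \mathfrak G(\boldsymbol y)=\varnothing\ \text{ for the other }\boldsymbol y\in\mathbb H,$$ with domain $\mathrm D(\mathfrak G)=\{\boldsymbol y\in\mathbb H:\varnothing\ne\mathfrak G(\boldsymbol y)\subset\mathbb H\}$. **Proposition.** Suppose that either $d\in\{2,3\}$ and $r>3$, or $d=r=3$ and $2\beta\mu>1$. Then there is $\kappa_0>0$, depending only on $d,\mu,\beta,\gamma,r,q$, such that for every $\kappa\ge\kappa_0$ the operator $\mathfrak G:\mathrm D(\mathfrak G)\multimap\mathbb H$ is maximal monotone in $\mathbb H\times\mathbb H$ (its graph is monotone and not properly contained in another monotone subset of $\mathbb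 H\times\mathbb H$), and $$\mathrm D(\mathfrak G)=\mathrm D(\mathrm A)\cap\mathrm D(\partial\mathrm I_{\mathcal K})=\mathrm D(\mathrm A)\cap\mathcal K,$$ where $\mathrm D(\partial\mathrm I_{\mathcal K})=\{\boldsymbol y\in\mathbb H:\partial\mathrm I_{\mathcal K}(\boldsymbol y)\neq\varnothing\}$. -/

import Mathlib

open MeasureTheory Topology
open scoped ContDiff ENNReal

noncomputable section

namespace CBFeD

/-! ### Monotone operators and subdifferentials in a real Hilbert space -/

section Monotone

variable {X : Type*} [NormedAddCommGroup X] [InnerProductSpace ℝ X]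

/-- A multivalued operator, given by its graph in `X × X`, is monotone. -/
def IsMonotoneGraph (G : Set (X × X)) : Prop :=
  ∀ p ∈ G, ∀ p' ∈ G, 0 ≤ inner ℝ (p.2 - p'.2) (p.1 - p'.1)

/-- A monotone graph which is not properly contained in any other monotone graph. -/
def IsMaximalMonotoneGraph (G : Set (X × X)) : Prop :=
  IsMonotoneGraph G ∧ ∀ G' : Set (X × X), IsMonotoneGraph G' → G ⊆ G' → G' = G

open Classical in
/-- The indicator function `I_K`, equal to `0` on `K` and to `+∞` off `K`. -/
def indicatorFn (K : Set X) (x : X) : EReal := if x ∈ K then 0 else ⊤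

/-- The subdifferential of `φ : X → (-∞, +∞]` at `x`. -/
def subdifferential (φ : X → EReal) (x : X) : Set X :=
  {ξ | ∀ z, φ x + ((inner ℝ ξ (z - x) : ℝ) : EReal) ≤ φ z}

/-- For a nonempty set `K`, the subdifferential of `I_K` is the normal cone of `K`. -/
theorem mem_subdifferential_indicatorFn {K : Set X} (hK : K.Nonempty) {x ξ : X} :
    ξ ∈ subdifferential (indicatorFn K) x ↔ x ∈ K ∧ ∀ z ∈ K, 0 ≤ inner ℝ ξ (x - z) := by
  have key : ∀ z, inner ℝ ξ (x - z) = - inner ℝ ξ (z - x) := by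
    intro z
    rw [← inner_neg_right, neg_sub]
  constructor
  · intro h
    have hx : x ∈ K := by
      by_contra hx
      obtain ⟨z, hz⟩ := hK
      have := h z
      simp [indicatorFn, hx, hz] at this
    refine ⟨hx, fun z hz => ?_⟩
    have := h z
    simp only [indicatorFn, hx, hz, if_true, zero_add] at this
    have h2 : inner ℝ ξ (z - x) ≤ 0 := by exact_mod_cast this
    rw [key]
    linarith
  · rintro ⟨hx, h⟩ z
    by_cases hz : z ∈ K
    · simp only [indicatorFn, hx, hz, if_true, zero_add]
      have := h z hz
      rw [key] at this
      have h2 : inner ℝ ξ (z - x) ≤ 0 := by linarith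
      exact_mod_cast h2
    · simp [indicatorFn, hz]

end Monotone

/-! ### Smooth periodic vector fields -/

/-- The torus `(ℝ / L ℤ)^d`; its `volume` is Lebesgue measure, of total mass `L ^ d`. -/
abbrev Torus (d : ℕ) (L : ℝ) := Fin d → AddCircle L

/-- `ℝ^d` with its Euclidean norm. -/
abbrev E (d : ℕ) := EuclideanSpace ℝ (Fin d)

/-- The covering map `ℝ^d → (ℝ / L ℤ)^d`. -/
def proj (d : ℕ) (L : ℝ) (x : Fin d → ℝ) : Torus d L := fun i => (x i : AddCircle L)

/-- A function on the torus is smooth if the corresponding periodic function on `ℝ^d` is. -/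
def IsSmooth {d : ℕ} {L : ℝ} (f : Torus d L → E d) : Prop :=
  ContDiff ℝ ∞ (fun x => f (proj d L x))

/-- The partial derivative `∂_i f`, as a function on the torus. -/
def pderivFun {d : ℕ} {L : ℝ} (i : Fin d) (f : Torus d L → E d) (t : Torus d L) : E d :=
  deriv (fun s : ℝ => f (t + Pi.single i (s : AddCircle L))) 0

theorem isOpenQuotientMap_proj (d : ℕ) (L : ℝ) : IsOpenQuotientMap (proj d L) :=
  IsOpenQuotientMap.piMap (fun _ : Fin d => QuotientAddGroup.isOpenQuotientMap_mk)

theorem proj_add_single {d : ℕ} {L : ℝ} (x : Fin d → ℝ) (i : Fin d) (s : ℝ) :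
    proj d L x + Pi.single i (s : AddCircle L) = proj d L (x + s • Pi.single i (1 : ℝ)) := by
  funext j
  by_cases h : j = i
  · subst h
    simp [proj]
  · simp [proj, h]

theorem IsSmooth.hasDerivAt {d : ℕ} {L : ℝ} {f : Torus d L → E d} (hf : IsSmooth f)
    (i : Fin d) (x : Fin d → ℝ) :
    HasDerivAt (fun s : ℝ => f (proj d L x + Pi.single i (s : AddCircle L)))
      (fderiv ℝ (fun x => f (proj d L x)) x (Pi.single i (1 : ℝ))) 0 := by
  have h1 : HasFDerivAt (fun x => f (proj d L x)) (fderiv ℝ (fun x => f (proj d L x)) x)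
      (x + (0 : ℝ) • Pi.single i (1 : ℝ)) := by
    simpa using (ContDiff.differentiable hf (by simp) x).hasFDerivAt
  have h2 : HasDerivAt (fun s : ℝ => x + s • (Pi.single i (1 : ℝ) : Fin d → ℝ))
      (Pi.single i (1 : ℝ)) 0 := by
    simpa using ((hasDerivAt_id (0 : ℝ)).smul_const
      (Pi.single i (1 : ℝ) : Fin d → ℝ)).const_add x
  simpa only [proj_add_single, Function.comp_def] using h1.comp_hasDerivAt (0 : ℝ) h2

theorem IsSmooth.pderivFun_proj {d : ℕ} {L : ℝ} {f : Torus d L → E d} (hf : IsSmooth f)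
    (i : Fin d) (x : Fin d → ℝ) :
    pderivFun i f (proj d L x) =
      fderiv ℝ (fun x => f (proj d L x)) x (Pi.single i (1 : ℝ)) :=
  (hf.hasDerivAt i x).deriv

theorem IsSmooth.pderivFun {d : ℕ} {L : ℝ} {f : Torus d L → E d} (hf : IsSmooth f)
    (i : Fin d) : IsSmooth (pderivFun i f) := by
  unfold IsSmooth
  simp only [hf.pderivFun_proj]
  exact (ContDiff.fderiv_right hf (by simp)).clm_apply contDiff_const

theorem IsSmooth.continuous {d : ℕ} {L : ℝ} {f : Torus d L → E d} (hf : IsSmooth f) :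
    Continuous f :=
  (isOpenQuotientMap_proj d L).isQuotientMap.continuous_iff.2 (ContDiff.continuous hf)

/-- The space `C_p^∞(𝕋^d; ℝ^d)` of smooth periodic vector fields. -/
def smoothFields (d : ℕ) (L : ℝ) : Submodule ℝ C(Torus d L, E d) where
  carrier := {f | IsSmooth (f : Torus d L → E d)}
  add_mem' {f g} (hf : IsSmooth f) (hg : IsSmooth g) :=
    show ContDiff ℝ ∞ (fun x => f (proj d L x) + g (proj d L x)) from ContDiff.add hf hg
  zero_mem' := show ContDiff ℝ ∞ (fun _ => (0 : E d)) from contDiff_const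
  smul_mem' c f (hf : IsSmooth f) :=
    show ContDiff ℝ ∞ (fun x => c • f (proj d L x)) from ContDiff.const_smul c hf

/-- The partial derivative `∂_i` on `C_p^∞(𝕋^d; ℝ^d)`. -/
def pderiv {d : ℕ} {L : ℝ} (i : Fin d) : smoothFields d L →ₗ[ℝ] smoothFields d L where
  toFun f := ⟨⟨pderivFun i f.1, (IsSmooth.pderivFun f.2 i).continuous⟩,
    IsSmooth.pderivFun f.2 i⟩
  map_add' f g := by
    ext1
    ext1 t
    obtain ⟨x, rfl⟩ := (isOpenQuotientMap_proj d L).surjective t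
    exact ((IsSmooth.hasDerivAt f.2 i x).add (IsSmooth.hasDerivAt g.2 i x)).deriv.trans
      (congrArg₂ (· + ·) (IsSmooth.pderivFun_proj f.2 i x).symm
        (IsSmooth.pderivFun_proj g.2 i x).symm)
  map_smul' c f := by
    ext1
    ext1 t
    obtain ⟨x, rfl⟩ := (isOpenQuotientMap_proj d L).surjective t
    exact ((IsSmooth.hasDerivAt f.2 i x).const_smul c).deriv.trans
      (congrArg (c • ·) (IsSmooth.pderivFun_proj f.2 i x).symm)

/-- The space `𝒱` of divergence-free smooth periodic vector fields. -/
def solenoidal (d : ℕ) (L : ℝ) : Submodule ℝ (smoothFields d L) where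
  carrier := {f | ∀ t, ∑ i, (pderiv i f).1 t i = 0}
  add_mem' {f g} hf hg t := by
    have h1 := hf t
    have h2 := hg t
    simp [Finset.sum_add_distrib, h1, h2]
  zero_mem' t := by simp
  smul_mem' c f hf t := by
    have h1 := hf t
    simp [← Finset.mul_sum, h1]

variable (d : ℕ) (L : ℝ) [Fact (0 < L)]

/-! ### Function spaces -/

/-- `L²(𝕋^d; ℝ^d)`. -/
abbrev L2 := Lp (E d) 2 (volume : Measure (Torus d L))

variable {d L} in
/-- The class in `L²` of a smooth field. -/
def toL2 : smoothFields d L →ₗ[ℝ] L2 d L :=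
  (ContinuousMap.toLp 2 (volume : Measure (Torus d L)) ℝ).toLinearMap ∘ₗ
    (smoothFields d L).subtype

/-- `ℍ`: the closure of `𝒱` in `L²`, a Hilbert space with the inner product of `L²`. -/
abbrev H : Submodule ℝ (L2 d L) := ((solenoidal d L).map toL2).topologicalClosure

/-- The pairs `(u, ∇u)` with `u ∈ H¹_p`, where `H¹_p` is the completion of the smooth fields in
the `H¹` norm: the closure in `L² × (L²)^d` of the pairs `(f, ∇f)`. -/
def h1Graph : Set (L2 d L × (Fin d → L2 d L)) :=
  closure (Set.range fun f : smoothFields d L => (toL2 f, fun i => toL2 (pderiv i f)))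

/-- The pairs `(u, ∇u)` with `u ∈ 𝕍`, where `𝕍` is the closure of `𝒱` in `H¹`. -/
def vGraph : Set (L2 d L × (Fin d → L2 d L)) :=
  closure ((fun f : smoothFields d L => (toL2 f, fun i => toL2 (pderiv i f))) '' solenoidal d L)

/-- The triples `(u, ∇u, ∇²u)` with `u ∈ H²_p`, the completion of the smooth fields in the
`H²` norm. -/
def h2Graph : Set (L2 d L × (Fin d → L2 d L) × (Fin d → Fin d → L2 d L)) :=
  closure (Set.range fun f : smoothFields d L =>
    (toL2 f, (fun i => toL2 (pderiv i f)), fun i j => toL2 (pderiv i (pderiv j f))))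

/-- The space `𝕍`, as a subset of `ℍ`. -/
def V : Set (H d L) := {u | ∃ g, ((u : L2 d L), g) ∈ vGraph d L}

/-- The domain `D(A) = 𝕍 ∩ H²_p` of the Stokes operator. -/
def DA : Set (H d L) := {u | u ∈ V d L ∧ ∃ p, ((u : L2 d L), p) ∈ h2Graph d L}

variable {d L}

/-- Membership in `L̃^p`, the closure of `𝒱` in `L^p`, `p ≥ 2`. -/
def MemLtilde (p : ℝ) (u : H d L) : Prop :=
  ∀ ε : ℝ≥0∞, 0 < ε → ∃ f ∈ solenoidal d L,
    eLpNorm (fun t => (u : L2 d L) t - f.1 t) (ENNReal.ofReal p) volume < ε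

variable (d L) in
/-- `𝕍 ∩ L̃^p`. -/
def VL (p : ℝ) : Set (H d L) := {u | u ∈ V d L ∧ MemLtilde p u}

open Classical in
/-- The weak gradient `(∂_i u)_i` of `u ∈ H¹_p` (zero if `u ∉ H¹_p`). -/
def grad (u : L2 d L) : Fin d → L2 d L :=
  if h : ∃ g, (u, g) ∈ h1Graph d L then h.choose else 0

open Classical in
/-- The Laplacian `Δu = ∑ᵢ ∂ᵢ∂ᵢu` of `u ∈ H²_p` (zero if `u ∉ H²_p`). -/
def laplacian (u : L2 d L) : L2 d L :=
  if h : ∃ p, (u, p) ∈ h2Graph d L then ∑ i, h.choose.2 i i else 0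

/-- The Leray projection `𝒫`, i.e. the orthogonal projection of `L²` onto `ℍ`. -/
def leray : L2 d L →L[ℝ] H d L := (H d L).orthogonalProjectionOnto

/-- The Stokes operator `A y = - 𝒫 Δ y`, for `y ∈ D(A)`. -/
def stokes (y : H d L) : H d L := -leray (laplacian (y : L2 d L))

/-! ### The operators with values in the dual of `𝕍 ∩ L̃^{r+1}`

Each of them is given by its duality pairing with a (divergence-free) `v`; as `v` is
divergence-free, the pairing of `𝒫 w` with `v` is `∫ w · v`. -/

/-- `⟨A y, v⟩ = ∫ ∇y : ∇v`. -/
def stokesForm (y v : H d L) : ℝ :=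
  ∑ i, inner ℝ (grad (y : L2 d L) i) (grad (v : L2 d L) i)

/-- The trilinear form `b(y, z, w) = ∑_{i,j} ∫ y_i (∂_i z_j) w_j`. -/
def trilinear (y z w : H d L) : ℝ :=
  ∑ i, ∑ j, ∫ t, (y : L2 d L) t i * (grad (z : L2 d L) i) t j * (w : L2 d L) t j

/-- `⟨𝓒 y, v⟩ = ∫ |y|^{p-1} y · v` for the operator `𝓒 y = 𝒫 (|y|^{p-1} y)`. -/
def powerForm (p : ℝ) (y v : H d L) : ℝ :=
  ∫ t, ‖(y : L2 d L) t‖ ^ (p - 1) * inner ℝ ((y : L2 d L) t) ((v : L2 d L) t)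

/-- `⟨B̃ y, v⟩`, where `B̃ y = B (y + yₑ) - B yₑ` and `⟨B y, v⟩ = b(y, y, v)`. -/
def convTilde (ye y v : H d L) : ℝ :=
  trilinear (y + ye) (y + ye) v - trilinear ye ye v

/-- `⟨C̃ y, v⟩`, where `C̃ y = 𝓒 (y + yₑ) - 𝓒 yₑ` and `𝓒 y = 𝒫 (|y|^{p-1} y)`. -/
def powerTilde (p : ℝ) (ye y v : H d L) : ℝ :=
  powerForm p (y + ye) v - powerForm p ye v

/-- The set of functionals on `𝕍 ∩ L̃^{r+1}`
`𝔊(y) = μ A y + B̃ y + α y + β C̃₁ y + γ C̃₂ y + ∂I_K(y) + κ y`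
for `y ∈ 𝕍 ∩ L̃^{r+1}`, and `𝔊(y) = ∅` for the other `y ∈ ℍ`. -/
def opG (μ α β γ r q κ : ℝ) (ye : H d L) (K : Set (H d L)) (y : H d L) :
    Set (VL d L (r + 1) → ℝ) :=
  {F | y ∈ VL d L (r + 1) ∧ ∃ ξ ∈ subdifferential (indicatorFn K) y,
    F = fun v : VL d L (r + 1) => μ * stokesForm y v + convTilde ye y v + α * inner ℝ y (v : H d L)
      + β * powerTilde r ye y v + γ * powerTilde q ye y v
      + inner ℝ ξ (v : H d L) + κ * inner ℝ y (v : H d L)}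

/-- The embedding of `ℍ` into the functionals on `𝕍 ∩ L̃^p`. -/
def embed (p : ℝ) (h : H d L) : VL d L p → ℝ := fun v => inner ℝ h (v : H d L)

/-- `D(𝔊) = {y ∈ ℍ : ∅ ≠ 𝔊(y) ⊆ ℍ}`. -/
def domG (μ α β γ r q κ : ℝ) (ye : H d L) (K : Set (H d L)) : Set (H d L) :=
  {y | (opG μ α β γ r q κ ye K y).Nonempty ∧
    opG μ α β γ r q κ ye K y ⊆ Set.range (embed (r + 1))}

/-- The graph of `𝔊 : D(𝔊) ⊸ ℍ`, as a subset of `ℍ × ℍ`. -/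
def graphG (μ α β γ r q κ : ℝ) (ye : H d L) (K : Set (H d L)) : Set (H d L × H d L) :=
  {p | p.1 ∈ domG μ α β γ r q κ ye K ∧ embed (r + 1) p.2 ∈ opG μ α β γ r q κ ye K p.1}

/-- The assumption on the constraint set: `K ⊆ ℍ` is closed and convex, `0 ∈ K`, and
`(I + λ A)⁻¹ K ⊆ K` for all `λ > 0`. -/
structure IsAdmissible (K : Set (H d L)) : Prop where
  isClosed : IsClosed K
  convex : Convex ℝ K
  zero_mem : (0 : H d L) ∈ K
  resolvent_mem : ∀ l : ℝ, 0 < l → ∀ y ∈ DA d L, y + l • stokes y ∈ K → y ∈ K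

end CBFeD

end

set_option linter.unusedSectionVars false

noncomputable section

namespace CBFeD

/-! ### Metric projections, strongly monotone maps and Minty's criterion in a Hilbert space. -/

section Hilbert

variable {X : Type*} [NormedAddCommGroup X] [InnerProductSpace ℝ X]

/-! Maximality comes from Minty's criterion (`isMaximalMonotoneGraph_of_range`): a monotone graph G
with R(I + G) equal to the whole space is maximal. So there are three tasks: monotonicity,
solvability of f ∈ y + 𝔊(y), and D(A)-regularity of the elements of D(𝔊).

Monotonicity (`exists_monotone`). With W = Y - Z, antisymmetry of b turns b(Y,Y,W) - b(Z,Z,W) into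
-b(W,W,Z), whose modulus is at most μ‖∇W‖² + (1/4μ) ∫|Z|²|W|². The damping tested with W is at least
(β/2) ∫(|Y|^{r-1} + |Z|^{r-1})|W|². If r > 3 the power r - 1 beats 2; if r = 3 one needs 1/(4μ) <
β/2, that is 2βμ > 1. The γ term has the lower power q - 1. All that is left over is k‖W‖², and κ
absorbs it, so κ₀ = k.

Solvability (`exists_variational`). The inclusion is a variational inequality on K. It is
approximated by Fourier truncation together with the penalty l⁻¹(y - P_K y), the Yosida
approximation of ∂I_K; the approximate problem is strongly monotone and locally Lipschitz. Two
bounds are uniform in the approximation. Testing with y uses the monotonicity above and 0 ∈ K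
(`exists_energy_bound`, `exists_approx_bound`). Testing with Ay (`exists_stokes_bound`) uses the
resolvent condition on K, which makes (y - P_K y, Ay) nonnegative, and the fact that on the torus Au
= -Δu for smooth solenoidal u: then ∫|u|^{r-1}u·(-Δu) ≥ ∫|u|^{r-1}|∇u|², which absorbs the
convective term under the very same condition on r, β, μ. Since the nonlinearity acts on y + yₑ, a
term tested with Ayₑ remains; it is sublinear in the dissipation by a Sobolev inequality
(`exists_abs_nform_le`). Bounds in D(A) give compactness in ℍ, convergence of gradients by
interpolation, and a bound in L^∞ because d ≤ 3, so all terms pass to the limit.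

Regularity (`domG_eq`). If y ∈ D(𝔊), then, as 0 ∈ ∂I_K(y), the single-valued part of the operator at
y is some h ∈ ℍ. The unconstrained problem (K = ℍ) with right-hand side h has a solution in D(A),
and strong monotonicity identifies it with y.

The spaces 𝕍, D(A) and the operator A are handled through Fourier coefficients (`mem_H_iff`,
`mem_V_iff`, `mem_DA_iff`, `fc_stokes`). -/

theorem exists_metricProj [CompleteSpace X] {K : Set X} (hK : IsClosed K) (hc : Convex ℝ K)
    (hne : K.Nonempty) (x : X) : ∃ p ∈ K, ∀ z ∈ K, inner ℝ (x - p) (z - p) ≤ 0 := by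
  obtain ⟨p, hp, h⟩ := exists_norm_eq_iInf_of_complete_convex hne hK.isComplete hc x
  exact ⟨p, hp, (norm_eq_iInf_iff_real_inner_le_zero hc hp).1 h⟩

open Classical in
/-- The metric projection onto a nonempty closed convex set. -/
def metricProj (K : Set X) (x : X) : X :=
  if h : ∃ p ∈ K, ∀ z ∈ K, inner ℝ (x - p) (z - p) ≤ 0 then h.choose else x

variable [CompleteSpace X] {K : Set X}

theorem metricProj_mem (hK : IsClosed K) (hc : Convex ℝ K) (hne : K.Nonempty) (x : X) :
    metricProj K x ∈ K := by
  have h := exists_metricProj hK hc hne x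
  rw [metricProj, dif_pos h]
  exact h.choose_spec.1

theorem inner_sub_metricProj_le (hK : IsClosed K) (hc : Convex ℝ K) (x : X) {z : X}
    (hz : z ∈ K) : inner ℝ (x - metricProj K x) (z - metricProj K x) ≤ 0 := by
  have h := exists_metricProj hK hc ⟨z, hz⟩ x
  rw [metricProj, dif_pos h]
  exact h.choose_spec.2 z hz

theorem norm_sub_metricProj_le (hK : IsClosed K) (hc : Convex ℝ K) (x : X) {z : X}
    (hz : z ∈ K) : ‖x - metricProj K x‖ ≤ ‖x - z‖ := by
  have h := inner_sub_metricProj_le hK hc x hz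
  have e : x - z = (x - metricProj K x) - (z - metricProj K x) := by abel
  have h2 := norm_sub_sq_real (x - metricProj K x) (z - metricProj K x)
  rw [← e] at h2
  refine (sq_le_sq₀ (norm_nonneg _) (norm_nonneg _)).1 ?_
  nlinarith [sq_nonneg ‖z - metricProj K x‖]

/-- Firm nonexpansiveness: add the variational inequalities of the two projections, each tested with
the other projection. -/
theorem inner_metricProj_sub_ge (hK : IsClosed K) (hc : Convex ℝ K) (hne : K.Nonempty) (x y : X) :
    ‖metricProj K x - metricProj K y‖ ^ 2 ≤
      inner ℝ (x - y) (metricProj K x - metricProj K y) := by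
  have h1 := inner_sub_metricProj_le hK hc x (metricProj_mem hK hc hne y)
  have h2 := inner_sub_metricProj_le hK hc y (metricProj_mem hK hc hne x)
  rw [← real_inner_self_eq_norm_sq]
  simp only [inner_sub_left, inner_sub_right] at *
  linarith

theorem norm_metricProj_sub_le (hK : IsClosed K) (hc : Convex ℝ K) (hne : K.Nonempty) (x y : X) :
    ‖metricProj K x - metricProj K y‖ ≤ ‖x - y‖ := by
  have h := (inner_metricProj_sub_ge hK hc hne x y).trans (real_inner_le_norm _ _)
  by_contra! hlt
  nlinarith [norm_nonneg (x - y)]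

/-- This is the monotonicity of the Yosida approximation of the normal cone, needed for the
penalised problem. -/
theorem inner_sub_metricProj_sub_nonneg (hK : IsClosed K) (hc : Convex ℝ K) (hne : K.Nonempty)
    (x y : X) :
    0 ≤ inner ℝ ((x - metricProj K x) - (y - metricProj K y)) (x - y) := by
  have h := norm_metricProj_sub_le hK hc hne x y
  have e : (x - metricProj K x) - (y - metricProj K y)
    = (x - y) - (metricProj K x - metricProj K y) := by abel
  rw [e, inner_sub_left, real_inner_self_eq_norm_sq]
  have := real_inner_le_norm (metricProj K x - metricProj K y) (x - y)
  nlinarith [norm_nonneg (x - y)]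

/-- The gradient inequality for `x ↦ dist(x, K)² / 2`. -/
theorem inner_sub_metricProj_le_half (hK : IsClosed K) (hc : Convex ℝ K) (hne : K.Nonempty)
    (u x : X) :
    inner ℝ (u - metricProj K u) (x - u) ≤
      ‖x - metricProj K x‖ ^ 2 / 2 - ‖u - metricProj K u‖ ^ 2 / 2 := by
  -- Split x - u into the difference of the residuals and the difference of the projections; the
  -- latter pairs nonpositively with the residual at u, and Young's inequality handles the rest.
  have h1 := inner_sub_metricProj_le hK hc u (metricProj_mem hK hc hne x)
  have e : x - u = (x - metricProj K x) - (u - metricProj K u)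
    + (metricProj K x - metricProj K u) := by abel
  rw [e, inner_add_right, inner_sub_right, real_inner_self_eq_norm_sq]
  have := real_inner_le_norm (u - metricProj K u) (x - metricProj K x)
  nlinarith [sq_nonneg (‖u - metricProj K u‖ - ‖x - metricProj K x‖)]

/-- A strongly monotone map which is Lipschitz on every ball is surjective. -/
theorem exists_eq_of_stronglyMonotone {F : X → X} {c : ℝ} (hc : 0 < c)
    (hmono : ∀ x y, c * ‖x - y‖ ^ 2 ≤ inner ℝ (F x - F y) (x - y))
    (hlip : ∀ R : ℝ, ∃ M : ℝ, ∀ x y, ‖x‖ ≤ R → ‖y‖ ≤ R → ‖F x - F y‖ ≤ M * ‖x - y‖) (f : X) :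
    ∃ x, F x = f := by
  -- Strong monotonicity confines any solution to radius ‖f - F 0‖ / c; the extra 1 leaves room for
  -- a unit step inside the ball.
  set R : ℝ := ‖f - F 0‖ / c + 1 with hR
  have hRpos : 0 < R := by positivity
  obtain ⟨M₀, hM₀⟩ := hlip R
  set M := max M₀ c with hM
  have hMpos : 0 < M := lt_of_lt_of_le hc (le_max_right _ _)
  have hML : ∀ x y, ‖x‖ ≤ R → ‖y‖ ≤ R → ‖F x - F y‖ ≤ M * ‖x - y‖ := fun x y hx hy =>
    (hM₀ x y hx hy).trans (by gcongr; exact le_max_left _ _)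
  set B : Set X := Metric.closedBall 0 R with hB
  have hBc : IsClosed B := Metric.isClosed_closedBall
  have hBconv : Convex ℝ B := convex_closedBall 0 R
  have hB0 : (0 : X) ∈ B := by simp [hB, hRpos.le]
  have hBne : B.Nonempty := ⟨0, hB0⟩
  -- This step size minimises 1 - 2τc + τ²M², the square of the contraction factor, whose minimum is
  -- 1 - c²/M².
  set τ : ℝ := c / M ^ 2 with hτ
  have hτpos : 0 < τ := by positivity
  have hcM : c ≤ M := le_max_right _ _
  set k : ℝ := Real.sqrt (1 - c ^ 2 / M ^ 2) with hk
  have hk1 : k < 1 := by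
    rw [hk, Real.sqrt_lt' one_pos]
    have : 0 < c ^ 2 / M ^ 2 := by positivity
    linarith
  have hkn : 0 ≤ 1 - c ^ 2 / M ^ 2 := by
    rw [sub_nonneg, div_le_one (by positivity)]
    gcongr
  -- Projecting the argument as well makes T a contraction of the whole space although F is
  -- Lipschitz only on balls.
  let T : X → X := fun x => metricProj B (metricProj B x - τ • (F (metricProj B x) - f))
  have hT : ContractingWith ⟨k, Real.sqrt_nonneg _⟩ T := by
    refine ⟨by exact_mod_cast hk1, LipschitzWith.of_dist_le_mul fun x y => ?_⟩
    simp only [dist_eq_norm]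
    refine (norm_metricProj_sub_le hBc hBconv hBne _ _).trans ?_
    set a := metricProj B x
    set b := metricProj B y
    have ha : ‖a‖ ≤ R := by simpa [hB] using metricProj_mem hBc hBconv hBne x
    have hb : ‖b‖ ≤ R := by simpa [hB] using metricProj_mem hBc hBconv hBne y
    have hab : ‖a - b‖ ≤ ‖x - y‖ := norm_metricProj_sub_le hBc hBconv hBne x y
    have e : a - τ • (F a - f) - (b - τ • (F b - f)) = (a - b) - τ • (F a - F b) := by
      simp only [smul_sub]; abel
    rw [e]
    have h1 := norm_sub_sq_real (a - b) (τ • (F a - F b))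
    rw [real_inner_smul_right, norm_smul, Real.norm_of_nonneg hτpos.le] at h1
    have h2 := hmono a b
    rw [real_inner_comm] at h2
    have h3 := hML a b ha hb
    have h4 : ‖F a - F b‖ ^ 2 ≤ M ^ 2 * ‖a - b‖ ^ 2 := by
      rw [← mul_pow]; gcongr
    have h5 : ‖(a - b) - τ • (F a - F b)‖ ^ 2 ≤ (1 - c ^ 2 / M ^ 2) * ‖a - b‖ ^ 2 := by
      have h6 : τ * (c * ‖a - b‖ ^ 2) ≤ τ * inner ℝ (a - b) (F a - F b) := by gcongr
      have h7 : τ ^ 2 * ‖F a - F b‖ ^ 2 ≤ τ ^ 2 * (M ^ 2 * ‖a - b‖ ^ 2) := by gcongr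
      have h8 : τ * (c * ‖a - b‖ ^ 2) = c ^ 2 / M ^ 2 * ‖a - b‖ ^ 2 := by
        rw [hτ]; ring
      have h9 : τ ^ 2 * (M ^ 2 * ‖a - b‖ ^ 2) = c ^ 2 / M ^ 2 * ‖a - b‖ ^ 2 := by
        rw [hτ]; field_simp
      rw [h1]
      nlinarith
    refine le_trans (Real.le_sqrt_of_sq_le h5) ?_
    rw [Real.sqrt_mul hkn, Real.sqrt_sq (norm_nonneg _)]
    exact mul_le_mul_of_nonneg_left hab (Real.sqrt_nonneg _)
  obtain ⟨x, hx⟩ : ∃ x, T x = x := ⟨_, hT.fixedPoint_isFixedPt⟩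
  have hxB : x ∈ B := hx ▸ metricProj_mem hBc hBconv hBne _
  have hpx : metricProj B x = x := by
    have := norm_sub_metricProj_le hBc hBconv x hxB
    rw [sub_self, norm_zero] at this
    exact (sub_eq_zero.1 (norm_eq_zero.1 (le_antisymm this (norm_nonneg _)))).symm
  -- A fixed point solves the variational inequality on the ball; the a priori bound will show that
  -- the constraint is inactive.
  have hvi : ∀ z ∈ B, 0 ≤ inner ℝ (F x - f) (z - x) := by
    intro z hz
    have h := inner_sub_metricProj_le hBc hBconv (metricProj B x - τ • (F (metricProj B x) - f)) hz
    rw [show metricProj B (metricProj B x - τ • (F (metricProj B x) - f)) = x from hx, hpx,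
      show x - τ • (F x - f) - x = -(τ • (F x - f)) by abel, inner_neg_left,
      real_inner_smul_left] at h
    by_contra! hneg
    nlinarith
  have hxR : c * ‖x‖ ≤ ‖f - F 0‖ := by
    have h0 := hvi 0 hB0
    have h1 := hmono x 0
    have h2 := real_inner_le_norm (f - F 0) x
    simp only [zero_sub, inner_neg_right, sub_zero] at h0 h1
    have h3 : inner ℝ (F x - F 0) x = inner ℝ (F x - f) x + inner ℝ (f - F 0) x := by
      rw [← inner_add_left]; congr 1; abel
    by_cases hx0 : ‖x‖ = 0
    · rw [hx0]; simp
    · have : 0 < ‖x‖ := lt_of_le_of_ne (norm_nonneg _) (Ne.symm hx0)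
      refine le_of_mul_le_mul_right ?_ this
      nlinarith
  have hxlt : ‖x‖ ≤ R - 1 := by
    rw [hR, add_sub_cancel_right, le_div_iff₀ hc]; linarith
  refine ⟨x, ?_⟩
  set v := F x - f
  by_contra hne
  have hv : 0 < ‖v‖ := norm_pos_iff.2 (sub_ne_zero.2 hne)
  -- A unit step against the residual v stays in the ball, so the variational inequality forces v =
  -- 0.
  have hz : x - ‖v‖⁻¹ • v ∈ B := by
    simp only [hB, Metric.mem_closedBall, dist_zero_right]
    refine (norm_sub_le _ _).trans ?_
    rw [norm_smul, norm_inv, norm_norm, inv_mul_cancel₀ hv.ne']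
    linarith
  have h := hvi _ hz
  rw [sub_sub_cancel_left, inner_neg_right, real_inner_smul_right,
    real_inner_self_eq_norm_sq] at h
  have : 0 < ‖v‖⁻¹ * ‖v‖ ^ 2 := by positivity
  linarith

/-- A monotone graph `G` with `R(I + G) = X` is maximal monotone. -/
theorem isMaximalMonotoneGraph_of_range {X : Type*} [NormedAddCommGroup X]
    [InnerProductSpace ℝ X] {G : Set (X × X)} (hG : IsMonotoneGraph G)
    (hr : ∀ f, ∃ p ∈ G, p.2 + p.1 = f) : IsMaximalMonotoneGraph G := by
  refine ⟨hG, fun G' hG' hsub => Set.Subset.antisymm (fun p hp => ?_) hsub⟩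
  -- Compare p with the point of G having the same sum of components: the two differences are
  -- opposite, so monotonicity reads -‖p.1 - p'.1‖² ≥ 0.
  obtain ⟨p', hp', he⟩ := hr (p.2 + p.1)
  have h := hG' p hp p' (hsub hp')
  have e : p.2 - p'.2 = -(p.1 - p'.1) := by
    have : p.2 = p'.2 + p'.1 - p.1 := by rw [he]; abel
    rw [this]; abel
  rw [e, inner_neg_left, real_inner_self_eq_norm_sq] at h
  have h0 : ‖p.1 - p'.1‖ = 0 := by
    have := sq_nonneg ‖p.1 - p'.1‖
    exact pow_eq_zero_iff two_ne_zero |>.1 (le_antisymm (by linarith) this)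
  have h1 : p.1 = p'.1 := sub_eq_zero.1 (norm_eq_zero.1 h0)
  have h2 : p.2 = p'.2 := by rw [h1, sub_self, neg_zero] at e; exact sub_eq_zero.1 e
  rwa [Prod.ext h1 h2]

end Hilbert

/-! ### Scalar inequalities between powers. -/

section Scalar

/-- Let M solve ε M^(b-a) = 1. Below M the left side is at most the constant M^a; above M it is at
most ε s^b. -/
theorem exists_rpow_le_mul_rpow_add {a b ε : ℝ} (ha : 0 ≤ a) (hab : a < b) (hε : 0 < ε) :
    ∃ C : ℝ, 0 < C ∧ ∀ s : ℝ, 0 ≤ s → s ^ a ≤ ε * s ^ b + C := by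
  set M : ℝ := (1 / ε) ^ (1 / (b - a)) with hM
  have hMpos : 0 < M := by positivity
  have hba : 0 < b - a := sub_pos.2 hab
  refine ⟨M ^ a, by positivity, fun s hs => ?_⟩
  rcases le_total s M with h | h
  · have h1 : s ^ a ≤ M ^ a := Real.rpow_le_rpow hs h ha
    have h2 : 0 ≤ ε * s ^ b := by positivity
    linarith
  · have hs' : 0 < s := hMpos.trans_le h
    have h1 : M ^ (b - a) ≤ s ^ (b - a) := Real.rpow_le_rpow hMpos.le h hba.le
    rw [hM, ← Real.rpow_mul (by positivity), one_div_mul_cancel hba.ne', Real.rpow_one] at h1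
    have h2 : s ^ b = s ^ (b - a) * s ^ a := by rw [← Real.rpow_add hs']; congr 1; ring
    have h3 : 1 ≤ ε * s ^ (b - a) := by
      rw [div_le_iff₀ hε] at h1; linarith
    have h4 : 0 < s ^ a := by positivity
    have h5 : 0 < M ^ a := by positivity
    rw [h2]
    nlinarith

/-- The hypothesis on the exponent enters the whole proof through this inequality. It is applied
with (A, b) = (1/(4μ), β/2) for monotonicity and with (1/(2μ), β) for the estimate in D(A); for r =
3 both requirements A < b say 2βμ > 1. The surplus δ yields the coercivity behind the a priori
bounds. -/
theorem exists_absorb {A B b q r : ℝ} (hA : 0 ≤ A) (hB : 0 ≤ B) (hb : 0 < b) (hq : 1 ≤ q)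
    (hqr : q < r) (h : 3 < r ∨ r = 3 ∧ A < b) :
    ∃ δ : ℝ, 0 < δ ∧ ∃ k : ℝ, 0 < k ∧ ∀ s : ℝ, 0 ≤ s →
      A * s ^ 2 + B * s ^ (q - 1) + δ * s ^ (r - 1) ≤ b * s ^ (r - 1) + k := by
  rcases h with h | ⟨h, hAb⟩
  · obtain ⟨C1, hC1, H1⟩ := exists_rpow_le_mul_rpow_add (a := 2) (b := r - 1)
      (ε := b / (4 * (A + 1))) (by norm_num) (by linarith) (by positivity)
    obtain ⟨C2, hC2, H2⟩ := exists_rpow_le_mul_rpow_add (a := q - 1) (b := r - 1)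
      (ε := b / (4 * (B + 1))) (by linarith) (by linarith) (by positivity)
    refine ⟨b / 4, by positivity, A * C1 + B * C2 + 1, by positivity, fun s hs => ?_⟩
    have h1 := H1 s hs
    have h2 := H2 s hs
    rw [Real.rpow_two] at h1
    have hp : 0 ≤ s ^ (r - 1) := by positivity
    have e1 : A * (b / (4 * (A + 1)) * s ^ (r - 1)) ≤ b / 4 * s ^ (r - 1) := by
      rw [← mul_assoc]; gcongr
      rw [mul_div_assoc', div_le_div_iff₀ (by positivity) (by positivity)]
      nlinarith
    have e2 : B * (b / (4 * (B + 1)) * s ^ (r - 1)) ≤ b / 4 * s ^ (r - 1) := by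
      rw [← mul_assoc]; gcongr
      rw [mul_div_assoc', div_le_div_iff₀ (by positivity) (by positivity)]
      nlinarith
    have e3 := mul_le_mul_of_nonneg_left h1 hA
    have e4 := mul_le_mul_of_nonneg_left h2 hB
    nlinarith
  · subst h
    obtain ⟨C2, hC2, H2⟩ := exists_rpow_le_mul_rpow_add (a := q - 1) (b := 3 - 1)
      (ε := (b - A) / (2 * (B + 1))) (by linarith) (by linarith)
      (div_pos (by linarith) (by positivity))
    refine ⟨(b - A) / 2, by linarith, B * C2 + 1, by positivity, fun s hs => ?_⟩
    have h2 := H2 s hs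
    have e0 : s ^ ((3 : ℝ) - 1) = s ^ 2 := by norm_num
    rw [e0] at h2 ⊢
    have hp : 0 ≤ s ^ 2 := by positivity
    have e2 : B * ((b - A) / (2 * (B + 1)) * s ^ 2) ≤ (b - A) / 2 * s ^ 2 := by
      rw [← mul_assoc]; gcongr
      rw [mul_div_assoc', div_le_div_iff₀ (by positivity) (by positivity)]
      nlinarith
    have e4 := mul_le_mul_of_nonneg_left h2 hB
    nlinarith

/-- Bernoulli's inequality for the power s + 1 of b / a. Unlike a mean value estimate for a^s, it
needs no lower bound on b or s. -/
theorem rpow_sub_rpow_mul_le {a b s : ℝ} (hb : 0 ≤ b) (hba : b ≤ a) (hs : 0 ≤ s) :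
    (a ^ s - b ^ s) * b ≤ s * a ^ s * (a - b) := by
  rcases hb.eq_or_lt with rfl | hb'
  · have : 0 ≤ a ^ s := by positivity
    simp only [mul_zero, sub_zero]; positivity
  have ha : 0 < a := hb'.trans_le hba
  have h := one_add_mul_self_le_rpow_one_add (s := (b - a) / a) (p := s + 1)
    (by rw [le_div_iff₀ ha]; linarith) (by linarith)
  have e : 1 + (b - a) / a = b / a := by field_simp; ring
  rw [e, Real.div_rpow hb ha.le, le_div_iff₀ (by positivity), Real.rpow_add_one ha.ne',
    Real.rpow_add_one hb'.ne'] at h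
  have e2 : (1 + (s + 1) * ((b - a) / a)) * (a ^ s * a) = a ^ s * a + (s + 1) * a ^ s * (b - a) := by
    field_simp
  rw [e2] at h
  nlinarith

end Scalar

/-! ### The vector field |x|^{p-1} x: strong monotonicity and local Lipschitz bound. -/

section PowerField

variable {X : Type*} [NormedAddCommGroup X] [InnerProductSpace ℝ X]

/-- The vector field `x ↦ |x|^{p-1} x`. -/
def powField (p : ℝ) (x : X) : X := ‖x‖ ^ (p - 1) • x

theorem norm_powField {p : ℝ} (hp : 1 ≤ p) (x : X) : ‖powField p x‖ = ‖x‖ ^ p := by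
  rw [powField, norm_smul, Real.norm_of_nonneg (by positivity)]
  rcases eq_or_ne x 0 with rfl | hx
  · simp [Real.zero_rpow (by linarith : p ≠ 0)]
  · rw [← Real.rpow_add_one (norm_ne_zero_iff.2 hx), sub_add_cancel]

theorem continuous_powField {p : ℝ} (hp : 1 ≤ p) : Continuous (powField p : X → X) :=
  (continuous_norm.rpow_const fun _ => Or.inr (by linarith)).smul continuous_id

/-- Expanding, the two sides differ by half the product of the increments of |·|^{p-1} and |·|²,
which have the same sign. -/
theorem inner_powField_sub_ge {p : ℝ} (hp : 1 ≤ p) (x y : X) :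
    (‖x‖ ^ (p - 1) + ‖y‖ ^ (p - 1)) * ‖x - y‖ ^ 2 / 2 ≤
      inner ℝ (powField p x - powField p y) (x - y) := by
  have h1 : inner ℝ (powField p x - powField p y) (x - y) =
      (‖x‖ ^ (p - 1) + ‖y‖ ^ (p - 1)) * ‖x - y‖ ^ 2 / 2 +
        (‖x‖ ^ (p - 1) - ‖y‖ ^ (p - 1)) * (‖x‖ ^ 2 - ‖y‖ ^ 2) / 2 := by
    rw [norm_sub_sq_real]
    simp only [powField, inner_sub_left, inner_sub_right, real_inner_smul_left,
      real_inner_self_eq_norm_sq, real_inner_comm y x]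
    ring
  rw [h1]
  have h2 : 0 ≤ (‖x‖ ^ (p - 1) - ‖y‖ ^ (p - 1)) * (‖x‖ ^ 2 - ‖y‖ ^ 2) := by
    rcases le_total ‖x‖ ‖y‖ with h | h
    · refine mul_nonneg_of_nonpos_of_nonpos (sub_nonpos.2 ?_) (sub_nonpos.2 ?_)
      · exact Real.rpow_le_rpow (norm_nonneg _) h (by linarith)
      · gcongr
    · refine mul_nonneg (sub_nonneg.2 ?_) (sub_nonneg.2 ?_)
      · exact Real.rpow_le_rpow (norm_nonneg _) h (by linarith)
      · gcongr
  linarith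

theorem norm_powField_sub_le {p : ℝ} (hp : 1 ≤ p) (x y : X) :
    ‖powField p x - powField p y‖ ≤ p * (‖x‖ ^ (p - 1) + ‖y‖ ^ (p - 1)) * ‖x - y‖ := by
  wlog h : ‖y‖ ≤ ‖x‖ generalizing x y
  · rw [norm_sub_rev, norm_sub_rev x, add_comm (‖x‖ ^ (p - 1))]
    exact this y x (le_of_not_ge h)
  have e : powField p x - powField p y =
      ‖x‖ ^ (p - 1) • (x - y) + (‖x‖ ^ (p - 1) - ‖y‖ ^ (p - 1)) • y := by
    simp only [powField, smul_sub, sub_smul]; abel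
  have hle : ‖y‖ ^ (p - 1) ≤ ‖x‖ ^ (p - 1) := Real.rpow_le_rpow (norm_nonneg _) h (by linarith)
  have h1 := rpow_sub_rpow_mul_le (norm_nonneg y) h (sub_nonneg.2 hp)
  have h2 : ‖x‖ - ‖y‖ ≤ ‖x - y‖ := norm_sub_norm_le x y
  have hx : 0 ≤ ‖x‖ ^ (p - 1) := by positivity
  have hy : 0 ≤ ‖y‖ ^ (p - 1) := by positivity
  rw [e]
  refine (norm_add_le _ _).trans ?_
  rw [norm_smul, norm_smul, Real.norm_of_nonneg hx, Real.norm_of_nonneg (sub_nonneg.2 hle)]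
  have h3 : (p - 1) * ‖x‖ ^ (p - 1) * (‖x‖ - ‖y‖) ≤ (p - 1) * ‖x‖ ^ (p - 1) * ‖x - y‖ := by
    have : 0 ≤ p - 1 := by linarith
    gcongr
  have h4 : 0 ≤ p * ‖y‖ ^ (p - 1) * ‖x - y‖ := by positivity
  nlinarith

end PowerField

/-! ### Calculus on the torus: integration by parts, a Sobolev inequality, dissipation integrals. -/

section TorusCalculus

variable {d : ℕ} {L : ℝ} [Fact (0 < L)]

theorem integrable_of_continuous {F : Type*} [NormedAddCommGroup F] {f : Torus d L → F}
    (hf : Continuous f) : Integrable f :=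
  hf.integrable_of_hasCompactSupport (HasCompactSupport.of_compactSpace f)

theorem hasDerivAt_add_single {F : Type*} [NormedAddCommGroup F] [NormedSpace ℝ F]
    {i : Fin d} {g g' : Torus d L → F}
    (hg : ∀ t, HasDerivAt (fun s : ℝ => g (t + Pi.single i (s : AddCircle L))) (g' t) 0)
    (t : Torus d L) (s : ℝ) :
    HasDerivAt (fun s : ℝ => g (t + Pi.single i (s : AddCircle L)))
      (g' (t + Pi.single i (s : AddCircle L))) s := by
  have h3 := HasDerivAt.comp_sub_const s s
    (by simpa using hg (t + Pi.single i (s : AddCircle L)))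
  convert h3 using 1
  funext x
  rw [add_assoc, ← Pi.single_add, ← AddCircle.coe_add, add_sub_cancel]

theorem continuous_add_single (i : Fin d) :
    Continuous (fun p : Torus d L × ℝ => p.1 + Pi.single i (p.2 : AddCircle L)) := by
  refine continuous_fst.add ?_
  refine (continuous_single i).comp ?_
  exact (AddCircle.continuous_mk' L).comp continuous_snd

/-- By translation invariance the increment of g along a unit shift has integral zero. That
increment is the integral of g' along the shift, and all translates of g' have the same integral. No
splitting into coordinates is needed. -/
theorem integral_deriv_eq_zero {F : Type*} [NormedAddCommGroup F] [NormedSpace ℝ F]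
    [CompleteSpace F] {i : Fin d} {g g' : Torus d L → F}
    (hg : ∀ t, HasDerivAt (fun s : ℝ => g (t + Pi.single i (s : AddCircle L))) (g' t) 0)
    (hgc : Continuous g) (hgc' : Continuous g') : ∫ t, g' t = 0 := by
  have hcont := hgc'.comp (continuous_add_single (L := L) i)
  have h1 : ∀ t, ∫ s in (0 : ℝ)..1, g' (t + Pi.single i (s : AddCircle L)) =
      g (t + Pi.single i ((1 : ℝ) : AddCircle L)) - g t := by
    intro t
    rw [intervalIntegral.integral_eq_sub_of_hasDerivAt
      (fun s _ => hasDerivAt_add_single hg t s)]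
    · simp
    · exact Continuous.intervalIntegrable (hcont.comp (Continuous.prodMk_right t)) _ _
  have h2 : ∫ t, (g (t + Pi.single i ((1 : ℝ) : AddCircle L)) - g t) = 0 := by
    have hgs : Continuous fun t => g (t + Pi.single i ((1 : ℝ) : AddCircle L)) :=
      hgc.comp (continuous_id.add continuous_const)
    rw [integral_sub (integrable_of_continuous hgs)
      (integrable_of_continuous hgc), integral_add_right_eq_self g, sub_self]
  simp_rw [← h1, intervalIntegral.integral_of_le zero_le_one] at h2
  obtain ⟨M, hM⟩ : ∃ M, ∀ t, ‖g' t‖ ≤ M := by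
    obtain ⟨M, hM⟩ := (isCompact_range hgc').isBounded.exists_norm_le
    exact ⟨M, fun t => hM _ ⟨t, rfl⟩⟩
  rw [integral_integral_swap] at h2
  · simp_rw [integral_add_right_eq_self g'] at h2
    simpa using h2
  · refine Integrable.of_bound hcont.aestronglyMeasurable M (Filter.Eventually.of_forall fun p => ?_)
    exact hM _

theorem IsSmooth.hasDerivAt' {f : Torus d L → E d} (hf : IsSmooth f) (i : Fin d)
    (t : Torus d L) :
    HasDerivAt (fun s : ℝ => f (t + Pi.single i (s : AddCircle L))) (CBFeD.pderivFun i f t) 0 := by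
  obtain ⟨x, rfl⟩ := (isOpenQuotientMap_proj d L).surjective t
  rw [hf.pderivFun_proj]
  exact hf.hasDerivAt i x

theorem hasDerivAt_field (f : smoothFields d L) (i : Fin d) (t : Torus d L) :
    HasDerivAt (fun s : ℝ => f.1 (t + Pi.single i (s : AddCircle L))) ((pderiv i f).1 t) 0 :=
  IsSmooth.hasDerivAt' f.2 i t

/-- Bound of a function on the circle by its mean and its total variation. -/
theorem le_integral_circle {φ φ' G : AddCircle L → ℝ}
    (h : ∀ x, HasDerivAt (fun s : ℝ => φ (x + (s : AddCircle L))) (φ' x) 0)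
    (hφ : Continuous φ) (hφ' : Continuous φ') (hG : Continuous G) (hle : ∀ x, |φ' x| ≤ G x)
    (x : AddCircle L) : φ x ≤ ∫ y, (L⁻¹ * φ y + G y) := by
  have hL : 0 < L := Fact.out
  have hint : ∀ {f : AddCircle L → ℝ}, Continuous f → Integrable f := fun hf =>
    hf.integrable_of_hasCompactSupport (HasCompactSupport.of_compactSpace _)
  have hder : ∀ s : ℝ, HasDerivAt (fun s : ℝ => φ (x + (s : AddCircle L)))
      (φ' (x + (s : AddCircle L))) s := by
    intro s
    have h3 := HasDerivAt.comp_sub_const s s (by simpa using h (x + (s : AddCircle L)))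
    refine h3.congr_of_eventuallyEq (Filter.Eventually.of_forall fun y => ?_)
    simp only
    rw [add_assoc, ← AddCircle.coe_add, add_sub_cancel]
  have hmk : Continuous fun s : ℝ => x + (s : AddCircle L) :=
    continuous_const.add (AddCircle.continuous_mk' L)
  have hGint : ∫ s in (0 : ℝ)..L, G (x + (s : AddCircle L)) = ∫ y, G y := by
    have := AddCircle.intervalIntegral_preimage L 0 (fun y => G (x + y))
    rw [zero_add] at this
    rw [this, integral_add_left_eq_self G x]
  have hGi : ∀ a b, IntervalIntegrable (fun s : ℝ => G (x + (s : AddCircle L))) volume a b :=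
    fun a b => (hG.comp hmk).intervalIntegrable _ _
  have hGnn : ∀ y, 0 ≤ G y := fun y => (abs_nonneg _).trans (hle y)
  have hy : ∀ y, φ x - φ y ≤ ∫ y, G y := by
    intro y
    obtain ⟨b, hb, hby⟩ : ∃ b ∈ Set.Ico (0 : ℝ) (0 + L), (b : AddCircle L) = y - x := by
      obtain ⟨b, hb⟩ := (AddCircle.equivIco L 0).symm.surjective (y - x)
      exact ⟨b.1, b.2, hb⟩
    have e : ∫ s in (0 : ℝ)..b, φ' (x + (s : AddCircle L)) = φ y - φ x := by
      rw [intervalIntegral.integral_eq_sub_of_hasDerivAt (fun s _ => hder s)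
        ((hφ'.comp hmk).intervalIntegrable _ _)]
      simp [hby]
    have e2 : |∫ s in (0 : ℝ)..b, φ' (x + (s : AddCircle L))| ≤
        ∫ s in (0 : ℝ)..b, G (x + (s : AddCircle L)) := by
      rw [← Real.norm_eq_abs]
      exact intervalIntegral.norm_integral_le_of_norm_le hb.1
        (Filter.Eventually.of_forall fun s _ => hle _) (hGi _ _)
    have e3 : ∫ s in (0 : ℝ)..b, G (x + (s : AddCircle L)) ≤ ∫ y, G y := by
      rw [← hGint]
      exact intervalIntegral.integral_mono_interval le_rfl hb.1 (by linarith [hb.2])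
        (Filter.Eventually.of_forall fun s => hGnn _) (hGi _ _)
    rw [e] at e2
    linarith [neg_abs_le (φ y - φ x)]
  have hvol : (volume : Measure (AddCircle L)).real Set.univ = L := by
    rw [Measure.real, AddCircle.measure_univ, ENNReal.toReal_ofReal hL.le]
  -- Averaging over the circle, of length L, replaces the value at y by the mean.
  have h1 : ∫ y, (φ x - φ y) ≤ ∫ _ : AddCircle L, (∫ y, G y) :=
    integral_mono ((integrable_const _).sub (hint hφ)) (integrable_const _) hy
  rw [integral_sub (integrable_const _) (hint hφ), integral_const, integral_const, hvol] at h1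
  rw [integral_add ((hint hφ).const_mul _) (hint hG), integral_const_mul]
  simp only [smul_eq_mul] at h1
  have h2 : φ x = L⁻¹ * (L * φ x) := by field_simp
  rw [h2]
  have h3 : L⁻¹ * (L * φ x) ≤ L⁻¹ * ((∫ y, φ y) + L * ∫ y, G y) := by
    gcongr; linarith
  refine h3.trans (le_of_eq ?_)
  field_simp

theorem le_integral_update {i : Fin d} {g g' G : Torus d L → ℝ}
    (hg : ∀ t, HasDerivAt (fun s : ℝ => g (t + Pi.single i (s : AddCircle L))) (g' t) 0)
    (hgc : Continuous g) (hgc' : Continuous g') (hG : Continuous G) (hle : ∀ t, |g' t| ≤ G t)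
    (t : Torus d L) :
    g t ≤ ∫ y, (L⁻¹ * g (Function.update t i y) + G (Function.update t i y)) := by
  have hu : Continuous fun y : AddCircle L => Function.update t i y :=
    continuous_const.update i continuous_id
  have h := le_integral_circle (φ := fun y => g (Function.update t i y))
    (φ' := fun y => g' (Function.update t i y)) (G := fun y => G (Function.update t i y))
    (fun x => ?_) (hgc.comp hu) (hgc'.comp hu) (hG.comp hu) (fun x => hle _) (t i)
  · simpa using h
  · convert hg (Function.update t i x) using 3 with s
    funext j
    by_cases hj : j = i
    · subst hj; simp
    · simp [hj]

/-- The Sobolev inequality `W^{1,1} ⊂ L^{3/2}` on the torus. -/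
theorem integral_rpow_le_of_deriv (hd : d = 2 ∨ d = 3) {g G : Torus d L → ℝ}
    {g' : Fin d → Torus d L → ℝ}
    (hg : ∀ i t, HasDerivAt (fun s : ℝ => g (t + Pi.single i (s : AddCircle L))) (g' i t) 0)
    (hgc : Continuous g) (hgc' : ∀ i, Continuous (g' i)) (hG : Continuous G)
    (hle : ∀ i t, |g' i t| ≤ G t) (hg0 : ∀ t, 0 ≤ g t) :
    ∫ t, g t ^ (3 / 2 : ℝ) ≤
      (1 + L ^ (1 / 2 : ℝ)) * (∫ t, (L⁻¹ * g t + G t)) ^ (3 / 2 : ℝ) := by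
  have hL : 0 < L := Fact.out
  set h : Torus d L → ℝ := fun t => L⁻¹ * g t + G t with hh
  have i0 : Fin d := ⟨0, by omega⟩
  have hG0 : ∀ t, 0 ≤ G t := fun t => (abs_nonneg _).trans (hle i0 t)
  have hh0 : ∀ t, 0 ≤ h t := fun t => add_nonneg (mul_nonneg (by positivity) (hg0 t)) (hG0 t)
  have hhc : Continuous h := (continuous_const.mul hgc).add hG
  set f : Torus d L → ℝ≥0∞ := fun t => ENNReal.ofReal (h t) with hf
  have hfm : Measurable f := (ENNReal.measurable_ofReal.comp hhc.measurable)
  have hline : ∀ i t, ENNReal.ofReal (g t) ≤ ∫⁻ y, f (Function.update t i y) := by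
    intro i t
    have h1 := le_integral_update (hg i) hgc (hgc' i) hG (hle i) t
    have hu : Continuous fun y : AddCircle L => h (Function.update t i y) :=
      hhc.comp (continuous_const.update i continuous_id)
    rw [hf, ← ofReal_integral_eq_lintegral_ofReal
      (hu.integrable_of_hasCompactSupport (HasCompactSupport.of_compactSpace _))
      (Filter.Eventually.of_forall fun y => hh0 _)]
    exact ENNReal.ofReal_le_ofReal h1
  set C : ℝ≥0∞ := ENNReal.ofReal (1 + L ^ (1 / 2 : ℝ)) with hC
  -- Gagliardo's argument: g is at most its line integral in every direction. In dimension 3 the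
  -- power 3/2 is a product of three square roots, one per direction. In dimension 2 the missing
  -- square root is supplied by g ≤ L f, which costs the factor L^(1/2).
  have hpt : ∀ t, ENNReal.ofReal (g t) ^ (3 / 2 : ℝ) ≤ C * (f t ^ (1 - ((Fintype.card (Fin d) : ℝ) - 1) * (1 / 2)) *
      ∏ i, (∫⁻ y, f (Function.update t i y)) ^ (1 / 2 : ℝ)) := by
    intro t
    set a := ENNReal.ofReal (g t) with ha
    have hprod : (a ^ (1 / 2 : ℝ)) ^ d ≤ ∏ i, (∫⁻ y, f (Function.update t i y)) ^ (1 / 2 : ℝ) := by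
      calc (a ^ (1 / 2 : ℝ)) ^ d = ∏ i : Fin d, a ^ (1 / 2 : ℝ) := by simp
        _ ≤ _ := Finset.prod_le_prod' fun i _ => ENNReal.rpow_le_rpow (hline i t) (by norm_num)
    rcases hd with rfl | rfl
    · have ha2 : a ≤ ENNReal.ofReal L * f t := by
        rw [ha, hf, ← ENNReal.ofReal_mul hL.le]
        refine ENNReal.ofReal_le_ofReal ?_
        simp only [hh, mul_add, ← mul_assoc, mul_inv_cancel₀ hL.ne', one_mul]
        have := hG0 t
        nlinarith
      have ha3 : a ^ (1 / 2 : ℝ) ≤ C * f t ^ (1 / 2 : ℝ) := by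
        refine (ENNReal.rpow_le_rpow ha2 (by norm_num)).trans ?_
        rw [ENNReal.mul_rpow_of_nonneg _ _ (by norm_num), ENNReal.ofReal_rpow_of_pos hL]
        gcongr
        exact ENNReal.ofReal_le_ofReal (by linarith)
      have e : a ^ (3 / 2 : ℝ) = a ^ (1 / 2 : ℝ) * (a ^ (1 / 2 : ℝ)) ^ 2 := by
        rw [← pow_succ', ← ENNReal.rpow_mul_natCast]; norm_num
      rw [e, ← mul_assoc]
      refine mul_le_mul' (ha3.trans (le_of_eq ?_)) hprod
      norm_num
    · have e : a ^ (3 / 2 : ℝ) = (a ^ (1 / 2 : ℝ)) ^ 3 := by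
        rw [← ENNReal.rpow_mul_natCast]; norm_num
      have e0 : (1 - ((Fintype.card (Fin 3) : ℝ) - 1) * (1 / 2)) = 0 := by norm_num
      rw [e, e0, ENNReal.rpow_zero, one_mul]
      refine hprod.trans (le_mul_of_one_le_left' ?_)
      rw [hC, ENNReal.one_le_ofReal]
      have : 0 < L ^ (1 / 2 : ℝ) := by positivity
      linarith
  -- The Loomis–Whitney type inequality with p = 1/2 produces the exponent 1 + p = 3/2 in both
  -- dimensions.
  have hgrid := lintegral_mul_prod_lintegral_pow_le (fun _ : Fin d => (volume : Measure (AddCircle L)))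
    (p := 1 / 2) (by norm_num) (by rcases hd with rfl | rfl <;> norm_num) hfm
  have hfin : ∫⁻ t, ENNReal.ofReal (g t) ^ (3 / 2 : ℝ) ≤ C * (∫⁻ t, f t) ^ (3 / 2 : ℝ) := by
    refine (lintegral_mono hpt).trans ?_
    rw [lintegral_const_mul' _ _ ENNReal.ofReal_ne_top]
    refine mul_le_mul_right (hgrid.trans (le_of_eq ?_)) _
    norm_num
    rfl
  rw [hf, ← ofReal_integral_eq_lintegral_ofReal (integrable_of_continuous hhc)
      (Filter.Eventually.of_forall fun y => hh0 _), ENNReal.ofReal_rpow_of_nonneg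
      (integral_nonneg hh0) (by norm_num), ← ENNReal.ofReal_mul (by positivity)] at hfin
  simp_rw [ENNReal.ofReal_rpow_of_nonneg (hg0 _) (by norm_num : (0 : ℝ) ≤ 3 / 2)] at hfin
  rw [← ofReal_integral_eq_lintegral_ofReal (integrable_of_continuous
    (hgc.rpow_const fun _ => Or.inr (by norm_num)))
      (Filter.Eventually.of_forall fun y => Real.rpow_nonneg (hg0 _) _)] at hfin
  refine (ENNReal.ofReal_le_ofReal_iff ?_).1 hfin
  have : 0 ≤ ∫ t, h t := integral_nonneg hh0
  positivity

/-- Cauchy–Schwarz for continuous functions. -/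
theorem integral_mul_le_sqrt {f g : Torus d L → ℝ} (hf : Continuous f) (hg : Continuous g) :
    ∫ t, f t * g t ≤ √(∫ t, f t ^ 2) * √(∫ t, g t ^ 2) := by
  have hm : ∀ {f : Torus d L → ℝ}, Continuous f → MemLp f (ENNReal.ofReal 2) volume := fun hf => by
    have : MemLp _ _ (volume : Measure (Torus d L)) := hf.memLp_of_hasCompactSupport (p := 2) (HasCompactSupport.of_compactSpace _)
    simpa using this
  have h := integral_mul_norm_le_Lp_mul_Lq (μ := (volume : Measure (Torus d L)))
    Real.HolderConjugate.two_two (hm hf) (hm hg)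
  simp only [Real.norm_eq_abs, Real.rpow_two, sq_abs, ← Real.sqrt_eq_rpow] at h
  refine (integral_mono (integrable_of_continuous (hf.mul hg))
    (integrable_of_continuous (hf.abs.mul hg.abs)) fun t => ?_).trans h
  simp only [Pi.mul_apply]
  rw [← abs_mul]
  exact le_abs_self _

theorem continuous_pderiv (f : smoothFields d L) (i : Fin d) :
    Continuous fun t => (pderiv i f).1 t := (pderiv i f).1.continuous

/-- `|∇u|²` for a smooth field. -/
def gradSq (u : smoothFields d L) (t : Torus d L) : ℝ := ∑ i, ‖(pderiv i u).1 t‖ ^ 2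

theorem gradSq_nonneg (u : smoothFields d L) (t : Torus d L) : 0 ≤ gradSq u t :=
  Finset.sum_nonneg fun _ _ => by positivity

theorem continuous_gradSq (u : smoothFields d L) : Continuous (gradSq u) :=
  continuous_finsetSum _ fun i _ => (continuous_pderiv u i).norm.pow 2

theorem norm_pderiv_le_sqrt_gradSq (u : smoothFields d L) (i : Fin d) (t : Torus d L) :
    ‖(pderiv i u).1 t‖ ≤ √(gradSq u t) :=
  Real.le_sqrt_of_sq_le (Finset.single_le_sum (f := fun i => ‖(pderiv i u).1 t‖ ^ 2)
    (fun _ _ => by positivity) (Finset.mem_univ i))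

/-- The dissipation `∫ |u|^{p-1} |∇u|²`. -/
def dissip (p : ℝ) (u : smoothFields d L) : ℝ := ∫ t, ‖u.1 t‖ ^ (p - 1) * gradSq u t

theorem continuous_dissip {p : ℝ} (hp : 1 ≤ p) (u : smoothFields d L) :
    Continuous fun t => ‖u.1 t‖ ^ (p - 1) * gradSq u t :=
  (u.1.continuous.norm.rpow_const fun _ => Or.inr (by linarith)).mul (continuous_gradSq u)

theorem dissip_nonneg (p : ℝ) (u : smoothFields d L) : 0 ≤ dissip p u :=
  integral_nonneg fun t => mul_nonneg (by positivity) (gradSq_nonneg u t)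

/-- The Laplacian on smooth fields. -/
def lap : smoothFields d L →ₗ[ℝ] smoothFields d L := ∑ i, pderiv i ∘ₗ pderiv i

theorem lap_apply (u : smoothFields d L) (t : Torus d L) :
    (lap u).1 t = ∑ i, (pderiv i (pderiv i u)).1 t := by
  simp [lap]

theorem hasDerivAt_powField {p : ℝ} (hp : 2 < p) (u : smoothFields d L) (i : Fin d)
    (t : Torus d L) :
    HasDerivAt (fun s : ℝ => powField p (u.1 (t + Pi.single i (s : AddCircle L))))
      (‖u.1 t‖ ^ (p - 1) • (pderiv i u).1 t +
        (fderiv ℝ (fun x : E d => ‖x‖ ^ (p - 1)) (u.1 t) ((pderiv i u).1 t)) • u.1 t) 0 := by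
  have h1 := hasDerivAt_field u i t
  have h2 := ((contDiff_norm_rpow (E := E d) (p := p - 1) (by linarith)).differentiable
    one_ne_zero (u.1 (t + Pi.single i ((0 : ℝ) : AddCircle L)))).hasFDerivAt.comp_hasDerivAt (0 : ℝ) h1
  refine HasDerivAt.congr_deriv (h2.smul h1) ?_
  simp

theorem fderiv_norm_rpow_apply {p : ℝ} (hp : 1 < p) (x y : E d) :
    fderiv ℝ (fun x : E d => ‖x‖ ^ p) x y = p * ‖x‖ ^ (p - 2) * inner ℝ x y := by
  rw [fderiv_norm_rpow x hp]; simp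

/-- Integrating by parts, ∂ᵢ(|u|^{p-1}u)·∂ᵢu is |u|^{p-1}|∂ᵢu|² plus (p-1)|u|^{p-3}(u·∂ᵢu)², and by
Cauchy–Schwarz the second term lies between 0 and p - 1 times the first. For p > 2 the function
|x|^{p-1} is C¹, also at the origin. -/
theorem dissip_bounds {p : ℝ} (hp : 2 < p) (u : smoothFields d L) :
    dissip p u ≤ -∫ t, inner ℝ (powField p (u.1 t)) ((lap u).1 t) ∧
      -∫ t, inner ℝ (powField p (u.1 t)) ((lap u).1 t) ≤ p * dissip p u := by
  set Q : Fin d → Torus d L → ℝ := fun i t =>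
    inner ℝ (‖u.1 t‖ ^ (p - 1) • (pderiv i u).1 t +
        (fderiv ℝ (fun x : E d => ‖x‖ ^ (p - 1)) (u.1 t) ((pderiv i u).1 t)) • u.1 t)
      ((pderiv i u).1 t) with hQ
  have hcp : Continuous fun t => powField p (u.1 t) :=
    (continuous_powField (by linarith)).comp u.1.continuous
  have hcQ : ∀ i, Continuous (Q i) := fun i => by
    have h1 : Continuous fun t => fderiv ℝ (fun x : E d => ‖x‖ ^ (p - 1)) (u.1 t) :=
      ((contDiff_norm_rpow (E := E d) (p := p - 1) (by linarith)).continuous_fderiv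
        one_ne_zero).comp u.1.continuous
    have h2 : Continuous fun t => ‖u.1 t‖ ^ (p - 1) :=
      u.1.continuous.norm.rpow_const fun _ => Or.inr (by linarith)
    have h3 := continuous_pderiv u i
    exact ((h2.smul h3).add ((h1.clm_apply h3).smul u.1.continuous)).inner h3
  have hcL : ∀ i, Continuous fun t => inner ℝ (powField p (u.1 t)) ((pderiv i (pderiv i u)).1 t) :=
    fun i => hcp.inner (continuous_pderiv _ i)
  have hi : ∀ i, ∫ t, inner ℝ (powField p (u.1 t)) ((pderiv i (pderiv i u)).1 t) = -∫ t, Q i t := by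
    intro i
    have h := integral_deriv_eq_zero (i := i)
      (g := fun t => inner ℝ (powField p (u.1 t)) ((pderiv i u).1 t))
      (g' := fun t => inner ℝ (powField p (u.1 t)) ((pderiv i (pderiv i u)).1 t) + Q i t)
      (fun t => by
        simpa using (hasDerivAt_powField hp u i t).inner ℝ (hasDerivAt_field (pderiv i u) i t))
      (hcp.inner (continuous_pderiv u i)) ((hcL i).add (hcQ i))
    rw [integral_add (integrable_of_continuous (hcL i)) (integrable_of_continuous (hcQ i))] at h
    linarith
  have hsum : -∫ t, inner ℝ (powField p (u.1 t)) ((lap u).1 t) = ∫ t, ∑ i, Q i t := by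
    simp_rw [lap_apply, inner_sum]
    rw [integral_finsetSum _ fun i _ => integrable_of_continuous (hcL i),
      integral_finsetSum _ fun i _ => integrable_of_continuous (hcQ i)]
    simp [hi]
  have hcs : Continuous fun t => ∑ i, Q i t := continuous_finsetSum _ fun i _ => hcQ i
  have hQe : ∀ i t, Q i t = ‖u.1 t‖ ^ (p - 1) * ‖(pderiv i u).1 t‖ ^ 2 +
      (p - 1) * ‖u.1 t‖ ^ (p - 1 - 2) * inner ℝ (u.1 t) ((pderiv i u).1 t) ^ 2 := by
    intro i t
    simp only [hQ, inner_add_left, real_inner_smul_left, real_inner_self_eq_norm_sq]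
    rw [fderiv_norm_rpow_apply (by linarith)]
    ring
  rw [hsum, dissip, ← integral_const_mul]
  constructor
  · refine integral_mono (integrable_of_continuous (continuous_dissip (by linarith) u))
      (integrable_of_continuous hcs) fun t => ?_
    simp only [gradSq, Finset.mul_sum]
    refine Finset.sum_le_sum fun i _ => ?_
    rw [hQe]
    have : 0 ≤ (p - 1) * ‖u.1 t‖ ^ (p - 1 - 2) * inner ℝ (u.1 t) ((pderiv i u).1 t) ^ 2 := by
      have : 0 ≤ p - 1 := by linarith
      positivity
    linarith
  · refine integral_mono (integrable_of_continuous hcs) (integrable_of_continuous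
      ((continuous_dissip (by linarith) u).const_mul p)) fun t => ?_
    simp only [gradSq, Finset.mul_sum]
    refine Finset.sum_le_sum fun i _ => ?_
    rw [hQe]
    have h1 : ‖u.1 t‖ ^ (p - 1 - 2) * inner ℝ (u.1 t) ((pderiv i u).1 t) ^ 2 ≤
        ‖u.1 t‖ ^ (p - 1) * ‖(pderiv i u).1 t‖ ^ 2 := by
      rcases eq_or_ne (u.1 t) 0 with h0 | h0
      · simp only [h0, inner_zero_left]
        have : 0 ≤ ‖(0 : E d)‖ ^ (p - 1) * ‖(pderiv i u).1 t‖ ^ 2 := by positivity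
        simpa using this
      · have hn := norm_pos_iff.2 h0
        have e : ‖u.1 t‖ ^ (p - 1) = ‖u.1 t‖ ^ (p - 1 - 2) * ‖u.1 t‖ ^ 2 := by
          rw [← Real.rpow_two, ← Real.rpow_add hn]; congr 1; ring
        rw [e, mul_assoc, ← mul_pow]
        refine mul_le_mul_of_nonneg_left ?_ (by positivity)
        rw [sq_le_sq, abs_mul, abs_norm, abs_norm]
        exact abs_real_inner_le_norm _ _
    have h2 : 0 ≤ p - 1 := by linarith
    have h3 := mul_le_mul_of_nonneg_left h1 h2
    nlinarith

/-- A bound for `∫ |u|^{2R}` by `∫ |u|^R` and `∫ |u|^{R-2} |∇u|²`. -/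
theorem exists_integral_norm_rpow_le (hd : d = 2 ∨ d = 3) {R : ℝ} (hR : 2 < R) :
    ∃ C : ℝ, 0 < C ∧ ∀ u : smoothFields d L,
      ∫ t, ‖u.1 t‖ ^ (2 * R) ≤
        C * √(∫ t, ‖u.1 t‖ ^ R) * (√(∫ t, ‖u.1 t‖ ^ R) + √(dissip (R - 1) u)) ^ 3 := by
  have hL : 0 < L := Fact.out
  set C₀ : ℝ := 1 + L ^ (1 / 2 : ℝ) with hC₀
  have hC₀pos : 0 < C₀ := by positivity
  set c : ℝ := L⁻¹ + 2 * R with hc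
  have hcpos : 0 < c := by positivity
  refine ⟨C₀ ^ 2 * c ^ 3, by positivity, fun u => ?_⟩
  have hcn : ∀ {a : ℝ}, 0 ≤ a → Continuous fun t => ‖u.1 t‖ ^ a := fun ha =>
    u.1.continuous.norm.rpow_const fun _ => Or.inr ha
  set A := ∫ t, ‖u.1 t‖ ^ R with hA
  set S := ∫ t, ‖u.1 t‖ ^ (3 * R) with hS
  set D := dissip (R - 1) u with hD
  have hA0 : 0 ≤ A := integral_nonneg fun t => by positivity
  have hS0 : 0 ≤ S := integral_nonneg fun t => by positivity
  have hadd : ∀ {a b : ℝ} (x : ℝ), 0 ≤ x → 0 ≤ a → 0 ≤ b → x ^ a * x ^ b = x ^ (a + b) :=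
    fun x hx ha hb => (Real.rpow_add_of_nonneg hx ha hb).symm
  have hsq : ∀ {a : ℝ} (x : ℝ), 0 ≤ x → (x ^ a) ^ 2 = x ^ (2 * a) := fun x hx => by
    rw [← Real.rpow_mul_natCast hx, mul_comm]; norm_num
  -- Interpolation of L^{2R} between L^{3R} and L^R.
  have h1 : ∫ t, ‖u.1 t‖ ^ (2 * R) ≤ √S * √A := by
    have := integral_mul_le_sqrt (hcn (a := 3 * R / 2) (by linarith)) (hcn (a := R / 2) (by linarith))
    simp_rw [hadd _ (norm_nonneg _) (by linarith : 0 ≤ 3 * R / 2) (by linarith : 0 ≤ R / 2),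
      hsq _ (norm_nonneg _)] at this
    ring_nf at this ⊢
    convert this using 3
    rw [hS]; ring_nf
  set G : Torus d L → ℝ := fun t => 2 * R * (‖u.1 t‖ ^ (3 * R / 2) *
    (‖u.1 t‖ ^ (R / 2 - 1) * √(gradSq u t))) with hG
  have hsqrt : Continuous fun t => √(gradSq u t) := (continuous_gradSq u).sqrt
  have hGc : Continuous G := continuous_const.mul
    ((hcn (by linarith)).mul ((hcn (by linarith)).mul hsqrt))
  -- For g = |u|^{2R} the Sobolev inequality controls S = ∫|u|^{3R}. Its gradient is split as
  -- |u|^{3R/2} · |u|^{R/2-1}|∇u|, so that Cauchy–Schwarz reproduces √S next to the dissipation.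
  have hsob := integral_rpow_le_of_deriv hd (g := fun t => ‖u.1 t‖ ^ (2 * R)) (G := G)
    (g' := fun i t => fderiv ℝ (fun x : E d => ‖x‖ ^ (2 * R)) (u.1 t) ((pderiv i u).1 t))
    (fun i t => by
      have h1 := hasDerivAt_field u i t
      have h2 := ((contDiff_norm_rpow (E := E d) (p := 2 * R) (by linarith)).differentiable
        one_ne_zero (u.1 (t + Pi.single i ((0 : ℝ) : AddCircle L)))).hasFDerivAt.comp_hasDerivAt
          (0 : ℝ) h1
      simpa [Function.comp_def] using h2)
    (hcn (by linarith))
    (fun i => (((contDiff_norm_rpow (E := E d) (p := 2 * R) (by linarith)).continuous_fderiv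
        one_ne_zero).comp u.1.continuous).clm_apply (continuous_pderiv u i)) hGc
    (fun i t => by
      rw [fderiv_norm_rpow_apply (by linarith), abs_mul, abs_of_nonneg (by positivity)]
      have h1 : |inner ℝ (u.1 t) ((pderiv i u).1 t)| ≤ ‖u.1 t‖ * √(gradSq u t) :=
        (abs_real_inner_le_norm _ _).trans
          (mul_le_mul_of_nonneg_left (norm_pderiv_le_sqrt_gradSq u i t) (norm_nonneg _))
      have h2 : ‖u.1 t‖ ^ (2 * R - 2) * ‖u.1 t‖ = ‖u.1 t‖ ^ (3 * R / 2) * ‖u.1 t‖ ^ (R / 2 - 1) := by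
        rw [hadd _ (norm_nonneg _) (by linarith) (by linarith)]
        nth_rewrite 2 [← Real.rpow_one ‖u.1 t‖]
        rw [hadd _ (norm_nonneg _) (by linarith) (by linarith)]
        congr 1; ring
      calc 2 * R * ‖u.1 t‖ ^ (2 * R - 2) * |inner ℝ (u.1 t) ((pderiv i u).1 t)|
          ≤ 2 * R * ‖u.1 t‖ ^ (2 * R - 2) * (‖u.1 t‖ * √(gradSq u t)) := by gcongr
        _ = 2 * R * ((‖u.1 t‖ ^ (2 * R - 2) * ‖u.1 t‖) * √(gradSq u t)) := by ring
        _ = G t := by rw [h2, hG]; ring)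
    (fun t => by positivity)
  have hSe : ∫ t, (‖u.1 t‖ ^ (2 * R)) ^ (3 / 2 : ℝ) = S := by
    rw [hS]; congr 1; funext t
    rw [← Real.rpow_mul (norm_nonneg _)]; congr 1; ring
  have hGi : ∫ t, ‖u.1 t‖ ^ (3 * R / 2) * (‖u.1 t‖ ^ (R / 2 - 1) * √(gradSq u t)) ≤ √S * √D := by
    refine (integral_mul_le_sqrt (hcn (by linarith)) ((hcn (by linarith)).mul hsqrt)).trans
      (le_of_eq ?_)
    congr 2
    · rw [hS]; congr 1; funext t; rw [hsq _ (norm_nonneg _)]; congr 1; ring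
    · rw [hD, dissip]; congr 1; funext t
      rw [Pi.mul_apply, mul_pow, hsq _ (norm_nonneg _), Real.sq_sqrt (gradSq_nonneg u t)]; congr 2; ring
  have hI : ∫ t, (L⁻¹ * ‖u.1 t‖ ^ (2 * R) + G t) ≤ √S * (c * (√A + √D)) := by
    rw [integral_add ((integrable_of_continuous (hcn (by linarith))).const_mul _)
      (integrable_of_continuous hGc), integral_const_mul, hG, integral_const_mul]
    have e1 : L⁻¹ * ∫ t, ‖u.1 t‖ ^ (2 * R) ≤ L⁻¹ * (√S * √A) := by gcongr
    have e2 := mul_le_mul_of_nonneg_left hGi (by linarith : 0 ≤ 2 * R)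
    have e3 : 0 ≤ 2 * R * (√S * √A) := by positivity
    have e4 : 0 ≤ L⁻¹ * (√S * √D) := by positivity
    rw [hc]
    nlinarith
  have hI0 : 0 ≤ ∫ t, (L⁻¹ * ‖u.1 t‖ ^ (2 * R) + G t) := integral_nonneg fun t => by
    have := gradSq_nonneg u t
    simp only [hG, Pi.zero_apply]
    positivity
  rw [hSe] at hsob
  set B := c * (√A + √D) with hB
  have hB0 : 0 ≤ B := by positivity
  have hS2 : S ≤ C₀ * (√S * B) ^ (3 / 2 : ℝ) :=
    hsob.trans (mul_le_mul_of_nonneg_left (Real.rpow_le_rpow hI0 hI (by norm_num)) hC₀pos.le)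
  -- Squaring gives S² ≤ C₀² S^{3/2} B³; as S is finite, S^{3/2} cancels.
  have hS3 : √S ≤ C₀ ^ 2 * B ^ 3 := by
    rcases hS0.eq_or_lt with h0 | h0
    · rw [← h0]; simp; positivity
    set x := √S with hx
    have hxpos : 0 < x := Real.sqrt_pos.2 h0
    have hxS : S = x ^ 2 := (Real.sq_sqrt hS0).symm
    have h2 : S ^ 2 ≤ C₀ ^ 2 * (x * B) ^ 3 := by
      calc S ^ 2 ≤ (C₀ * (x * B) ^ (3 / 2 : ℝ)) ^ 2 := by gcongr
        _ = _ := by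
          rw [mul_pow, ← Real.rpow_mul_natCast (by positivity)]; norm_num
    rw [hxS] at h2
    have h3 : x ^ 3 * x ≤ x ^ 3 * (C₀ ^ 2 * B ^ 3) := by nlinarith
    exact le_of_mul_le_mul_left h3 (by positivity)
  calc ∫ t, ‖u.1 t‖ ^ (2 * R) ≤ √S * √A := h1
    _ ≤ (C₀ ^ 2 * B ^ 3) * √A := by gcongr
    _ = _ := by rw [hB]; ring

end TorusCalculus

/-! ### Fourier series of real vector fields on the torus. -/

section Fourier

open scoped ComplexConjugate

variable {d : ℕ} {L : ℝ}

/-- The character `t ↦ exp (2πi k·t / L)`. -/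
def chr (k : Fin d → ℤ) : C(Torus d L, ℂ) where
  toFun t := ∏ i, fourier (k i) (t i)
  continuous_toFun := by fun_prop

theorem chr_apply (k : Fin d → ℤ) (t : Torus d L) : chr k t = ∏ i, fourier (k i) (t i) := rfl

theorem chr_neg (k : Fin d → ℤ) (t : Torus d L) : chr (-k) t = conj (chr k t) := by
  simp only [chr_apply, Pi.neg_apply, fourier_neg, map_prod]

theorem chr_add (k l : Fin d → ℤ) (t : Torus d L) : chr (k + l) t = chr k t * chr l t := by
  simp only [chr_apply, Pi.add_apply, fourier_add, ← Finset.prod_mul_distrib]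

theorem chr_zero (t : Torus d L) : chr (0 : Fin d → ℤ) t = 1 := by
  simp [chr_apply]

theorem norm_chr (k : Fin d → ℤ) (t : Torus d L) : ‖chr k t‖ = 1 := by
  rw [chr_apply, norm_prod]
  exact Finset.prod_eq_one fun i _ => Circle.norm_coe _

theorem chr_apply_add (k : Fin d → ℤ) (s t : Torus d L) : chr k (s + t) = chr k s * chr k t := by
  simp only [chr_apply, Pi.add_apply, ← Finset.prod_mul_distrib]
  refine Finset.prod_congr rfl fun i _ => ?_
  simp [fourier_apply, smul_add, AddCircle.toCircle_add]

theorem chr_single (k : Fin d → ℤ) (i : Fin d) (x : AddCircle L) :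
    chr k (Pi.single i x : Torus d L) = fourier (k i) x := by
  rw [chr_apply, Finset.prod_eq_single i]
  · simp
  · intro j _ hj; simp [hj]
  · simp

/-- The wave numbers `2π k / L`. -/
def kap (L : ℝ) (k : Fin d → ℤ) (i : Fin d) : ℝ := 2 * Real.pi * k i / L

theorem chr_proj_contDiff (k : Fin d → ℤ) :
    ContDiff ℝ ∞ fun x : Fin d → ℝ => chr k (proj d L x) := by
  simp only [chr_apply, proj, fourier_coe_apply]
  refine contDiff_prod fun i _ => ?_
  have h1 : ContDiff ℝ ∞ fun x : Fin d → ℝ => ((x i : ℝ) : ℂ) :=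
    Complex.ofRealCLM.contDiff.comp (contDiff_apply ℝ ℝ i)
  exact (((contDiff_const.mul h1)).div_const _).cexp

theorem hasDerivAt_chr [Fact (0 < L)] (k : Fin d → ℤ) (i : Fin d) (t : Torus d L) :
    HasDerivAt (fun s : ℝ => chr k (t + Pi.single i (s : AddCircle L)))
      ((kap L k i * Complex.I) * chr k t) 0 := by
  simp only [chr_apply_add, chr_single]
  have h := (hasDerivAt_fourier L (k i) 0).const_mul (chr k t)
  refine h.congr_deriv ?_
  simp only [QuotientAddGroup.mk_zero, fourier_eval_zero, kap, mul_one]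
  push_cast
  ring

/-- The subalgebra generated by the characters. -/
def chrSubalgebra (d : ℕ) (L : ℝ) : StarSubalgebra ℂ C(Torus d L, ℂ) where
  toSubalgebra := Algebra.adjoin ℂ (Set.range chr)
  star_mem' := by
    change Algebra.adjoin ℂ (Set.range chr) ≤ star (Algebra.adjoin ℂ (Set.range chr))
    refine Algebra.adjoin_le ?_
    rintro _ ⟨n, rfl⟩
    refine Algebra.subset_adjoin ⟨-n, ?_⟩
    ext1 x
    simp only [chr_neg, starRingEnd_apply, ContinuousMap.star_apply]

theorem chrSubalgebra_coe :
    (chrSubalgebra d L).toSubalgebra.toSubmodule = Submodule.span ℂ (Set.range chr) := by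
  apply Algebra.adjoin_eq_span_of_subset
  refine .trans (fun x ↦ Submonoid.closure_induction (fun _ ↦ id) ⟨0, ?_⟩ ?_) Submodule.subset_span
  · ext z; simp [chr_zero]
  · rintro _ _ _ _ ⟨m, rfl⟩ ⟨n, rfl⟩
    refine ⟨m + n, ?_⟩
    ext z
    simp [chr_add]

theorem chrSubalgebra_separatesPoints [Fact (0 < L)] : (chrSubalgebra d L).SeparatesPoints := by
  classical
  have hL : 0 < L := Fact.out
  intro x y hxy
  rw [Ne, funext_iff, not_forall] at hxy
  obtain ⟨i, hi⟩ := hxy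
  refine ⟨_, ⟨chr (Pi.single i 1), Algebra.subset_adjoin ⟨Pi.single i 1, rfl⟩, rfl⟩, ?_⟩
  have h : ∀ z : Torus d L, chr (Pi.single i 1) z = fourier 1 (z i) := by
    intro z
    rw [chr_apply, Finset.prod_eq_single i]
    · simp
    · intro j _ hj; simp [hj]
    · simp
  intro he
  have he' : chr (Pi.single i 1) x = chr (Pi.single i 1) y := he
  rw [h, h, fourier_one, fourier_one] at he'
  exact hi (AddCircle.injective_toCircle hL.ne' (Circle.ext he'))

theorem span_chr_closure_eq_top [Fact (0 < L)] :
    (Submodule.span ℂ (Set.range (chr (d := d) (L := L)))).topologicalClosure = ⊤ := by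
  rw [← chrSubalgebra_coe]
  exact congr_arg (Subalgebra.toSubmodule <| StarSubalgebra.toSubalgebra ·)
    (ContinuousMap.starSubalgebra_topologicalClosure_eq_top_of_separatesPoints _
      chrSubalgebra_separatesPoints)

/-- The normalisation `L^{-d/2}`. -/
def nrm (d : ℕ) (L : ℝ) : ℝ := (√(L ^ d))⁻¹

variable [Fact (0 < L)]

theorem nrm_pos : 0 < nrm d L := by
  have hL : 0 < L := Fact.out
  exact inv_pos.2 (Real.sqrt_pos.2 (by positivity))

theorem nrm_sq_mul : nrm d L ^ 2 * L ^ d = 1 := by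
  have hL : 0 < L := Fact.out
  rw [nrm, inv_pow, Real.sq_sqrt (by positivity), inv_mul_cancel₀ (by positivity)]

/-- A nontrivial character is an eigenfunction of some ∂ᵢ with nonzero eigenvalue, so its integral
vanishes. -/
theorem integral_chr (k : Fin d → ℤ) :
    ∫ t : Torus d L, chr k t = if k = 0 then ((L ^ d : ℝ) : ℂ) else 0 := by
  have hL : 0 < L := Fact.out
  split_ifs with h
  · subst h
    simp only [chr_zero, integral_const]
    have : (volume : Measure (Torus d L)).real Set.univ = L ^ d := by
      rw [Measure.real, volume_pi, Measure.pi_univ]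
      simp [AddCircle.measure_univ, hL.le]
    rw [this]; simp
  · obtain ⟨i, hi⟩ := Function.ne_iff.1 h
    have h0 : ((kap L k i : ℂ) * Complex.I) ≠ 0 := by
      refine mul_ne_zero (Complex.ofReal_ne_zero.2 ?_) Complex.I_ne_zero
      rw [kap]
      have : (k i : ℝ) ≠ 0 := Int.cast_ne_zero.2 hi
      have := Real.pi_ne_zero
      positivity
    have := integral_deriv_eq_zero (hasDerivAt_chr (L := L) k i) (chr k).continuous
      (continuous_const.mul (chr k).continuous)
    rw [integral_const_mul] at this
    exact (mul_eq_zero.1 this).resolve_left h0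

/-- The normalised characters in `L²(𝕋^d; ℂ)`. -/
def chrLp (k : Fin d → ℤ) : Lp ℂ 2 (volume : Measure (Torus d L)) :=
  (nrm d L : ℂ) • ContinuousMap.toLp (E := ℂ) 2 volume ℂ (chr k)

theorem orthonormal_chrLp : Orthonormal ℂ (chrLp (d := d) (L := L)) := by
  rw [orthonormal_iff_ite]
  intro m n
  simp only [chrLp, inner_smul_left, inner_smul_right, ContinuousMap.inner_toLp]
  have e : ∀ t : Torus d L, chr n t * conj (chr m t) = chr (n - m) t := fun t => by
    rw [sub_eq_add_neg, chr_add, chr_neg]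
  simp_rw [e, integral_chr, sub_eq_zero, Complex.conj_ofReal]
  by_cases h : m = n
  · subst h
    simp only [if_true]
    rw [← mul_assoc, ← Complex.ofReal_mul, ← Complex.ofReal_mul, ← sq, nrm_sq_mul]
    simp
  · rw [if_neg h, if_neg (Ne.symm h)]; simp

theorem span_chrLp_closure_eq_top :
    (Submodule.span ℂ (Set.range (chrLp (d := d) (L := L)))).topologicalClosure = ⊤ := by
  have h : (Submodule.span ℂ (Set.range fun k =>
      ContinuousMap.toLp (E := ℂ) 2 (volume : Measure (Torus d L)) ℂ (chr k))).topologicalClosure = ⊤ := by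
    simpa only [Submodule.map_span, ContinuousLinearMap.coe_coe, ← Set.range_comp, Function.comp_def] using
      (ContinuousMap.toLp_denseRange ℂ (volume : Measure (Torus d L)) ℂ
        (ENNReal.ofNat_ne_top : (2 : ℝ≥0∞) ≠ ⊤)).topologicalClosure_map_submodule
        (span_chr_closure_eq_top (d := d) (L := L))
  rw [← h]
  congr 1
  apply le_antisymm
  · rw [Submodule.span_le]
    rintro _ ⟨k, rfl⟩
    exact Submodule.smul_mem _ _ (Submodule.subset_span ⟨k, rfl⟩)
  · rw [Submodule.span_le]
    rintro _ ⟨k, rfl⟩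
    have h1 : chrLp k ∈ Submodule.span ℂ (Set.range (chrLp (d := d) (L := L))) :=
      Submodule.subset_span ⟨k, rfl⟩
    have h2 := Submodule.smul_mem _ ((nrm d L : ℂ)⁻¹) h1
    rwa [chrLp, smul_smul, inv_mul_cancel₀ (Complex.ofReal_ne_zero.2 nrm_pos.ne'), one_smul] at h2

/-- The Fourier basis of `L²(𝕋^d; ℂ)`. -/
def chrBasis : HilbertBasis (Fin d → ℤ) ℂ (Lp ℂ 2 (volume : Measure (Torus d L))) :=
  HilbertBasis.mk orthonormal_chrLp span_chrLp_closure_eq_top.ge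

theorem coe_chrBasis : ⇑(chrBasis (d := d) (L := L)) = chrLp := HilbertBasis.coe_mk _ _

/-- `ℂ^d` with its Euclidean norm. -/
abbrev EC (d : ℕ) := EuclideanSpace ℂ (Fin d)

/-- The `j`-th component of a real field, as a complex function. -/
def compo (j : Fin d) : L2 d L →L[ℝ] Lp ℂ 2 (volume : Measure (Torus d L)) :=
  (Complex.ofRealCLM ∘L (EuclideanSpace.proj j : E d →L[ℝ] ℝ)).compLpL 2 volume

theorem coeFn_compo (j : Fin d) (u : L2 d L) :
    compo j u =ᵐ[volume] fun t => ((u t j : ℝ) : ℂ) :=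
  (ContinuousLinearMap.coeFn_compLpL _ u).trans (Filter.Eventually.of_forall fun t => by simp)

/-- The (normalised) Fourier coefficients of a real vector field. -/
def fc (k : Fin d → ℤ) : L2 d L →ₗ[ℝ] EC d where
  toFun u := WithLp.toLp 2 fun j => inner ℂ (chrLp k) (compo j u)
  map_add' u v := by ext j; simp [inner_add_right]
  map_smul' c u := by
    ext j
    simp only [map_smul, RingHom.id_apply, PiLp.smul_apply]
    exact inner_smul_right_eq_smul _ _ _

theorem fc_apply (k : Fin d → ℤ) (u : L2 d L) (j : Fin d) :
    fc k u j = nrm d L * ∫ t, chr (-k) t * ((u t j : ℝ) : ℂ) := by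
  simp only [fc, LinearMap.coe_mk, AddHom.coe_mk, chrLp, inner_smul_left, Complex.conj_ofReal]
  rw [L2.inner_def]
  congr 1
  refine integral_congr_ae ?_
  filter_upwards [coeFn_compo j u, ContinuousMap.coeFn_toLp (p := 2) (𝕜 := ℂ) volume (chr k)]
    with t h1 h2
  rw [h1, h2, chr_neg]
  simp [mul_comm]

theorem inner_compo (j : Fin d) (u v : L2 d L) :
    inner ℂ (compo j u) (compo j v) = ((∫ t, u t j * v t j : ℝ) : ℂ) := by
  rw [L2.inner_def]
  refine Eq.trans ?_ integral_ofReal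
  refine integral_congr_ae ?_
  filter_upwards [coeFn_compo j u, coeFn_compo j v] with t h1 h2
  rw [h1, h2, RCLike.inner_apply, Complex.conj_ofReal, mul_comm]
  simp

theorem memLp_coord (j : Fin d) (u : L2 d L) : MemLp (fun t => u t j) 2 volume :=
  (EuclideanSpace.proj j : E d →L[ℝ] ℝ).comp_memLp' (Lp.memLp u)

/-- Parseval's identity, summed over the components. Through it, identities between L² pairings are
checked one coefficient at a time. -/
theorem hasSum_inner_fc (u v : L2 d L) :
    HasSum (fun k => (inner ℂ (fc k u) (fc k v)).re) (inner ℝ u v) := by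
  have h1 : ∀ j : Fin d, HasSum (fun k => (inner ℂ (fc k u j) (fc k v j)).re)
      (∫ t, u t j * v t j) := by
    intro j
    have h := (chrBasis (d := d) (L := L)).hasSum_inner_mul_inner (compo j u) (compo j v)
    rw [inner_compo] at h
    have h2 := Complex.hasSum_re h
    rw [Complex.ofReal_re] at h2
    refine h2.congr_fun fun k => ?_
    rw [coe_chrBasis, RCLike.inner_apply, ← inner_conj_symm (compo j u), mul_comm]
    rfl
  have h2 := hasSum_sum (s := Finset.univ) fun j _ => h1 j
  have hint : ∀ j : Fin d, Integrable fun t => u t j * v t j := fun j =>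
    (memLp_coord j u).integrable_mul (memLp_coord j v)
  rw [← integral_finsetSum _ fun j _ => hint j] at h2
  have e : inner ℝ u v = ∫ t, ∑ j, u t j * v t j := by
    rw [L2.inner_def]
    refine integral_congr_ae (Filter.Eventually.of_forall fun t => ?_)
    simp only [PiLp.inner_apply, RCLike.inner_apply, conj_trivial]
    exact Finset.sum_congr rfl fun j _ => mul_comm _ _
  rw [e]
  refine h2.congr_fun fun k => ?_
  rw [PiLp.inner_apply, Complex.re_sum]

theorem hasSum_norm_fc (u : L2 d L) : HasSum (fun k => ‖fc k u‖ ^ 2) (‖u‖ ^ 2) := by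
  have h := hasSum_inner_fc u u
  rw [real_inner_self_eq_norm_sq] at h
  convert h using 2 with k
  rw [inner_self_eq_norm_sq_to_K]
  norm_cast

theorem norm_fc_le (k : Fin d → ℤ) (u : L2 d L) : ‖fc k u‖ ≤ ‖u‖ := by
  refine (sq_le_sq₀ (norm_nonneg _) (norm_nonneg _)).1 ?_
  exact le_hasSum (hasSum_norm_fc u) k fun _ _ => by positivity

theorem continuous_fc (k : Fin d → ℤ) : Continuous (fc k : L2 d L → EC d) :=
  AddMonoidHomClass.continuous_of_bound (fc k) 1 fun u => by simpa using norm_fc_le k u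

theorem ext_fc {u v : L2 d L} (h : ∀ k, fc k u = fc k v) : u = v := by
  have h1 := hasSum_norm_fc (u - v)
  simp only [map_sub, h, sub_self, norm_zero, ne_eq, OfNat.ofNat_ne_zero, not_false_eq_true,
    zero_pow] at h1
  have h2 := h1.unique hasSum_zero
  exact sub_eq_zero.1 (norm_eq_zero.1 (pow_eq_zero_iff two_ne_zero |>.1 h2))

/-- Componentwise complex conjugation. -/
def bar (z : EC d) : EC d := WithLp.toLp 2 fun j => conj (z j)

theorem bar_apply (z : EC d) (j : Fin d) : bar z j = conj (z j) := rfl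

/-- The reality condition; apart from square summability it is the only restriction on the
coefficients of a real field (see `exists_fc_eq`). -/
theorem fc_neg (k : Fin d → ℤ) (u : L2 d L) : fc (-k) u = bar (fc k u) := by
  ext j
  rw [bar_apply, fc_apply, fc_apply, map_mul, Complex.conj_ofReal, ← integral_conj]
  simp [chr_neg]

theorem toL2_ae (f : smoothFields d L) : ∀ᵐ t, (toL2 f : L2 d L) t = f.1 t :=
  ContinuousMap.coeFn_toLp (p := 2) (𝕜 := ℝ) volume f.1

theorem fc_toL2 (k : Fin d → ℤ) (f : smoothFields d L) (j : Fin d) :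
    fc k (toL2 f) j = nrm d L * ∫ t, chr (-k) t * ((f.1 t j : ℝ) : ℂ) := by
  rw [fc_apply]
  congr 1
  exact integral_congr_ae ((toL2_ae f).mono fun t h => by simp only [h])

theorem continuous_coord (f : smoothFields d L) (j : Fin d) : Continuous fun t => f.1 t j :=
  (EuclideanSpace.proj j : E d →L[ℝ] ℝ).continuous.comp f.1.continuous

theorem hasDerivAt_coord (f : smoothFields d L) (i j : Fin d) (t : Torus d L) :
    HasDerivAt (fun s : ℝ => f.1 (t + Pi.single i (s : AddCircle L)) j) ((pderiv i f).1 t j) 0 :=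
  (EuclideanSpace.proj j : E d →L[ℝ] ℝ).hasFDerivAt.comp_hasDerivAt (0 : ℝ) (hasDerivAt_field f i t)

theorem fc_pderiv (k : Fin d → ℤ) (i : Fin d) (f : smoothFields d L) :
    fc k (toL2 (pderiv i f)) = ((kap L k i : ℂ) * Complex.I) • fc k (toL2 f) := by
  ext j
  rw [PiLp.smul_apply, fc_toL2, fc_toL2]
  have hc1 : Continuous fun t => chr (-k) t * ((f.1 t j : ℝ) : ℂ) :=
    (chr (-k)).continuous.mul (Complex.continuous_ofReal.comp (continuous_coord f j))
  have hc2 : Continuous fun t => chr (-k) t * (((pderiv i f).1 t j : ℝ) : ℂ) :=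
    (chr (-k)).continuous.mul (Complex.continuous_ofReal.comp (continuous_coord _ j))
  have h := integral_deriv_eq_zero (i := i) (g := fun t => chr (-k) t * ((f.1 t j : ℝ) : ℂ))
    (g' := fun t => ((kap L (-k) i : ℂ) * Complex.I) * (chr (-k) t * ((f.1 t j : ℝ) : ℂ)) +
      chr (-k) t * (((pderiv i f).1 t j : ℝ) : ℂ))
    (fun t => ((hasDerivAt_chr (-k) i t).mul (hasDerivAt_coord f i j t).ofReal_comp).congr_deriv
      (by simp only [AddCircle.coe_zero, Pi.single_zero, add_zero]; ring))
    hc1 ((continuous_const.mul hc1).add hc2)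
  rw [integral_add ((integrable_of_continuous hc1).const_mul _) (integrable_of_continuous hc2),
    integral_const_mul] at h
  have e : (kap L (-k) i : ℂ) = -(kap L k i : ℂ) := by simp [kap]; ring
  rw [e] at h
  rw [smul_eq_mul]
  linear_combination (nrm d L : ℂ) * h

/-- The real part of a complex vector. -/
def reV : EC d →L[ℝ] E d :=
  LinearMap.toContinuousLinearMap
    { toFun := fun z => WithLp.toLp 2 fun j => (z j).re
      map_add' := fun x y => by ext j; simp
      map_smul' := fun c x => by ext j; simp }

theorem reV_apply (z : EC d) (j : Fin d) : reV z j = (z j).re := rfl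

theorem norm_reV_le (z : EC d) : ‖reV z‖ ≤ ‖z‖ := by
  rw [EuclideanSpace.norm_eq, EuclideanSpace.norm_eq]
  refine Real.sqrt_le_sqrt (Finset.sum_le_sum fun j _ => ?_)
  rw [reV_apply]
  gcongr
  exact Complex.abs_re_le_norm _

/-- The real field `t ↦ L^{-d/2} Re (e_k(t) z)`. -/
def mode (k : Fin d → ℤ) : EC d →ₗ[ℝ] smoothFields d L where
  toFun z := ⟨⟨fun t => nrm d L • reV (chr k t • z),
    by fun_prop⟩, (reV.contDiff.comp ((chr_proj_contDiff k).smul contDiff_const)).const_smul _⟩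
  map_add' x y := by
    ext1; ext1 t
    change nrm d L • reV (chr k t • (x + y)) = nrm d L • reV (chr k t • x) + nrm d L • reV (chr k t • y)
    rw [smul_add, map_add, smul_add]
  map_smul' c x := by
    ext1; ext1 t
    change nrm d L • reV (chr k t • (c • x)) = c • (nrm d L • reV (chr k t • x))
    rw [smul_comm (chr k t), map_smul, smul_comm c]

theorem mode_apply (k : Fin d → ℤ) (z : EC d) (t : Torus d L) :
    (mode k z).1 t = nrm d L • reV (chr k t • z) := rfl

theorem norm_mode_le (k : Fin d → ℤ) (z : EC d) (t : Torus d L) :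
    ‖(mode k z).1 t‖ ≤ nrm d L * ‖z‖ := by
  rw [mode_apply, norm_smul, Real.norm_of_nonneg nrm_pos.le]
  refine mul_le_mul_of_nonneg_left ((norm_reV_le _).trans ?_) nrm_pos.le
  rw [norm_smul, norm_chr, one_mul]

theorem pderiv_mode (k : Fin d → ℤ) (i : Fin d) (z : EC d) :
    pderiv i (mode (L := L) k z) = mode k (((kap L k i : ℂ) * Complex.I) • z) := by
  ext1; ext1 t
  refine HasDerivAt.unique (hasDerivAt_field (mode k z) i t) ?_
  have h1 := ((hasDerivAt_chr k i t).smul_const z)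
  have h2 := ((reV (d := d)).hasFDerivAt.comp_hasDerivAt (0 : ℝ) h1).const_smul (nrm d L)
  exact h2.congr_deriv (by rw [mode_apply, smul_smul, mul_comm])

/-- The real part is half of e_k z plus half of its conjugate, which has wave vector -k. For k = 0
both terms are present. -/
theorem fc_mode (k l : Fin d → ℤ) (z : EC d) :
    fc l (toL2 (mode (L := L) k z)) =
      (if l = k then (2⁻¹ : ℂ) • z else 0) + (if l = -k then (2⁻¹ : ℂ) • bar z else 0) := by
  ext j
  rw [fc_toL2]
  have e : ∀ t : Torus d L, chr (-l) t * (((mode k z).1 t j : ℝ) : ℂ) =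
      (nrm d L * 2⁻¹ * z j) * chr (k - l) t + (nrm d L * 2⁻¹ * conj (z j)) * chr (-k - l) t := by
    intro t
    rw [mode_apply, PiLp.smul_apply, reV_apply, smul_eq_mul, Complex.ofReal_mul, Complex.re_eq_add_conj,
      sub_eq_add_neg, sub_eq_add_neg, chr_add, chr_add, chr_neg k]
    simp only [PiLp.smul_apply, smul_eq_mul, map_mul]
    ring
  simp_rw [e]
  have hi : ∀ m, Integrable fun t : Torus d L => chr m t := fun m =>
    integrable_of_continuous (chr m).continuous
  rw [integral_add ((hi _).const_mul _) ((hi _).const_mul _), integral_const_mul,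
    integral_const_mul, integral_chr, integral_chr]
  have h1 : k - l = 0 ↔ l = k := by rw [sub_eq_zero, eq_comm]
  have h2 : -k - l = 0 ↔ l = -k := by rw [sub_eq_zero, eq_comm]
  have h3 : (nrm d L : ℂ) ^ 2 * ((L ^ d : ℝ) : ℂ) = 1 := by
    rw [← Complex.ofReal_pow, ← Complex.ofReal_mul, nrm_sq_mul]; simp
  simp only [h1, h2, PiLp.add_apply]
  have e1 : (if l = k then (2⁻¹ : ℂ) • z else 0) j = if l = k then 2⁻¹ * z j else 0 := by
    split_ifs <;> simp
  have e2 : (if l = -k then (2⁻¹ : ℂ) • bar z else 0) j = if l = -k then 2⁻¹ * conj (z j) else 0 := by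
    split_ifs <;> simp [bar_apply]
  rw [e1, e2]
  have e3 : ∀ (p : Prop) [Decidable p] (x : ℂ), (nrm d L : ℂ) * (nrm d L * 2⁻¹ * x *
      if p then ((L ^ d : ℝ) : ℂ) else 0) = if p then 2⁻¹ * x else 0 := by
    intro p _ x
    split_ifs
    · linear_combination 2⁻¹ * x * h3
    · simp
  rw [mul_add, e3, e3]

end Fourier

/-! ### Fourier truncations and the Riesz–Fischer theorem. -/

section Truncation

open Filter

variable {d : ℕ} {L : ℝ} [Fact (0 < L)]

theorem bar_smul (c : ℂ) (x : EC d) : bar (c • x) = (starRingEnd ℂ c) • bar x := by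
  ext j; simp [bar_apply]

/-- The wave vectors with entries in `[-n, n]`. -/
def box (d n : ℕ) : Finset (Fin d → ℤ) := Fintype.piFinset fun _ => Finset.Icc (-(n : ℤ)) n

theorem mem_box {n : ℕ} {k : Fin d → ℤ} : k ∈ box d n ↔ ∀ i, |k i| ≤ n := by
  simp [box, abs_le]

theorem neg_mem_box {n : ℕ} {k : Fin d → ℤ} : -k ∈ box d n ↔ k ∈ box d n := by
  simp [mem_box]

theorem box_mono {m n : ℕ} (h : m ≤ n) : box d m ⊆ box d n := fun k hk =>
  mem_box.2 fun i => (mem_box.1 hk i).trans (by exact_mod_cast h)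

theorem tendsto_box : Tendsto (box d) atTop atTop := by
  refine tendsto_atTop_finset_of_monotone (fun m n h => box_mono h) fun k => ?_
  refine ⟨∑ i, (k i).natAbs, mem_box.2 fun i => ?_⟩
  rw [Int.abs_eq_natAbs]
  exact_mod_cast Finset.single_le_sum (f := fun i => (k i).natAbs) (fun _ _ => Nat.zero_le _)
    (Finset.mem_univ i)

/-- The part of a sum over the wave vectors outside a box. -/
def tail (f : (Fin d → ℤ) → ℝ) (n : ℕ) : ℝ := ∑' k, if k ∈ box d n then 0 else f k

theorem summable_tail {f : (Fin d → ℤ) → ℝ} (hf : Summable f) (n : ℕ) :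
    Summable fun k => if k ∈ box d n then 0 else f k := by
  refine (hf.indicator {k | k ∉ box d n}).congr fun k => ?_
  simp only [Set.indicator, Set.mem_ofPred_eq]
  split_ifs <;> simp_all

theorem tendsto_tail {f : (Fin d → ℤ) → ℝ} (hf : Summable f) : Tendsto (tail f) atTop (𝓝 0) := by
  have h : ∀ n, tail f n = ∑' k, f k - ∑ k ∈ box d n, f k := by
    intro n
    have h1 := (hf.hasSum).sub (hasSum_sum_of_ne_finset_zero (s := box d n)
      (f := fun k => if k ∈ box d n then f k else 0) fun k hk => if_neg hk)
    have h2 : ∑ k ∈ box d n, (if k ∈ box d n then f k else 0) = ∑ k ∈ box d n, f k :=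
      Finset.sum_congr rfl fun k hk => if_pos hk
    rw [h2] at h1
    rw [← h1.tsum_eq, tail]
    refine tsum_congr fun k => ?_
    split_ifs <;> simp
  have h3 : Tendsto (fun n => ∑ k ∈ box d n, f k) atTop (𝓝 (∑' k, f k)) :=
    hf.hasSum.comp tendsto_box
  have h4 := (tendsto_const_nhds (x := ∑' k, f k)).sub h3
  rw [sub_self] at h4
  exact h4.congr fun n => (h n).symm

theorem norm_sq_le_tsum {u : L2 d L} {c : (Fin d → ℤ) → ℝ} (hc : Summable c)
    (h : ∀ k, ‖fc k u‖ ^ 2 ≤ c k) : ‖u‖ ^ 2 ≤ ∑' k, c k :=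
  hasSum_le h (hasSum_norm_fc u) hc.hasSum

theorem norm_sq_le_norm_sq {u v : L2 d L} (h : ∀ k, ‖fc k u‖ ≤ ‖fc k v‖) : ‖u‖ ≤ ‖v‖ := by
  refine (sq_le_sq₀ (norm_nonneg _) (norm_nonneg _)).1 ?_
  exact hasSum_le (fun k => by gcongr; exact h k) (hasSum_norm_fc u) (hasSum_norm_fc v)

/-- A trigonometric polynomial with given coefficients. -/
def trig (n : ℕ) (a : (Fin d → ℤ) → EC d) : smoothFields d L := ∑ k ∈ box d n, mode k (a k)

/-- The box is symmetric, so the halves carried by k and -k recombine to the full coefficient. -/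
theorem fc_trig {a : (Fin d → ℤ) → EC d} (ha : ∀ k, a (-k) = bar (a k)) (n : ℕ)
    (l : Fin d → ℤ) : fc l (toL2 (trig (L := L) n a)) = if l ∈ box d n then a l else 0 := by
  have h1 : ∀ k : Fin d → ℤ, (l = -k) ↔ (-l = k) := fun k => by
    rw [neg_eq_iff_eq_neg]
  simp only [trig, map_sum, fc_mode, Finset.sum_add_distrib, h1, Finset.sum_ite_eq, neg_mem_box]
  split_ifs
  · rw [← ha, neg_neg, ← add_smul]; norm_num
  · simp

theorem cauchySeq_trig {a : (Fin d → ℤ) → EC d} (ha : ∀ k, a (-k) = bar (a k))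
    (hs : Summable fun k => ‖a k‖ ^ 2) : CauchySeq fun n => (toL2 (trig n a) : L2 d L) := by
  have ht := (tendsto_tail hs).sqrt
  rw [Real.sqrt_zero] at ht
  refine cauchySeq_of_le_tendsto_0 (fun N => √(tail (fun k => ‖a k‖ ^ 2) N)) (fun n m N hn hm => ?_) ht
  rw [dist_eq_norm]
  refine Real.le_sqrt_of_sq_le (norm_sq_le_tsum (summable_tail hs N) fun k => ?_)
  rw [map_sub, fc_trig ha, fc_trig ha]
  by_cases hk : k ∈ box d N
  · rw [if_pos (box_mono hn hk), if_pos (box_mono hm hk), if_pos hk]; simp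
  · rw [if_neg hk]
    split_ifs <;> simp

/-- The Riesz–Fischer theorem for real vector fields. -/
theorem exists_fc_eq {a : (Fin d → ℤ) → EC d} (ha : ∀ k, a (-k) = bar (a k))
    (hs : Summable fun k => ‖a k‖ ^ 2) : ∃ u : L2 d L, ∀ k, fc k u = a k := by
  obtain ⟨u, hu⟩ := cauchySeq_tendsto_of_complete (cauchySeq_trig (L := L) ha hs)
  refine ⟨u, fun k => ?_⟩
  have h1 := ((continuous_fc k).tendsto u).comp hu
  refine tendsto_nhds_unique h1 (tendsto_const_nhds.congr' ?_)
  obtain ⟨N, hN⟩ := (tendsto_box (d := d)).eventually (eventually_ge_atTop {k}) |>.exists_forall_of_atTop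
  filter_upwards [eventually_ge_atTop N] with n hn
  rw [Function.comp_apply, fc_trig ha, if_pos]
  exact hN n hn (by simp)

/-- The Fourier truncation of a field. -/
def trunc (n : ℕ) : L2 d L →ₗ[ℝ] smoothFields d L := ∑ k ∈ box d n, mode k ∘ₗ fc k

theorem trunc_eq (n : ℕ) (u : L2 d L) : trunc n u = trig n fun k => fc k u := by
  simp [trunc, trig]

theorem fc_trunc (n : ℕ) (u : L2 d L) (k : Fin d → ℤ) :
    fc k (toL2 (trunc n u)) = if k ∈ box d n then fc k u else 0 := by
  rw [trunc_eq, fc_trig fun k => fc_neg k u]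

theorem norm_sub_trunc_sq (n : ℕ) (u : L2 d L) :
    ‖u - toL2 (trunc n u)‖ ^ 2 = tail (fun k => ‖fc k u‖ ^ 2) n := by
  rw [← (hasSum_norm_fc (u - toL2 (trunc n u))).tsum_eq, tail]
  refine tsum_congr fun k => ?_
  rw [map_sub, fc_trunc]
  split_ifs <;> simp

theorem tendsto_trunc (u : L2 d L) :
    Tendsto (fun n => (toL2 (trunc n u) : L2 d L)) atTop (𝓝 u) := by
  rw [tendsto_iff_norm_sub_tendsto_zero]
  have h := (tendsto_tail (hasSum_norm_fc u).summable).sqrt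
  rw [Real.sqrt_zero] at h
  refine h.congr fun n => ?_
  rw [← norm_sub_trunc_sq, Real.sqrt_sq (norm_nonneg _), norm_sub_rev]

theorem norm_trunc_le (n : ℕ) (u : L2 d L) : ‖(toL2 (trunc n u) : L2 d L)‖ ≤ ‖u‖ :=
  norm_sq_le_norm_sq fun k => by rw [fc_trunc]; split_ifs <;> simp

theorem pderiv_trunc {u g : L2 d L} {i : Fin d}
    (h : ∀ k, fc k g = ((kap L k i : ℂ) * Complex.I) • fc k u) (n : ℕ) :
    pderiv i (trunc n u) = trunc n g := by
  simp [trunc, pderiv_mode, h]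

theorem norm_trunc_sub_trunc_apply_le {u : L2 d L} (hs : Summable fun k => ‖fc k u‖) {m n : ℕ}
    (h : n ≤ m) (t : Torus d L) :
    ‖(trunc m u).1 t - (trunc n u).1 t‖ ≤ nrm d L * tail (fun k => ‖fc k u‖) n := by
  have e : (trunc m u).1 t - (trunc n u).1 t = ∑ k ∈ box d m \ box d n, (mode k (fc k u)).1 t := by
    have e1 : ∀ n, (trunc n u).1 t = ∑ k ∈ box d n, (mode k (fc k u)).1 t := by
      intro n; simp [trunc]
    rw [e1, e1, ← Finset.sum_sdiff (box_mono h), add_sub_cancel_right]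
  rw [e]
  calc ‖∑ k ∈ box d m \ box d n, (mode k (fc k u)).1 t‖
      ≤ ∑ k ∈ box d m \ box d n, ‖(mode k (fc k u)).1 t‖ := norm_sum_le _ _
    _ ≤ ∑ k ∈ box d m \ box d n, nrm d L * ‖fc k u‖ :=
        Finset.sum_le_sum fun k _ => norm_mode_le _ _ _
    _ = nrm d L * ∑ k ∈ box d m \ box d n, ‖fc k u‖ := by rw [Finset.mul_sum]
    _ ≤ _ := by
        refine mul_le_mul_of_nonneg_left ?_ nrm_pos.le
        have e2 : ∑ k ∈ box d m \ box d n, ‖fc k u‖ =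
            ∑ k ∈ box d m \ box d n, if k ∈ box d n then 0 else ‖fc k u‖ :=
          Finset.sum_congr rfl fun k hk => (if_neg (Finset.mem_sdiff.1 hk).2).symm
        rw [e2]
        exact (summable_tail hs n).sum_le_tsum _ fun k _ => by split_ifs <;> simp

theorem norm_trunc_apply_le {u : L2 d L} (hs : Summable fun k => ‖fc k u‖) (n : ℕ)
    (t : Torus d L) : ‖(trunc n u).1 t‖ ≤ nrm d L * ∑' k, ‖fc k u‖ := by
  have e1 : (trunc n u).1 t = ∑ k ∈ box d n, (mode k (fc k u)).1 t := by simp [trunc]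
  rw [e1]
  calc ‖∑ k ∈ box d n, (mode k (fc k u)).1 t‖
      ≤ ∑ k ∈ box d n, nrm d L * ‖fc k u‖ := norm_sum_le_of_le _ fun k _ => norm_mode_le _ _ _
    _ = nrm d L * ∑ k ∈ box d n, ‖fc k u‖ := by rw [Finset.mul_sum]
    _ ≤ _ := by
        refine mul_le_mul_of_nonneg_left ?_ nrm_pos.le
        exact hs.sum_le_tsum _ fun k _ => norm_nonneg _

theorem exists_subseq_ae (u : L2 d L) : ∃ ns : ℕ → ℕ, StrictMono ns ∧
    ∀ᵐ t, Tendsto (fun j => (trunc (ns j) u).1 t) atTop (𝓝 (u t)) := by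
  have h := tendstoInMeasure_of_tendsto_Lp (tendsto_trunc u)
  obtain ⟨ns, hns, hae⟩ := h.exists_seq_tendsto_ae
  refine ⟨ns, hns, ?_⟩
  have h2 : ∀ᵐ t, ∀ j, (toL2 (trunc (ns j) u) : L2 d L) t = (trunc (ns j) u).1 t :=
    ae_all_iff.2 fun j => toL2_ae _
  filter_upwards [hae, h2] with t h3 h4
  simpa only [h4] using h3

/-- With absolutely summable coefficients the truncations are uniformly Cauchy; an almost everywhere
convergent subsequence transfers the bound to the L² class. -/
theorem ae_norm_sub_trunc_le {u : L2 d L} (hs : Summable fun k => ‖fc k u‖) (n : ℕ) :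
    ∀ᵐ t, ‖u t - (trunc n u).1 t‖ ≤ nrm d L * tail (fun k => ‖fc k u‖) n := by
  obtain ⟨ns, hns, hae⟩ := exists_subseq_ae u
  filter_upwards [hae] with t ht
  refine le_of_tendsto ((ht.sub_const _).norm) ?_
  filter_upwards [hns.tendsto_atTop.eventually (eventually_ge_atTop n)] with j hj
  exact norm_trunc_sub_trunc_apply_le hs hj t

theorem ae_norm_le {u : L2 d L} (hs : Summable fun k => ‖fc k u‖) :
    ∀ᵐ t, ‖u t‖ ≤ nrm d L * ∑' k, ‖fc k u‖ := by
  obtain ⟨ns, hns, hae⟩ := exists_subseq_ae u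
  filter_upwards [hae] with t ht
  exact le_of_tendsto ht.norm (Eventually.of_forall fun j => norm_trunc_apply_le hs _ t)

end Truncation

/-! ### Description of ℍ, 𝕍, D(A), the gradient and the Stokes operator by Fourier coefficients. -/

section Spaces

open Filter

variable {d : ℕ} {L : ℝ} [Fact (0 < L)]

/-- `k · û(k)`, up to a factor. -/
def divc (k : Fin d → ℤ) (z : EC d) : ℂ := ∑ i, (kap L k i : ℂ) * z i

theorem divc_smul (k : Fin d → ℤ) (c : ℂ) (z : EC d) :
    divc (L := L) k (c • z) = c * divc (L := L) k z := by
  simp only [divc, Finset.mul_sum, PiLp.smul_apply, smul_eq_mul]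
  exact Finset.sum_congr rfl fun i _ => by ring

theorem divc_fc_of_solenoidal {f : smoothFields d L} (hf : f ∈ solenoidal d L) (k : Fin d → ℤ) :
    divc (L := L) k (fc k (toL2 f)) = 0 := by
  have h1 : ∑ i, fc k (toL2 (pderiv i f)) i = Complex.I * divc (L := L) k (fc k (toL2 f)) := by
    simp only [fc_pderiv, divc, Finset.mul_sum, PiLp.smul_apply, smul_eq_mul]
    exact Finset.sum_congr rfl fun i _ => by ring
  have h2 : ∑ i, fc k (toL2 (pderiv i f)) i = 0 := by
    simp only [fc_toL2]
    rw [← Finset.mul_sum, ← integral_finsetSum]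
    · have : ∀ t, ∑ i, chr (-k) t * (((pderiv i f).1 t i : ℝ) : ℂ) = 0 := by
        intro t
        rw [← Finset.mul_sum, ← Complex.ofReal_sum, hf t]; simp
      simp [this]
    · exact fun i _ => integrable_of_continuous
        ((chr (-k)).continuous.mul (Complex.continuous_ofReal.comp (continuous_coord _ _)))
  rw [h2] at h1
  exact (mul_eq_zero.1 h1.symm).resolve_left Complex.I_ne_zero

theorem continuous_divc (k : Fin d → ℤ) : Continuous fun u : L2 d L => divc (L := L) k (fc k u) := by
  unfold divc
  refine continuous_finsetSum _ fun i _ => continuous_const.mul ?_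
  exact (EuclideanSpace.proj i : EC d →L[ℂ] ℂ).continuous.comp (continuous_fc k)

theorem mode_mem_solenoidal {k : Fin d → ℤ} {z : EC d} (h : divc (L := L) k z = 0) :
    mode k z ∈ solenoidal d L := by
  intro t
  simp only [pderiv_mode, mode_apply, PiLp.smul_apply, reV_apply, smul_eq_mul]
  rw [← Finset.mul_sum, ← Complex.re_sum]
  have : ∑ i, chr k t * ((kap L k i : ℂ) * Complex.I * z i) =
      chr k t * Complex.I * divc (L := L) k z := by
    rw [divc, Finset.mul_sum]
    exact Finset.sum_congr rfl fun i _ => by ring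
  rw [this, h]; simp

theorem trunc_mem_solenoidal {u : L2 d L} (h : ∀ k, divc (L := L) k (fc k u) = 0) (n : ℕ) :
    trunc n u ∈ solenoidal d L := by
  rw [trunc_eq, trig]
  exact Submodule.sum_mem _ fun k _ => mode_mem_solenoidal (h k)

/-- The divergence condition on one coefficient is closed in L²; conversely it makes every
truncation solenoidal, and truncations converge. -/
theorem mem_H_iff {u : L2 d L} : u ∈ H d L ↔ ∀ k, divc (L := L) k (fc k u) = 0 := by
  constructor
  · intro h k
    have hcl : IsClosed {u : L2 d L | divc (L := L) k (fc k u) = 0} :=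
      isClosed_eq (continuous_divc k) continuous_const
    refine closure_minimal ?_ hcl h
    rintro _ ⟨f, hf, rfl⟩
    exact divc_fc_of_solenoidal hf k
  · intro h
    exact mem_closure_of_tendsto (tendsto_trunc u)
      (Eventually.of_forall fun n => ⟨_, trunc_mem_solenoidal h n, rfl⟩)

theorem divc_fc (u : H d L) (k : Fin d → ℤ) : divc (L := L) k (fc k (u : L2 d L)) = 0 :=
  mem_H_iff.1 u.2 k

theorem fc_of_mem_h1Graph {u : L2 d L} {g : Fin d → L2 d L} (h : (u, g) ∈ h1Graph d L)
    (k : Fin d → ℤ) (i : Fin d) : fc k (g i) = ((kap L k i : ℂ) * Complex.I) • fc k u := by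
  have hcl : IsClosed {p : L2 d L × (Fin d → L2 d L) |
      fc k (p.2 i) = ((kap L k i : ℂ) * Complex.I) • fc k p.1} := by
    have := continuous_fc (L := L) k
    exact isClosed_eq (by fun_prop) (by fun_prop)
  refine closure_minimal ?_ hcl h
  rintro _ ⟨f, rfl⟩
  exact fc_pderiv k i f

theorem vGraph_subset : vGraph d L ⊆ h1Graph d L := closure_mono (Set.image_subset_range _ _)

theorem fc_of_mem_h2Graph {u : L2 d L} {g : Fin d → L2 d L} {w : Fin d → Fin d → L2 d L}
    (h : (u, g, w) ∈ h2Graph d L) (k : Fin d → ℤ) (i j : Fin d) :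
    fc k (w i j) = -((kap L k i * kap L k j : ℝ) : ℂ) • fc k u := by
  have hcl : IsClosed {p : L2 d L × (Fin d → L2 d L) × (Fin d → Fin d → L2 d L) |
      fc k (p.2.2 i j) = -((kap L k i * kap L k j : ℝ) : ℂ) • fc k p.1} := by
    have := continuous_fc (L := L) k
    exact isClosed_eq (by fun_prop) (by fun_prop)
  refine closure_minimal ?_ hcl h
  rintro _ ⟨f, rfl⟩
  simp only [Set.mem_ofPred_eq, fc_pderiv, smul_smul]
  congr 1
  push_cast
  linear_combination (kap L k i : ℂ) * kap L k j * Complex.I_mul_I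

/-- Truncation commutes with differentiation and keeps solenoidal fields solenoidal, so truncations
of u converge in H¹. Hence 𝕍 consists of all u in ℍ with square integrable gradient. -/
theorem mem_V_iff {u : H d L} : u ∈ V d L ↔
    ∃ g : Fin d → L2 d L, ∀ i k, fc k (g i) = ((kap L k i : ℂ) * Complex.I) • fc k (u : L2 d L) := by
  constructor
  · rintro ⟨g, hg⟩
    exact ⟨g, fun i k => fc_of_mem_h1Graph (vGraph_subset hg) k i⟩
  · rintro ⟨g, hg⟩
    refine ⟨g, mem_closure_of_tendsto (b := atTop) (f := fun n : ℕ =>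
      ((toL2 (trunc n (u : L2 d L)) : L2 d L), fun i => (toL2 (trunc n (g i)) : L2 d L))) ?_ ?_⟩
    · exact (tendsto_trunc _).prodMk_nhds (tendsto_pi_nhds.2 fun i => tendsto_trunc _)
    · refine Eventually.of_forall fun n => ⟨trunc n (u : L2 d L),
        trunc_mem_solenoidal (divc_fc u) n, ?_⟩
      ext1
      · rfl
      · funext i
        simp only [pderiv_trunc (hg i)]

theorem exists_mem_h1Graph {u : H d L} (hu : u ∈ V d L) : ∃ g, ((u : L2 d L), g) ∈ h1Graph d L := by
  obtain ⟨g, hg⟩ := hu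
  exact ⟨g, vGraph_subset hg⟩

theorem fc_grad {u : H d L} (hu : u ∈ V d L) (i : Fin d) (k : Fin d → ℤ) :
    fc k (grad (u : L2 d L) i) = ((kap L k i : ℂ) * Complex.I) • fc k (u : L2 d L) := by
  have h := exists_mem_h1Graph hu
  rw [grad, dif_pos h]
  exact fc_of_mem_h1Graph h.choose_spec k i

/-- Coefficients determine an L² field, so the weak gradient does not depend on the choice made in
`grad`. -/
theorem grad_eq {u : H d L} {g : Fin d → L2 d L}
    (h : ∀ i k, fc k (g i) = ((kap L k i : ℂ) * Complex.I) • fc k (u : L2 d L)) :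
    grad (u : L2 d L) = g := by
  funext i
  exact ext_fc fun k => by rw [fc_grad (mem_V_iff.2 ⟨g, h⟩), h]

theorem add_mem_V {u v : H d L} (hu : u ∈ V d L) (hv : v ∈ V d L) : u + v ∈ V d L :=
  mem_V_iff.2 ⟨grad (u : L2 d L) + grad (v : L2 d L), fun i k => by
    simp [fc_grad hu, fc_grad hv]⟩

theorem smul_mem_V {u : H d L} (c : ℝ) (hu : u ∈ V d L) : c • u ∈ V d L :=
  mem_V_iff.2 ⟨c • grad (u : L2 d L), fun i k => by
    simp [fc_grad hu, smul_comm c]⟩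

theorem sub_mem_V {u v : H d L} (hu : u ∈ V d L) (hv : v ∈ V d L) : u - v ∈ V d L := by
  have := add_mem_V hu (smul_mem_V (-1) hv)
  simpa [sub_eq_add_neg] using this

theorem grad_smul {u : H d L} (c : ℝ) (hu : u ∈ V d L) :
    grad ((c • u : H d L) : L2 d L) = c • grad (u : L2 d L) :=
  grad_eq fun i k => by simp [fc_grad hu, smul_comm c]

theorem grad_sub {u v : H d L} (hu : u ∈ V d L) (hv : v ∈ V d L) :
    grad ((u - v : H d L) : L2 d L) = grad (u : L2 d L) - grad (v : L2 d L) :=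
  grad_eq fun i k => by simp [fc_grad hu, fc_grad hv, smul_sub]

/-- The class in `ℍ` of a smooth solenoidal field. -/
def toH (f : solenoidal d L) : H d L :=
  ⟨toL2 f.1, Submodule.le_topologicalClosure _ ⟨f.1, f.2, rfl⟩⟩

theorem grad_toH (f : solenoidal d L) (i : Fin d) :
    grad (toH f : L2 d L) i = toL2 (pderiv i f.1) :=
  congrFun (grad_eq (u := toH f) (g := fun i => toL2 (pderiv i f.1)) fun i k => fc_pderiv k i f.1) i

/-- The symbol `|2π k / L|²` of `-Δ`. -/
def ksq (L : ℝ) (k : Fin d → ℤ) : ℝ := ∑ i, kap L k i ^ 2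

theorem ksq_nonneg (k : Fin d → ℤ) : 0 ≤ ksq L k := Finset.sum_nonneg fun _ _ => by positivity

theorem kap_neg (k : Fin d → ℤ) (i : Fin d) : kap L (-k) i = -kap L k i := by simp [kap]; ring

theorem ksq_neg (k : Fin d → ℤ) : ksq L (-k) = ksq L k := by simp [ksq, kap_neg]

theorem kap_sq_le (k : Fin d → ℤ) (i : Fin d) : kap L k i ^ 2 ≤ ksq L k :=
  Finset.single_le_sum (f := fun i => kap L k i ^ 2) (fun _ _ => by positivity) (Finset.mem_univ i)

/-- Square summability of |κ|² û(k) alone controls all derivatives up to order two, because κᵢ² ≤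
|κ|² ≤ 1 + |κ|⁴ and |κᵢ κⱼ| ≤ |κ|². Truncations then converge in H². -/
theorem mem_DA_iff {u : H d L} : u ∈ DA d L ↔
    ∃ w : H d L, ∀ k, fc k (w : L2 d L) = (ksq L k : ℂ) • fc k (u : L2 d L) := by
  constructor
  · rintro ⟨-, ⟨g, w⟩, h⟩
    have hfc : ∀ k, fc k (-∑ i, w i i) = (ksq L k : ℂ) • fc k (u : L2 d L) := by
      intro k
      simp only [map_neg, map_sum, fc_of_mem_h2Graph h, ksq]
      rw [← Finset.sum_smul, ← neg_smul]
      congr 1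
      push_cast
      rw [Finset.sum_neg_distrib, neg_neg]
      exact Finset.sum_congr rfl fun i _ => by ring
    refine ⟨⟨-∑ i, w i i, mem_H_iff.2 fun k => ?_⟩, hfc⟩
    rw [hfc, divc_smul, divc_fc, mul_zero]
  · rintro ⟨w, hw⟩
    have hnw : ∀ k, ‖fc k (w : L2 d L)‖ = ksq L k * ‖fc k (u : L2 d L)‖ := fun k => by
      rw [hw, norm_smul, Complex.norm_real, Real.norm_of_nonneg (ksq_nonneg k)]
    have hsu := (hasSum_norm_fc (u : L2 d L)).summable
    have hsw := (hasSum_norm_fc (w : L2 d L)).summable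
    have h1 : ∀ i, ∃ g : L2 d L, ∀ k, fc k g = ((kap L k i : ℂ) * Complex.I) • fc k (u : L2 d L) := by
      intro i
      refine exists_fc_eq (fun k => ?_) ((hsu.add hsw).of_nonneg_of_le (fun k => by positivity)
        fun k => ?_)
      · rw [bar_smul, fc_neg, kap_neg]; simp
      · rw [norm_smul, norm_mul, Complex.norm_I, mul_one, Complex.norm_real, mul_pow, hnw, mul_pow,
          Real.norm_eq_abs, sq_abs]
        have h2 := kap_sq_le (L := L) k i
        have h3 := ksq_nonneg (L := L) k
        have h4 : 0 ≤ ‖fc k (u : L2 d L)‖ ^ 2 := by positivity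
        nlinarith [sq_nonneg (ksq L k - 1), mul_le_mul_of_nonneg_right h2 h4]
    have h2 : ∀ i j, ∃ g : L2 d L, ∀ k,
        fc k g = -((kap L k i * kap L k j : ℝ) : ℂ) • fc k (u : L2 d L) := by
      intro i j
      refine exists_fc_eq (fun k => ?_) (hsw.of_nonneg_of_le (fun k => by positivity) fun k => ?_)
      · rw [bar_smul, fc_neg, kap_neg, kap_neg]; simp
      · rw [norm_smul, norm_neg, Complex.norm_real, hnw, mul_pow, mul_pow]
        refine mul_le_mul_of_nonneg_right ?_ (by positivity)
        rw [Real.norm_eq_abs, sq_abs, mul_pow, sq (ksq L k)]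
        exact mul_le_mul (kap_sq_le k i) (kap_sq_le k j) (by positivity) (ksq_nonneg k)
    choose g hg using h1
    choose w' hw' using h2
    refine ⟨mem_V_iff.2 ⟨g, hg⟩, (g, w'), mem_closure_of_tendsto (b := atTop) (f := fun n : ℕ =>
      ((toL2 (trunc n (u : L2 d L)) : L2 d L), (fun i => (toL2 (trunc n (g i)) : L2 d L)),
        fun i j => (toL2 (trunc n (w' i j)) : L2 d L))) ?_ ?_⟩
    · exact (tendsto_trunc _).prodMk_nhds ((tendsto_pi_nhds.2 fun i => tendsto_trunc _).prodMk_nhds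
        (tendsto_pi_nhds.2 fun i => tendsto_pi_nhds.2 fun j => tendsto_trunc _))
    · refine Eventually.of_forall fun n => ⟨trunc n (u : L2 d L), ?_⟩
      have e : ∀ i j, pderiv i (trunc n (g j)) = trunc n (w' i j) := fun i j =>
        pderiv_trunc (fun k => by
          rw [hw', hg, smul_smul]
          congr 1
          push_cast
          linear_combination -(kap L k i : ℂ) * kap L k j * Complex.I_mul_I) n
      simp only [fun i => pderiv_trunc (hg i) n, e]

/-- On the torus the Laplacian preserves the divergence condition, so the Leray projection acts
trivially and A is the multiplier |κ|². -/
theorem fc_stokes {u : H d L} (hu : u ∈ DA d L) (k : Fin d → ℤ) :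
    fc k (stokes u : L2 d L) = (ksq L k : ℂ) • fc k (u : L2 d L) := by
  obtain ⟨w, hw⟩ := mem_DA_iff.1 hu
  have h := hu.2
  have hlap : laplacian (u : L2 d L) = ((-w : H d L) : L2 d L) := by
    refine ext_fc fun k => ?_
    have hc := fun i j => fc_of_mem_h2Graph (g := h.choose.1) (w := h.choose.2) h.choose_spec k i j
    rw [laplacian, dif_pos h, Submodule.coe_neg, map_neg, hw, map_sum]
    simp only [hc, ksq]
    rw [← Finset.sum_smul, ← neg_smul]
    congr 1
    push_cast
    rw [Finset.sum_neg_distrib]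
    congr 1
    exact Finset.sum_congr rfl fun i _ => by ring
  have h2 : stokes u = w := by
    rw [stokes, hlap, leray, Submodule.orthogonalProjectionOnto_mem_subspace_eq_self, neg_neg]
  rw [h2, hw]

theorem ext_fcH {u v : H d L} (h : ∀ k, fc k (u : L2 d L) = fc k (v : L2 d L)) : u = v :=
  Subtype.ext (ext_fc h)

theorem mem_DA_and_stokes_eq {u w : H d L}
    (h : ∀ k, fc k (w : L2 d L) = (ksq L k : ℂ) • fc k (u : L2 d L)) :
    u ∈ DA d L ∧ stokes u = w := by
  have hu : u ∈ DA d L := mem_DA_iff.2 ⟨w, h⟩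
  exact ⟨hu, ext_fcH fun k => by rw [fc_stokes hu, h]⟩

theorem add_mem_DA {u v : H d L} (hu : u ∈ DA d L) (hv : v ∈ DA d L) :
    u + v ∈ DA d L ∧ stokes (u + v) = stokes u + stokes v :=
  mem_DA_and_stokes_eq fun k => by simp [fc_stokes hu, fc_stokes hv]

theorem sub_mem_DA {u v : H d L} (hu : u ∈ DA d L) (hv : v ∈ DA d L) :
    u - v ∈ DA d L ∧ stokes (u - v) = stokes u - stokes v :=
  mem_DA_and_stokes_eq fun k => by simp [fc_stokes hu, fc_stokes hv, smul_sub]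

theorem inner_stokes {u v : H d L} (hu : u ∈ DA d L) (hv : v ∈ V d L) :
    inner ℝ (stokes u) v = stokesForm u v := by
  have h1 := hasSum_inner_fc (stokes u : L2 d L) (v : L2 d L)
  have h2 := hasSum_sum (s := Finset.univ) fun i _ =>
    hasSum_inner_fc (grad (u : L2 d L) i) (grad (v : L2 d L) i)
  rw [Submodule.coe_inner, stokesForm]
  refine h1.unique (h2.congr_fun fun k => ?_)
  simp only [fc_grad hu.1, fc_grad hv, fc_stokes hu, inner_smul_left, inner_smul_right, ksq]
  rw [← Complex.re_sum, Complex.conj_ofReal]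
  congr 1
  push_cast
  rw [Finset.sum_mul]
  refine Finset.sum_congr rfl fun i _ => ?_
  rw [map_mul, Complex.conj_ofReal, Complex.conj_I]
  linear_combination ((kap L k i : ℂ) ^ 2 * inner ℂ (fc k (u : L2 d L)) (fc k (v : L2 d L))) *
    Complex.I_mul_I

end Spaces

/-! ### Truncations on ℍ, the Stokes resolvent, sup bounds and compactness in D(A). -/

section Stokes

open Filter

variable {d : ℕ} {L : ℝ} [Fact (0 < L)]

theorem inner_smul_rightH (x y : H d L) (c : ℝ) : inner ℝ x (c • y) = c * inner ℝ x y := by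
  simp [inner_smul_right]

theorem inner_smul_leftH (x y : H d L) (c : ℝ) : inner ℝ (c • x) y = c * inner ℝ x y := by
  simp [inner_smul_left]

/-- The Fourier truncation of an element of `ℍ`, as a smooth solenoidal field. -/
def truncS (n : ℕ) (u : H d L) : solenoidal d L :=
  ⟨trunc n (u : L2 d L), trunc_mem_solenoidal (divc_fc u) n⟩

/-- The Fourier truncation on `ℍ`. -/
def PH (n : ℕ) : H d L →ₗ[ℝ] H d L where
  toFun u := toH (truncS n u)
  map_add' u v := Subtype.ext (by
    change toL2 (trunc n ((u : L2 d L) + (v : L2 d L))) = toL2 (trunc n (u : L2 d L)) + toL2 (trunc n (v : L2 d L))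
    rw [map_add, map_add])
  map_smul' c u := Subtype.ext (by
    change toL2 (trunc n (c • (u : L2 d L))) = c • toL2 (trunc n (u : L2 d L))
    rw [map_smul, map_smul])

theorem PH_apply (n : ℕ) (u : H d L) : PH n u = toH (truncS n u) := rfl

theorem coe_PH (n : ℕ) (u : H d L) : (PH n u : L2 d L) = toL2 (trunc n (u : L2 d L)) := rfl

theorem fc_PH (n : ℕ) (u : H d L) (k : Fin d → ℤ) :
    fc k (PH n u : L2 d L) = if k ∈ box d n then fc k (u : L2 d L) else 0 := fc_trunc n _ k

theorem PH_PH (n : ℕ) (u : H d L) : PH n (PH n u) = PH n u :=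
  ext_fcH fun k => by rw [fc_PH, fc_PH]; split_ifs <;> rfl

theorem norm_PH_le (n : ℕ) (u : H d L) : ‖PH n u‖ ≤ ‖u‖ := norm_trunc_le n _

theorem inner_PH_left (n : ℕ) (u v : H d L) : inner ℝ (PH n u) v = inner ℝ u (PH n v) := by
  have h1 := hasSum_inner_fc (PH n u : L2 d L) (v : L2 d L)
  have h2 := hasSum_inner_fc (u : L2 d L) (PH n v : L2 d L)
  refine h1.unique (h2.congr_fun fun k => ?_)
  rw [fc_PH, fc_PH]
  split_ifs <;> simp

theorem tendsto_PH (u : H d L) : Tendsto (fun n => PH n u) atTop (𝓝 u) :=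
  tendsto_subtype_rng.2 (tendsto_trunc (u : L2 d L))

theorem toH_mem_DA (f : solenoidal d L) :
    toH f ∈ DA d L ∧ (stokes (toH f) : L2 d L) = -toL2 (lap f.1) := by
  have h : ∀ k, fc k (-toL2 (lap f.1) : L2 d L) = (ksq L k : ℂ) • fc k (toH f : L2 d L) := by
    intro k
    simp only [lap, LinearMap.sum_apply, LinearMap.comp_apply, map_neg, map_sum, fc_pderiv,
      smul_smul, ksq]
    rw [← Finset.sum_smul, ← neg_smul]
    congr 1
    push_cast
    rw [← Finset.sum_neg_distrib]
    refine Finset.sum_congr rfl fun i _ => ?_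
    linear_combination -(kap L k i : ℂ) ^ 2 * Complex.I_mul_I
  have hH : -toL2 (lap f.1) ∈ H d L := mem_H_iff.2 fun k => by
    rw [h, divc_smul, divc_fc, mul_zero]
  have h2 := mem_DA_and_stokes_eq (u := toH f) (w := ⟨_, hH⟩) h
  exact ⟨h2.1, by rw [h2.2]⟩

theorem PH_mem_DA (n : ℕ) (u : H d L) : PH n u ∈ DA d L := (toH_mem_DA _).1

theorem fc_stokes_PH (n : ℕ) (u : H d L) (k : Fin d → ℤ) :
    fc k (stokes (PH n u) : L2 d L) =
      if k ∈ box d n then (ksq L k : ℂ) • fc k (u : L2 d L) else 0 := by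
  rw [fc_stokes (PH_mem_DA n u), fc_PH]
  split_ifs <;> simp

theorem PH_stokes {u : H d L} (hu : u ∈ DA d L) (n : ℕ) : PH n (stokes u) = stokes (PH n u) :=
  ext_fcH fun k => by rw [fc_PH, fc_stokes_PH, fc_stokes hu]

theorem norm_stokes_PH_le {u : H d L} (hu : u ∈ DA d L) (n : ℕ) :
    ‖stokes (PH n u)‖ ≤ ‖stokes u‖ := by
  rw [← PH_stokes hu]; exact norm_PH_le n _

theorem norm_stokes_PH_le_sum (n : ℕ) (u : H d L) :
    ‖stokes (PH n u)‖ ≤ (∑ k ∈ box d n, ksq L k) * ‖u‖ := by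
  have hs : 0 ≤ ∑ k ∈ box d n, ksq L k := Finset.sum_nonneg fun k _ => ksq_nonneg k
  have h := norm_sq_le_norm_sq (u := (stokes (PH n u) : L2 d L))
    (v := (∑ k ∈ box d n, ksq L k) • (u : L2 d L)) fun k => by
      rw [fc_stokes_PH, map_smul, norm_smul, Real.norm_of_nonneg hs]
      split_ifs with hk
      · rw [norm_smul, Complex.norm_real, Real.norm_of_nonneg (ksq_nonneg k)]
        gcongr
        exact Finset.single_le_sum (f := fun k => ksq L k) (fun k _ => ksq_nonneg k) hk
      · rw [norm_zero]; positivity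
  rw [norm_smul, Real.norm_of_nonneg hs] at h
  exact h

theorem PH_stokes_PH (n : ℕ) (u : H d L) : PH n (stokes (PH n u)) = stokes (PH n u) := by
  rw [PH_stokes (PH_mem_DA n u), PH_PH]

theorem ksq_ge_of_notMem_box {n : ℕ} {k : Fin d → ℤ} (hk : k ∉ box d n) :
    (2 * Real.pi / L) ^ 2 * (n + 1) ^ 2 ≤ ksq L k := by
  simp only [mem_box, not_forall, not_le] at hk
  obtain ⟨i, hi⟩ := hk
  refine le_trans ?_ (kap_sq_le k i)
  -- Integrality turns n < |k i| into n + 1 ≤ |k i|, which keeps the spectral bound positive for n =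
  -- 0.
  have h1 : (n + 1 : ℝ) ≤ |(k i : ℝ)| := by
    have : (n : ℤ) + 1 ≤ |k i| := hi
    exact_mod_cast this
  have e : kap L k i = 2 * Real.pi / L * k i := by rw [kap]; ring
  rw [e, mul_pow]
  refine mul_le_mul_of_nonneg_left ?_ (by positivity)
  rw [← sq_abs (k i : ℝ)]
  gcongr

theorem norm_sub_PH_le {u : H d L} (hu : u ∈ DA d L) (n : ℕ) :
    (2 * Real.pi / L) ^ 2 * (n + 1) ^ 2 * ‖u - PH n u‖ ≤ ‖stokes u‖ := by
  set c : ℝ := (2 * Real.pi / L) ^ 2 * (n + 1) ^ 2 with hc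
  have hc0 : 0 ≤ c := by positivity
  have h := norm_sq_le_norm_sq (u := c • ((u - PH n u : H d L) : L2 d L))
    (v := (stokes u : L2 d L)) fun k => by
      rw [map_smul, norm_smul, Real.norm_of_nonneg hc0, Submodule.coe_sub, map_sub, fc_PH,
        fc_stokes hu, norm_smul, Complex.norm_real, Real.norm_of_nonneg (ksq_nonneg k)]
      split_ifs with hk
      · have := ksq_nonneg (L := L) k
        simp only [sub_self, norm_zero, mul_zero]; positivity
      · rw [sub_zero]
        gcongr
        exact ksq_ge_of_notMem_box hk
  rw [norm_smul, Real.norm_of_nonneg hc0] at h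
  exact h

theorem stokesForm_self_le {u : H d L} (hu : u ∈ DA d L) :
    stokesForm u u ≤ ‖stokes u‖ * ‖u‖ := by
  rw [← inner_stokes hu hu.1]; exact real_inner_le_norm _ _

theorem stokesForm_self (u : H d L) :
    stokesForm u u = ∑ i, ‖grad (u : L2 d L) i‖ ^ 2 := by
  simp [stokesForm]

/-! ### The resolvent -/

theorem exists_resolvent {l : ℝ} (hl : 0 < l) (z : H d L) :
    ∃ y ∈ DA d L, y + l • stokes y = z ∧
      ∀ k, fc k (y : L2 d L) = (1 + l * ksq L k)⁻¹ • fc k (z : L2 d L) := by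
  have hs := (hasSum_norm_fc (z : L2 d L)).summable
  have hk := fun k => ksq_nonneg (L := L) (d := d) k
  -- A bounded, real and even Fourier multiplier preserves square summability, the reality condition
  -- and the divergence condition, so it acts on ℍ.
  have key : ∀ m : (Fin d → ℤ) → ℝ, (∀ k, m (-k) = m k) → ∀ M : ℝ, (∀ k, |m k| ≤ M) →
      ∃ y : H d L, ∀ k, fc k (y : L2 d L) = m k • fc k (z : L2 d L) := by
    intro m hm M hM
    obtain ⟨y, hy⟩ := exists_fc_eq (L := L) (a := fun k => m k • fc k (z : L2 d L)) (fun k => by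
        rw [hm, fc_neg, ← Complex.coe_smul, ← Complex.coe_smul, bar_smul]; simp)
      ((hs.mul_left (M ^ 2)).of_nonneg_of_le (fun k => by positivity) fun k => by
        rw [norm_smul, mul_pow, Real.norm_eq_abs]
        have := hM k
        gcongr)
    refine ⟨⟨y, mem_H_iff.2 fun k => ?_⟩, hy⟩
    rw [hy, ← Complex.coe_smul, divc_smul, divc_fc, mul_zero]
  obtain ⟨y, hy⟩ := key (fun k => (1 + l * ksq L k)⁻¹) (fun k => by simp [ksq_neg]) 1 fun k => by
    have := hk k
    rw [abs_of_nonneg (by positivity)]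
    exact inv_le_one_of_one_le₀ (by nlinarith)
  obtain ⟨w, hw⟩ := key (fun k => ksq L k * (1 + l * ksq L k)⁻¹) (fun k => by simp [ksq_neg]) l⁻¹
    fun k => by
      have := hk k
      rw [abs_of_nonneg (by positivity), ← div_eq_mul_inv, div_le_iff₀ (by positivity)]
      field_simp
      linarith
  obtain ⟨h1, h2⟩ := mem_DA_and_stokes_eq (u := y) (w := w) fun k => by
    rw [hw, hy, Complex.coe_smul, smul_smul]
  refine ⟨y, h1, ext_fcH fun k => ?_, hy⟩
  have := hk k
  rw [h2, Submodule.coe_add, Submodule.coe_smul, map_add, map_smul, hy, hw, smul_smul, ← add_smul]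
  have e : (1 + l * ksq L k)⁻¹ + l * (ksq L k * (1 + l * ksq L k)⁻¹) = 1 := by
    field_simp
  rw [e, one_smul]

/-- The resolvent `(I + l A)⁻¹`. -/
def resolv (l : ℝ) (z : H d L) : H d L :=
  if h : 0 < l then (exists_resolvent h z).choose else z

theorem resolv_spec {l : ℝ} (hl : 0 < l) (z : H d L) :
    resolv l z ∈ DA d L ∧ resolv l z + l • stokes (resolv l z) = z ∧
      ∀ k, fc k (resolv l z : L2 d L) = (1 + l * ksq L k)⁻¹ • fc k (z : L2 d L) := by
  rw [resolv, dif_pos hl]; exact (exists_resolvent hl z).choose_spec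

theorem norm_resolv_sub_le {l : ℝ} (hl : 0 < l) (y z : H d L) :
    ‖resolv l y - resolv l z‖ ≤ ‖y - z‖ :=
  norm_sq_le_norm_sq (u := ((resolv l y - resolv l z : H d L) : L2 d L))
    (v := ((y - z : H d L) : L2 d L)) fun k => by
    have := ksq_nonneg (L := L) k
    rw [Submodule.coe_sub, Submodule.coe_sub, map_sub, map_sub, (resolv_spec hl y).2.2,
      (resolv_spec hl z).2.2, ← smul_sub, norm_smul, Real.norm_of_nonneg (by positivity)]
    exact mul_le_of_le_one_left (norm_nonneg _) (inv_le_one_of_one_le₀ (by nlinarith))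

/-- Dominated convergence of the coefficients. It serves to approximate elements of K by elements of
K ∩ D(A). -/
theorem tendsto_resolv (z : H d L) : Tendsto (fun n : ℕ => resolv (1 / (n + 1)) z) atTop (𝓝 z) := by
  rw [tendsto_iff_norm_sub_tendsto_zero]
  have hn : ∀ n : ℕ, (0 : ℝ) < 1 / (n + 1) := fun n => by positivity
  have hfc : ∀ (n : ℕ) k, ‖fc k ((resolv (1 / (n + 1)) z - z : H d L) : L2 d L)‖ ^ 2 =
      ((1 + 1 / (n + 1) * ksq L k)⁻¹ - 1) ^ 2 * ‖fc k (z : L2 d L)‖ ^ 2 := by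
    intro n k
    rw [Submodule.coe_sub, map_sub, (resolv_spec (hn n) z).2.2]
    nth_rewrite 2 [← one_smul ℝ (fc k (z : L2 d L))]
    rw [← sub_smul, norm_smul, mul_pow, Real.norm_eq_abs, sq_abs]
  have hle : ∀ (n : ℕ) (k : Fin d → ℤ), ((1 + 1 / (n + 1) * ksq L k)⁻¹ - 1) ^ 2 ≤ 1 := by
    intro n k
    have h0 := ksq_nonneg (L := L) k
    have h1 : 0 ≤ 1 / ((n : ℝ) + 1) * ksq L k := by positivity
    have h2 : (1 + 1 / ((n : ℝ) + 1) * ksq L k)⁻¹ ≤ 1 := inv_le_one_of_one_le₀ (by linarith)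
    have h3 : 0 ≤ (1 + 1 / ((n : ℝ) + 1) * ksq L k)⁻¹ := by positivity
    nlinarith
  have h := tendsto_tsum_of_dominated_convergence (𝓕 := atTop)
    (f := fun (n : ℕ) k => ‖fc k ((resolv (1 / (n + 1)) z - z : H d L) : L2 d L)‖ ^ 2)
    (g := fun _ => (0 : ℝ)) (hasSum_norm_fc (z : L2 d L)).summable (fun k => ?_)
    (Eventually.of_forall fun n k => ?_)
  · rw [tsum_zero] at h
    have h2 := h.sqrt
    rw [Real.sqrt_zero] at h2
    refine h2.congr fun n => ?_
    rw [(hasSum_norm_fc ((resolv (1 / (n + 1)) z - z : H d L) : L2 d L)).tsum_eq,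
      Real.sqrt_sq (norm_nonneg _)]
    rfl
  · simp only [hfc]
    have h1 : Tendsto (fun n : ℕ => (1 + 1 / ((n : ℝ) + 1) * ksq L k)⁻¹) atTop (𝓝 1) := by
      have := ((tendsto_one_div_add_atTop_nhds_zero_nat (𝕜 := ℝ)).mul_const (ksq L k)).const_add 1
      simpa using this.inv₀ (by simp)
    have h2 := ((h1.sub_const 1).pow 2).mul_const (‖fc k (z : L2 d L)‖ ^ 2)
    simpa using h2
  · rw [hfc, Real.norm_of_nonneg (by positivity)]
    exact mul_le_of_le_one_left (by positivity) (hle n k)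

theorem IsAdmissible.resolv_mem {K : Set (H d L)} (hK : IsAdmissible K) {l : ℝ} (hl : 0 < l)
    {z : H d L} (hz : z ∈ K) : resolv l z ∈ K :=
  hK.resolvent_mem l hl _ (resolv_spec hl z).1 (by rwa [(resolv_spec hl z).2.1])

theorem IsAdmissible.nonempty {K : Set (H d L)} (hK : IsAdmissible K) : K.Nonempty :=
  ⟨0, hK.zero_mem⟩

theorem isAdmissible_univ : IsAdmissible (Set.univ : Set (H d L)) :=
  ⟨isClosed_univ, convex_univ, trivial, fun _ _ _ _ _ => trivial⟩

/-- The Yosida approximation of `∂I_K` is compatible with the Stokes operator. -/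
theorem IsAdmissible.inner_sub_metricProj_stokes_nonneg {K : Set (H d L)} (hK : IsAdmissible K)
    {u : H d L} (hu : u ∈ DA d L) : 0 ≤ inner ℝ (u - metricProj K u) (stokes u) := by
  have hne := hK.nonempty
  have hn : ∀ n : ℕ, (0 : ℝ) < 1 / (n + 1) := fun n => by positivity
  have hstep : ∀ n : ℕ, 0 ≤ inner ℝ (u - metricProj K u) (resolv (1 / (n + 1)) (stokes u)) := by
    intro n
    set l : ℝ := 1 / ((n : ℝ) + 1) with hl
    have hl0 : 0 < l := hn n
    -- The resolvent is a contraction mapping P_K u back into K, so it does not increase the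
    -- distance to K; the gradient inequality then gives (u - P_K u, (I + lA)⁻¹u - u) ≤ 0.
    have h1 := inner_sub_metricProj_le_half hK.isClosed hK.convex hne u (resolv l u)
    have h2 : ‖resolv l u - metricProj K (resolv l u)‖ ≤ ‖u - metricProj K u‖ :=
      (norm_sub_metricProj_le hK.isClosed hK.convex _ (hK.resolv_mem hl0
        (metricProj_mem hK.isClosed hK.convex hne u))).trans (norm_resolv_sub_le hl0 _ _)
    have h3 : inner ℝ (u - metricProj K u) (resolv l u - u) ≤ 0 := by
      have : ‖resolv l u - metricProj K (resolv l u)‖ ^ 2 ≤ ‖u - metricProj K u‖ ^ 2 := by gcongr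
      linarith
    -- Dividing by -l leaves the pairing with (I + lA)⁻¹Au, which tends to Au as l → 0.
    have e : resolv l u - u = -(l • resolv l (stokes u)) := by
      refine ext_fcH fun k => ?_
      have h0 := ksq_nonneg (L := L) k
      rw [Submodule.coe_sub, Submodule.coe_neg, Submodule.coe_smul, map_sub, map_neg, map_smul,
        (resolv_spec hl0 _).2.2, (resolv_spec hl0 _).2.2, fc_stokes hu, Complex.coe_smul, smul_smul,
        smul_smul]
      nth_rewrite 2 [← one_smul ℝ (fc k (u : L2 d L))]
      rw [← sub_smul, ← neg_smul]
      congr 1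
      field_simp
      ring
    rw [e, inner_neg_right, inner_smul_rightH] at h3
    by_contra! hneg
    nlinarith
  exact ge_of_tendsto' (tendsto_const_nhds.inner (tendsto_resolv (stokes u))) hstep

/-! ### Bounds in the maximum norm -/

/-- For d ≤ 3, (1 + |κ|²)⁻² is at most the product over the coordinates of (1 + κᵢ²)^(-2/3), and
each one-dimensional sum converges like that of |m|^(-4/3). -/
theorem summable_inv_ksq (hd : d ≤ 3) :
    Summable fun k : Fin d → ℤ => ((1 + ksq L k) ^ 2)⁻¹ := by
  have hL : 0 < L := Fact.out
  set c : ℝ := (2 * Real.pi / L) ^ 2 with hc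
  have hcpos : 0 < c := by have := Real.pi_pos; positivity
  set f : ℤ → ℝ := fun m => (1 + c * (m : ℝ) ^ 2) ^ (-(2 / 3) : ℝ) with hf
  have hf0 : ∀ m, 0 ≤ f m := fun m => by positivity
  have hfs : Summable f := by
    have h1 := (Real.summable_abs_int_rpow (b := 4 / 3) (by norm_num)).mul_left (c ^ (-(2 / 3) : ℝ))
    refine h1.of_norm_bounded_eventually ?_
    have : ∀ᶠ m : ℤ in cofinite, m ≠ 0 := (Set.finite_singleton 0).compl_mem_cofinite
    filter_upwards [this] with m hm
    have hm' : 0 < |(m : ℝ)| := abs_pos.2 (Int.cast_ne_zero.2 hm)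
    rw [Real.norm_of_nonneg (hf0 m), hf]
    have e : |(m : ℝ)| ^ (-(4 / 3) : ℝ) = ((m : ℝ) ^ 2) ^ (-(2 / 3) : ℝ) := by
      rw [← sq_abs (m : ℝ), ← Real.rpow_natCast_mul hm'.le]; norm_num
    rw [e, ← Real.mul_rpow hcpos.le (by positivity)]
    have hm2 : 0 < (m : ℝ) ^ 2 := by rw [← sq_abs]; positivity
    exact Real.rpow_le_rpow_of_nonpos (by positivity) (by linarith) (by norm_num)
  refine Summable.of_nonneg_of_le (fun k => by positivity) (f := fun k : Fin d → ℤ => ∏ i, f (k i))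
    (fun k => ?_) ?_
  · have hX : 0 < 1 + ksq L k := by have := ksq_nonneg (L := L) k; positivity
    have h1 : ∀ i, (1 + ksq L k) ^ (-(2 / 3) : ℝ) ≤ f (k i) := fun i => by
      refine Real.rpow_le_rpow_of_nonpos (by positivity) ?_ (by norm_num)
      have := kap_sq_le (L := L) k i
      have e : kap L k i ^ 2 = c * (k i : ℝ) ^ 2 := by rw [kap, hc]; ring
      linarith
    have h2 : ((1 + ksq L k) ^ (-(2 / 3) : ℝ)) ^ d ≤ ∏ i, f (k i) := by
      calc ((1 + ksq L k) ^ (-(2 / 3) : ℝ)) ^ d = ∏ i : Fin d, (1 + ksq L k) ^ (-(2 / 3) : ℝ) := by simp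
        _ ≤ _ := Finset.prod_le_prod (fun i _ => by positivity) fun i _ => h1 i
    refine le_trans ?_ h2
    rw [← Real.rpow_mul_natCast hX.le, ← Real.rpow_natCast, ← Real.rpow_neg hX.le]
    refine Real.rpow_le_rpow_of_exponent_le (by linarith [ksq_nonneg (L := L) k]) ?_
    have : (d : ℝ) ≤ 3 := by exact_mod_cast hd
    push_cast
    linarith
  · refine summable_of_sum_le (c := (∑' m, f m) ^ d) (fun k => Finset.prod_nonneg fun i _ => hf0 _)
      fun S => ?_
    obtain ⟨n, hn⟩ := (tendsto_box (d := d)).eventually (eventually_ge_atTop S) |>.exists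
    calc ∑ k ∈ S, ∏ i, f (k i) ≤ ∑ k ∈ box d n, ∏ i, f (k i) :=
          Finset.sum_le_sum_of_subset_of_nonneg hn fun k _ _ => Finset.prod_nonneg fun i _ => hf0 _
      _ = ∏ _i : Fin d, ∑ m ∈ Finset.Icc (-(n : ℤ)) n, f m := by
          rw [box, Finset.prod_univ_sum]
      _ = (∑ m ∈ Finset.Icc (-(n : ℤ)) n, f m) ^ d := by simp
      _ ≤ _ := pow_le_pow_left₀ (Finset.sum_nonneg fun _ _ => hf0 _)
          (hfs.sum_le_tsum _ fun _ _ => hf0 _) d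

/-- Writing X = 1 + |κ|² and a = |û(k)|, a = X⁻¹ · Xa ≤ X⁻² + (Xa)², and both terms are summable. So
elements of D(A) have absolutely convergent Fourier series. -/
theorem summable_norm_fc (hd : d ≤ 3) {u : H d L} (hu : u ∈ DA d L) :
    Summable (fun k => ‖fc k (u : L2 d L)‖) ∧
      ∑' k, ‖fc k (u : L2 d L)‖ ≤ ∑' k : Fin d → ℤ, ((1 + ksq L k) ^ 2)⁻¹ +
        ‖u + stokes u‖ ^ 2 := by
  have hs := summable_inv_ksq (L := L) hd
  have hn := hasSum_norm_fc ((u + stokes u : H d L) : L2 d L)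
  have hle : ∀ k, ‖fc k (u : L2 d L)‖ ≤
      ((1 + ksq L k) ^ 2)⁻¹ + ‖fc k ((u + stokes u : H d L) : L2 d L)‖ ^ 2 := by
    intro k
    have hX : 0 < 1 + ksq L k := by have := ksq_nonneg (L := L) k; positivity
    have e : ‖fc k ((u + stokes u : H d L) : L2 d L)‖ = (1 + ksq L k) * ‖fc k (u : L2 d L)‖ := by
      rw [Submodule.coe_add, map_add, fc_stokes hu]
      nth_rewrite 1 [← one_smul ℂ (fc k (u : L2 d L))]
      rw [← add_smul, norm_smul]
      congr 1
      rw [← Complex.ofReal_one, ← Complex.ofReal_add, Complex.norm_real, Real.norm_of_nonneg hX.le]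
    rw [e]
    set a := ‖fc k (u : L2 d L)‖
    set X := 1 + ksq L k
    have h1 : a = X⁻¹ * (X * a) := by field_simp
    have h2 : (X ^ 2)⁻¹ = (X⁻¹) ^ 2 := by rw [inv_pow]
    rw [h2]
    nlinarith [sq_nonneg (X⁻¹ - X * a), sq_nonneg (X⁻¹ + X * a)]
  have hs2 := hs.add hn.summable
  have h1 : Summable fun k => ‖fc k (u : L2 d L)‖ :=
    hs2.of_nonneg_of_le (fun k => norm_nonneg _) hle
  refine ⟨h1, (h1.tsum_le_tsum hle hs2).trans (le_of_eq ?_)⟩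
  rw [hs.tsum_add hn.summable, hn.tsum_eq]
  rfl

/-- The embedding of D(A) in L^∞. One radius serves a whole bounded set of D(A), which is what the
passage to the limit needs. -/
theorem exists_sup_bound (hd : d ≤ 3) (M : ℝ) : ∃ R : ℝ, 0 < R ∧ ∀ u ∈ DA d L, ‖u‖ ≤ M →
    ‖stokes u‖ ≤ M → (∀ᵐ t, ‖(u : L2 d L) t‖ ≤ R) ∧
      ∀ n t, ‖(trunc n (u : L2 d L)).1 t‖ ≤ R := by
  have hpos : 0 ≤ ∑' k : Fin d → ℤ, ((1 + ksq L k) ^ 2)⁻¹ := tsum_nonneg fun k => by positivity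
  have hn := nrm_pos (d := d) (L := L)
  refine ⟨nrm d L * (∑' k : Fin d → ℤ, ((1 + ksq L k) ^ 2)⁻¹ + (M + M) ^ 2) + 1, by positivity,
    fun u hu h1 h2 => ?_⟩
  obtain ⟨hs, hle⟩ := summable_norm_fc hd hu
  have h3 : ‖u + stokes u‖ ^ 2 ≤ (M + M) ^ 2 := by
    have := norm_add_le u (stokes u)
    gcongr
    linarith
  have h4 : nrm d L * ∑' k, ‖fc k (u : L2 d L)‖ ≤
      nrm d L * (∑' k : Fin d → ℤ, ((1 + ksq L k) ^ 2)⁻¹ + (M + M) ^ 2) + 1 := by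
    have : nrm d L * ∑' k, ‖fc k (u : L2 d L)‖ ≤
      nrm d L * (∑' k : Fin d → ℤ, ((1 + ksq L k) ^ 2)⁻¹ + (M + M) ^ 2) := by
      gcongr
      linarith
    linarith
  exact ⟨(ae_norm_le hs).mono fun t ht => ht.trans h4,
    fun n t => (norm_trunc_apply_le hs n t).trans h4⟩

theorem exists_ae_bound (hd : d ≤ 3) {u : H d L} (hu : u ∈ DA d L) :
    ∃ R : ℝ, 0 < R ∧ ∀ᵐ t, ‖(u : L2 d L) t‖ ≤ R := by
  obtain ⟨R, hR, h⟩ := exists_sup_bound (L := L) hd (‖u‖ + ‖stokes u‖)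
  exact ⟨R, hR, (h u hu (by linarith [norm_nonneg (stokes u)]) (by linarith [norm_nonneg u])).1⟩

/-- The truncations are solenoidal and converge uniformly, hence in every L^p of the torus. -/
theorem memLtilde_of_mem_DA (hd : d ≤ 3) {u : H d L} (hu : u ∈ DA d L) (p : ℝ) :
    MemLtilde p u := by
  intro ε hε
  obtain ⟨hs, -⟩ := summable_norm_fc hd hu
  set V : ℝ≥0∞ := (volume (Set.univ : Set (Torus d L))) ^ (ENNReal.ofReal p).toReal⁻¹ with hV
  have hVfin : V ≠ ⊤ := by
    rw [hV]
    exact ENNReal.rpow_ne_top_of_nonneg (by positivity) (measure_ne_top _ _)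
  have hT : Tendsto (fun n => V * ENNReal.ofReal (nrm d L * tail (fun k => ‖fc k (u : L2 d L)‖) n))
      atTop (𝓝 0) := by
    have h1 := (tendsto_tail hs).const_mul (nrm d L)
    rw [mul_zero] at h1
    have h2 := ENNReal.tendsto_ofReal h1
    rw [ENNReal.ofReal_zero] at h2
    have h3 := ENNReal.Tendsto.const_mul h2 (Or.inr hVfin)
    rwa [mul_zero] at h3
  obtain ⟨n, hn⟩ := (hT.eventually (gt_mem_nhds hε)).exists
  exact ⟨trunc n (u : L2 d L), trunc_mem_solenoidal (divc_fc u) n,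
    (eLpNorm_le_of_ae_bound (ae_norm_sub_trunc_le hs n)).trans_lt hn⟩

theorem mem_VL_of_mem_DA (hd : d ≤ 3) {u : H d L} (hu : u ∈ DA d L) (p : ℝ) : u ∈ VL d L p :=
  ⟨hu.1, memLtilde_of_mem_DA hd hu p⟩

theorem exists_trunc_apply_bound (n : ℕ) : ∃ C : ℝ, 0 < C ∧ ∀ (u : L2 d L) (t : Torus d L),
    ‖(trunc n u).1 t‖ ≤ C * ‖u‖ ∧ ∀ i, ‖(pderiv i (trunc n u)).1 t‖ ≤ C * ‖u‖ := by
  have hn := nrm_pos (d := d) (L := L)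
  refine ⟨∑ k ∈ box d n, nrm d L * (1 + ∑ i, |kap L k i|) + 1, by positivity, fun u t => ⟨?_, ?_⟩⟩
  · have e : (trunc n u).1 t = ∑ k ∈ box d n, (mode k (fc k u)).1 t := by simp [trunc]
    rw [e]
    refine (norm_sum_le_of_le _ fun k _ => (norm_mode_le _ _ _).trans
      (mul_le_mul_of_nonneg_left (norm_fc_le k u) hn.le)).trans ?_
    rw [add_mul, Finset.sum_mul]
    have : ∑ k ∈ box d n, nrm d L * ‖u‖ ≤ ∑ k ∈ box d n, nrm d L * (1 + ∑ i, |kap L k i|) * ‖u‖ := by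
      gcongr with k
      have : 0 ≤ ∑ i, |kap L k i| := by positivity
      nlinarith
    linarith [norm_nonneg u]
  · intro i
    have e : (pderiv i (trunc n u)).1 t =
        ∑ k ∈ box d n, (mode k (((kap L k i : ℂ) * Complex.I) • fc k u)).1 t := by
      simp [trunc, pderiv_mode]
    rw [e]
    refine (norm_sum_le_of_le (n := fun k => nrm d L * (1 + ∑ i, |kap L k i|) * ‖u‖) _ fun k _ => (norm_mode_le _ _ _).trans ?_).trans ?_
    · rw [norm_smul, norm_mul, Complex.norm_I, mul_one, Complex.norm_real, Real.norm_eq_abs, mul_assoc]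
      have h1 : |kap L k i| ≤ 1 + ∑ i, |kap L k i| := by
        have := Finset.single_le_sum (f := fun i => |kap L k i|) (fun _ _ => abs_nonneg _)
          (Finset.mem_univ i)
        linarith
      have h2 := norm_fc_le k u
      gcongr
    · rw [add_mul, Finset.sum_mul]
      linarith [norm_nonneg u]

/-! ### Compactness -/

/-- Rellich's theorem: the part of y outside a large box is uniformly small by `norm_sub_PH_le`, and
the part inside ranges over a compact finite-dimensional set. -/
theorem totallyBounded_of_stokes_le (M : ℝ) :
    TotallyBounded {u : L2 d L | ∃ y ∈ DA d L, ‖y‖ ≤ M ∧ ‖stokes y‖ ≤ M ∧ (y : L2 d L) = u} := by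
  have hL : 0 < L := Fact.out
  rw [Metric.totallyBounded_iff]
  intro ε hε
  set c : ℝ := (2 * Real.pi / L) ^ 2 with hc
  have hcpos : 0 < c := by have := Real.pi_pos; positivity
  obtain ⟨n, hn⟩ := exists_nat_gt (M / (c * (ε / 2)))
  let F : (box d n → EC d) → L2 d L := fun a => ∑ k, toL2 (mode k.1 (a k))
  have hF : Continuous F := by
    refine continuous_finsetSum _ fun k _ => ?_
    have h1 : Continuous (toL2 ∘ₗ mode k.1 : EC d →ₗ[ℝ] L2 d L) :=
      LinearMap.continuous_of_finiteDimensional _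
    exact h1.comp (continuous_apply k)
  have hcomp : IsCompact (F '' Set.univ.pi fun _ => Metric.closedBall (0 : EC d) M) := by
    have : ProperSpace (EC d) := FiniteDimensional.proper ℂ (EC d)
    exact (isCompact_univ_pi fun _ => isCompact_closedBall _ _).image hF
  obtain ⟨T, hT, hsub⟩ := Metric.totallyBounded_iff.1 hcomp.totallyBounded (ε / 2) (by positivity)
  refine ⟨T, hT, ?_⟩
  rintro _ ⟨y, hy, h1, h2, rfl⟩
  have hmem : (PH n y : L2 d L) ∈ F '' Set.univ.pi fun _ => Metric.closedBall (0 : EC d) M := by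
    refine ⟨fun k => fc k.1 (y : L2 d L), fun k _ => ?_, ?_⟩
    · simpa using (norm_fc_le k.1 (y : L2 d L)).trans h1
    · simp only [F, coe_PH, trunc, LinearMap.sum_apply, LinearMap.comp_apply, map_sum]
      exact Finset.sum_coe_sort (box d n) fun k => toL2 (mode k (fc k (y : L2 d L)))
  obtain ⟨x, hx, hdist⟩ := Set.mem_iUnion₂.1 (hsub hmem)
  refine Set.mem_iUnion₂.2 ⟨x, hx, ?_⟩
  have h3 := norm_sub_PH_le hy n
  have h4 : ‖y - PH n y‖ < ε / 2 := by
    by_contra! hcon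
    rw [div_lt_iff₀ (by positivity)] at hn
    have h5 : c * (n + 1) ^ 2 * (ε / 2) ≤ c * (n + 1) ^ 2 * ‖y - PH n y‖ := by gcongr
    have h6 : (n : ℝ) * (c * (ε / 2)) ≤ c * (n + 1) ^ 2 * (ε / 2) := by
      have : (n : ℝ) ≤ (n + 1) ^ 2 := by nlinarith
      have : 0 < c * (ε / 2) := by positivity
      nlinarith
    linarith
  have h5 : dist (y : L2 d L) (PH n y : L2 d L) < ε / 2 := by
    rw [dist_eq_norm]; exact h4
  rw [Metric.mem_ball] at hdist ⊢
  linarith [dist_triangle (y : L2 d L) (PH n y : L2 d L) x]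

theorem exists_subseq_of_stokes_le {M : ℝ} {y : ℕ → H d L} (hy : ∀ n, y n ∈ DA d L)
    (h1 : ∀ n, ‖y n‖ ≤ M) (h2 : ∀ n, ‖stokes (y n)‖ ≤ M) :
    ∃ z ∈ DA d L, ∃ φ : ℕ → ℕ, StrictMono φ ∧ Tendsto (y ∘ φ) atTop (𝓝 z) := by
  have hcomp := isCompact_iff_totallyBounded_isComplete.2
    ⟨TotallyBounded.closure (totallyBounded_of_stokes_le (d := d) (L := L) M),
      isClosed_closure.isComplete⟩
  obtain ⟨z, -, φ, hφ, hlim⟩ := hcomp.tendsto_subseq (x := fun n => (y n : L2 d L))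
    fun n => subset_closure ⟨y n, hy n, h1 n, h2 n, rfl⟩
  have hz : z ∈ H d L := (Submodule.isClosed_topologicalClosure _).mem_of_tendsto hlim
    (Eventually.of_forall fun n => (y (φ n)).2)
  -- The bound on Ay survives in the limit, as in Fatou's lemma: finite partial sums converge and
  -- stay below M². Hence the limit is in D(A).
  have hsum : Summable fun k => ‖(ksq L k : ℂ) • fc k z‖ ^ 2 := by
    refine summable_of_sum_le (c := M ^ 2) (fun k => by positivity) fun S => ?_
    have h3 : Tendsto (fun n => ∑ k ∈ S, ‖(ksq L k : ℂ) • fc k (y (φ n) : L2 d L)‖ ^ 2) atTop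
        (𝓝 (∑ k ∈ S, ‖(ksq L k : ℂ) • fc k z‖ ^ 2)) :=
      tendsto_finsetSum _ fun k _ =>
        ((((continuous_fc k).tendsto z).comp hlim).const_smul _).norm.pow 2
    refine le_of_tendsto' h3 fun n => ?_
    have h4 := (hasSum_norm_fc (stokes (y (φ n)) : L2 d L)).summable.sum_le_tsum S
      fun k _ => by positivity
    rw [(hasSum_norm_fc _).tsum_eq] at h4
    simp only [fc_stokes (hy _)] at h4
    refine h4.trans ?_
    have := h2 (φ n)
    gcongr
    exact this
  obtain ⟨w, hw⟩ := exists_fc_eq (L := L) (a := fun k => (ksq L k : ℂ) • fc k z)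
    (fun k => by rw [bar_smul, fc_neg, ksq_neg]; simp) hsum
  have hwH : w ∈ H d L := mem_H_iff.2 fun k => by
    rw [hw, divc_smul, mem_H_iff.1 hz, mul_zero]
  exact ⟨⟨z, hz⟩, mem_DA_iff.2 ⟨⟨w, hwH⟩, hw⟩, φ, hφ, tendsto_subtype_rng.2 hlim⟩

end Stokes

/-! ### The trilinear form: integrability, bounds and antisymmetry. -/

section Forms

open Filter

variable {d : ℕ} {L : ℝ} [Fact (0 < L)]

/-- The convective term `(u · ∇) z`, where `g = ∇z`. -/
def conv (u : L2 d L) (g : Fin d → L2 d L) (t : Torus d L) : E d := ∑ i, u t i • g i t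

/-- The pointwise norm of a gradient. -/
def gnorm (g : Fin d → L2 d L) (t : Torus d L) : ℝ := √(∑ i, ‖g i t‖ ^ 2)

theorem gnorm_nonneg (g : Fin d → L2 d L) (t : Torus d L) : 0 ≤ gnorm g t := Real.sqrt_nonneg _

theorem gnorm_sq (g : Fin d → L2 d L) (t : Torus d L) : gnorm g t ^ 2 = ∑ i, ‖g i t‖ ^ 2 :=
  Real.sq_sqrt (Finset.sum_nonneg fun _ _ => by positivity)

theorem norm_sum_smul_le (x : E d) (v : Fin d → E d) :
    ‖∑ i, x i • v i‖ ≤ ‖x‖ * √(∑ i, ‖v i‖ ^ 2) := by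
  calc ‖∑ i, x i • v i‖ ≤ ∑ i, |x i| * ‖v i‖ :=
        norm_sum_le_of_le _ fun i _ => by rw [norm_smul, Real.norm_eq_abs]
    _ ≤ √(∑ i, |x i| ^ 2) * √(∑ i, ‖v i‖ ^ 2) := Real.sum_mul_le_sqrt_mul_sqrt _ _ _
    _ = _ := by rw [EuclideanSpace.norm_eq]; simp

theorem norm_conv_le (u : L2 d L) (g : Fin d → L2 d L) (t : Torus d L) :
    ‖conv u g t‖ ≤ ‖u t‖ * gnorm g t := norm_sum_smul_le _ _

theorem aestronglyMeasurable_coord (u : L2 d L) (i : Fin d) :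
    AEStronglyMeasurable (fun t => u t i) volume := (memLp_coord i u).aestronglyMeasurable

theorem aestronglyMeasurable_conv (u : L2 d L) (g : Fin d → L2 d L) :
    AEStronglyMeasurable (conv u g) volume := by
  unfold conv
  exact Finset.aestronglyMeasurable_fun_sum _ fun i _ =>
    (aestronglyMeasurable_coord u i).smul (Lp.aestronglyMeasurable (g i))

theorem integrable_norm_sq (u : L2 d L) : Integrable fun t => ‖u t‖ ^ 2 :=
  (Lp.memLp u).integrable_norm_pow (by norm_num)

theorem integral_norm_sq (u : L2 d L) : ∫ t, ‖u t‖ ^ 2 = ‖u‖ ^ 2 := by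
  rw [← real_inner_self_eq_norm_sq, L2.inner_def]
  exact integral_congr_ae (Eventually.of_forall fun t => by simp)

theorem integrable_gnorm_sq (g : Fin d → L2 d L) : Integrable fun t => gnorm g t ^ 2 := by
  simp only [gnorm_sq]
  exact integrable_finsetSum _ fun i _ => integrable_norm_sq (g i)

theorem integral_gnorm_sq (g : Fin d → L2 d L) : ∫ t, gnorm g t ^ 2 = ∑ i, ‖g i‖ ^ 2 := by
  simp only [gnorm_sq]
  rw [integral_finsetSum _ fun i _ => integrable_norm_sq (g i)]
  simp only [integral_norm_sq]

theorem aestronglyMeasurable_gnorm (g : Fin d → L2 d L) :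
    AEStronglyMeasurable (gnorm g) volume :=
  Real.continuous_sqrt.comp_aestronglyMeasurable (Finset.aestronglyMeasurable_fun_sum _ fun i _ =>
    (Lp.aestronglyMeasurable (g i)).norm.pow 2)

theorem memLp_gnorm (g : Fin d → L2 d L) : MemLp (gnorm g) 2 volume :=
  (memLp_two_iff_integrable_sq (aestronglyMeasurable_gnorm g)).2 (integrable_gnorm_sq g)

/-- The product `|u| |w|` is square integrable. -/
def L2Pair (u w : L2 d L) : Prop := MemLp (fun t => ‖u t‖ * ‖w t‖) 2 volume

theorem aestronglyMeasurable_mul_norm (u w : L2 d L) :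
    AEStronglyMeasurable (fun t => ‖u t‖ * ‖w t‖) volume :=
  (Lp.aestronglyMeasurable u).norm.mul (Lp.aestronglyMeasurable w).norm

theorem L2Pair.symm {u w : L2 d L} (h : L2Pair u w) : L2Pair w u := by
  unfold L2Pair at *; simpa only [mul_comm] using h

theorem L2Pair.add {u u' w : L2 d L} (h : L2Pair u w) (h' : L2Pair u' w) : L2Pair (u + u') w := by
  refine (MemLp.add h h').mono (aestronglyMeasurable_mul_norm _ _) ?_
  filter_upwards [Lp.coeFn_add u u'] with t ht
  rw [ht, Real.norm_of_nonneg (by positivity), Pi.add_apply, Pi.add_apply,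
    Real.norm_of_nonneg (by positivity), ← add_mul]
  gcongr
  exact norm_add_le _ _

theorem L2Pair.neg {u w : L2 d L} (h : L2Pair u w) : L2Pair (-u) w := by
  refine MemLp.ae_eq ?_ h
  filter_upwards [Lp.coeFn_neg u] with t ht
  rw [ht, Pi.neg_apply, norm_neg]

theorem L2Pair.sub {u u' w : L2 d L} (h : L2Pair u w) (h' : L2Pair u' w) : L2Pair (u - u') w := by
  rw [sub_eq_add_neg]; exact h.add h'.neg

theorem l2Pair_of_bound {u : L2 d L} {R : ℝ} (hu : ∀ᵐ t, ‖u t‖ ≤ R) (w : L2 d L) : L2Pair u w := by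
  refine ((Lp.memLp w).norm.const_mul R).mono (aestronglyMeasurable_mul_norm _ _) ?_
  filter_upwards [hu] with t ht
  rw [Real.norm_of_nonneg (by positivity)]
  refine le_trans ?_ (le_abs_self _)
  gcongr

theorem integrable_conv {u w : L2 d L} (h : L2Pair u w) (g : Fin d → L2 d L) :
    Integrable fun t => inner ℝ (conv u g t) (w t) := by
  refine (h.integrable_mul (memLp_gnorm g)).mono
    ((aestronglyMeasurable_conv u g).inner (Lp.aestronglyMeasurable w)) ?_
  refine Eventually.of_forall fun t => ?_
  rw [Pi.mul_apply, Real.norm_of_nonneg (mul_nonneg (by positivity) (gnorm_nonneg g t))]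
  refine (norm_inner_le_norm _ _).trans ?_
  have := mul_le_mul_of_nonneg_right (norm_conv_le u g t) (norm_nonneg (w t))
  linarith

/-- The trilinear form with the gradient as an independent argument. -/
def tri (u : L2 d L) (g : Fin d → L2 d L) (w : L2 d L) : ℝ := ∫ t, inner ℝ (conv u g t) (w t)

/-- The componentwise integrals merge into one because each product is integrable: |y||w| and ∇z are
both in L². -/
theorem trilinear_eq_tri {y w : H d L} (h : L2Pair (y : L2 d L) (w : L2 d L)) (z : H d L) :
    trilinear y z w = tri (y : L2 d L) (grad (z : L2 d L)) (w : L2 d L) := by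
  have hint : ∀ i j, Integrable fun t => (y : L2 d L) t i * (grad (z : L2 d L) i) t j *
      (w : L2 d L) t j := by
    intro i j
    refine (h.integrable_mul (Lp.memLp (grad (z : L2 d L) i)).norm).mono
      (((aestronglyMeasurable_coord _ i).mul (aestronglyMeasurable_coord _ j)).mul
        (aestronglyMeasurable_coord _ j)) (Eventually.of_forall fun t => ?_)
    have h1 := PiLp.norm_apply_le ((y : L2 d L) t) i
    have h2 := PiLp.norm_apply_le (grad (z : L2 d L) i t) j
    have h3 := PiLp.norm_apply_le ((w : L2 d L) t) j
    rw [norm_mul, norm_mul, Pi.mul_apply, norm_mul, norm_mul, norm_norm, norm_norm, norm_norm]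
    calc _ ≤ ‖(y : L2 d L) t‖ * ‖grad (z : L2 d L) i t‖ * ‖(w : L2 d L) t‖ :=
          mul_le_mul (mul_le_mul h1 h2 (norm_nonneg _) (norm_nonneg _)) h3 (norm_nonneg _)
            (by positivity)
      _ = _ := by ring
  rw [trilinear, tri]
  rw [← Finset.sum_congr rfl fun i _ => integral_finsetSum _ fun j _ => hint i j,
    ← integral_finsetSum _ fun i _ => integrable_finsetSum _ fun j _ => hint i j]
  refine integral_congr_ae (Eventually.of_forall fun t => ?_)
  simp only [conv, sum_inner, PiLp.inner_apply, RCLike.inner_apply,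
    conj_trivial, PiLp.smul_apply, smul_eq_mul]
  exact Finset.sum_congr rfl fun i _ => Finset.sum_congr rfl fun j _ => by ring

theorem tri_add_left {u u' w : L2 d L} (h : L2Pair u w) (h' : L2Pair u' w) (g : Fin d → L2 d L) :
    tri (u + u') g w = tri u g w + tri u' g w := by
  rw [tri, tri, tri, ← integral_add (integrable_conv h g) (integrable_conv h' g)]
  refine integral_congr_ae ?_
  filter_upwards [Lp.coeFn_add u u'] with t ht
  simp only [conv, ht, Pi.add_apply, PiLp.add_apply, add_smul, Finset.sum_add_distrib, inner_add_left]

theorem tri_neg_left (u w : L2 d L) (g : Fin d → L2 d L) : tri (-u) g w = -tri u g w := by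
  rw [tri, tri, ← integral_neg]
  refine integral_congr_ae ?_
  filter_upwards [Lp.coeFn_neg u] with t ht
  simp only [conv, ht, Pi.neg_apply, PiLp.neg_apply, neg_smul, Finset.sum_neg_distrib, inner_neg_left]

theorem tri_sub_left {u u' w : L2 d L} (h : L2Pair u w) (h' : L2Pair u' w) (g : Fin d → L2 d L) :
    tri (u - u') g w = tri u g w - tri u' g w := by
  rw [sub_eq_add_neg, tri_add_left h h'.neg, tri_neg_left, sub_eq_add_neg]

theorem tri_sub_mid {u w : L2 d L} (h : L2Pair u w) (g g' : Fin d → L2 d L) :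
    tri u (g - g') w = tri u g w - tri u g' w := by
  rw [tri, tri, tri, ← integral_sub (integrable_conv h g) (integrable_conv h g')]
  refine integral_congr_ae ?_
  have : ∀ᵐ t, ∀ i, (g i - g' i : L2 d L) t = g i t - g' i t :=
    ae_all_iff.2 fun i => Lp.coeFn_sub _ _
  filter_upwards [this] with t ht
  simp only [conv, Pi.sub_apply, ht, smul_sub, Finset.sum_sub_distrib, inner_sub_left]

theorem tri_sub_right {u w w' : L2 d L} (h : L2Pair u w) (h' : L2Pair u w') (g : Fin d → L2 d L) :
    tri u g (w - w') = tri u g w - tri u g w' := by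
  rw [tri, tri, tri, ← integral_sub (integrable_conv h g) (integrable_conv h' g)]
  refine integral_congr_ae ?_
  filter_upwards [Lp.coeFn_sub w w'] with t ht
  simp only [ht, Pi.sub_apply, inner_sub_right]

theorem abs_tri_le {u w : L2 d L} {F : Torus d L → ℝ} (hF : MemLp F 2 volume)
    (h : ∀ᵐ t, ‖u t‖ * ‖w t‖ ≤ F t) (g : Fin d → L2 d L) :
    |tri u g w| ≤ √(∫ t, F t ^ 2) * √(∑ i, ‖g i‖ ^ 2) := by
  have h1 : |tri u g w| ≤ ∫ t, ‖F t‖ * ‖gnorm g t‖ := by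
    rw [tri, ← Real.norm_eq_abs]
    refine norm_integral_le_of_norm_le (hF.norm.integrable_mul (memLp_gnorm g).norm) ?_
    filter_upwards [h] with t ht
    refine (norm_inner_le_norm _ _).trans ?_
    have h2 := mul_le_mul_of_nonneg_right (norm_conv_le u g t) (norm_nonneg (w t))
    have h3 := gnorm_nonneg g t
    rw [Real.norm_of_nonneg h3]
    have h4 : ‖u t‖ * ‖w t‖ ≤ ‖F t‖ := ht.trans (le_abs_self _)
    nlinarith
  have hp : ENNReal.ofReal 2 = 2 := by norm_num
  have h5 := integral_mul_norm_le_Lp_mul_Lq (μ := (volume : Measure (Torus d L)))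
    Real.HolderConjugate.two_two (f := F) (g := gnorm g) (by rwa [hp])
    (by rw [hp]; exact memLp_gnorm g)
  simp only [Real.norm_eq_abs, Real.rpow_two, sq_abs, ← Real.sqrt_eq_rpow, integral_gnorm_sq] at h5
  exact h1.trans h5

theorem abs_tri_le_of_bound_left {u : L2 d L} {R : ℝ} (hR : 0 ≤ R) (hu : ∀ᵐ t, ‖u t‖ ≤ R)
    (g : Fin d → L2 d L) (w : L2 d L) : |tri u g w| ≤ R * ‖w‖ * √(∑ i, ‖g i‖ ^ 2) := by
  have h := abs_tri_le (u := u) (w := w) ((Lp.memLp w).norm.const_mul R)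
    (hu.mono fun t ht => mul_le_mul_of_nonneg_right ht (norm_nonneg _)) g
  simp only [mul_pow] at h
  rwa [integral_const_mul, integral_norm_sq, ← mul_pow, Real.sqrt_sq (by positivity)] at h

theorem abs_tri_le_of_bound_right {w : L2 d L} {R : ℝ} (hR : 0 ≤ R) (hw : ∀ᵐ t, ‖w t‖ ≤ R)
    (g : Fin d → L2 d L) (u : L2 d L) : |tri u g w| ≤ R * ‖u‖ * √(∑ i, ‖g i‖ ^ 2) := by
  have h := abs_tri_le (u := u) (w := w) ((Lp.memLp u).norm.const_mul R)
    (hw.mono fun t ht => by rw [mul_comm]; exact mul_le_mul_of_nonneg_right ht (norm_nonneg _)) g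
  simp only [mul_pow] at h
  rwa [integral_const_mul, integral_norm_sq, ← mul_pow, Real.sqrt_sq (by positivity)] at h

theorem ae_bound_toL2 (f : smoothFields d L) : ∃ R : ℝ, 0 ≤ R ∧ ∀ᵐ t, ‖(toL2 f : L2 d L) t‖ ≤ R := by
  refine ⟨‖f.1‖, norm_nonneg _, (toL2_ae f).mono fun t ht => ?_⟩
  rw [ht]; exact f.1.norm_coe_le_norm t

/-! ### Antisymmetry of the trilinear form -/

/-- The integral of ∂ᵢ(fᵢ v·w) vanishes; after summation over i the term containing div f drops out.
-/
theorem tri_antisymm_smooth {f : smoothFields d L} (hf : f ∈ solenoidal d L)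
    (v w : smoothFields d L) :
    tri (toL2 f) (fun i => toL2 (pderiv i v)) (toL2 w) =
      -tri (toL2 f) (fun i => toL2 (pderiv i w)) (toL2 v) := by
  have hc : ∀ i, Continuous fun t => f.1 t i * inner ℝ ((pderiv i v).1 t) (w.1 t) := fun i =>
    (continuous_coord f i).mul ((continuous_pderiv v i).inner w.1.continuous)
  have hc' : ∀ i, Continuous fun t => f.1 t i * inner ℝ ((pderiv i w).1 t) (v.1 t) := fun i =>
    (continuous_coord f i).mul ((continuous_pderiv w i).inner v.1.continuous)
  have hc'' : ∀ i, Continuous fun t => (pderiv i f).1 t i * inner ℝ (v.1 t) (w.1 t) := fun i =>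
    (continuous_coord _ i).mul (v.1.continuous.inner w.1.continuous)
  have e : ∀ v w : smoothFields d L, tri (toL2 f) (fun i => toL2 (pderiv i v)) (toL2 w) =
      ∫ t, ∑ i, f.1 t i * inner ℝ ((pderiv i v).1 t) (w.1 t) := by
    intro v w
    refine integral_congr_ae ?_
    have : ∀ᵐ t, ∀ i, (toL2 (pderiv i v) : L2 d L) t = (pderiv i v).1 t :=
      ae_all_iff.2 fun i => toL2_ae _
    filter_upwards [toL2_ae f, toL2_ae w, this] with t h1 h2 h3
    simp only [conv, h1, h2, h3, sum_inner, real_inner_smul_left]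
  have hi : ∀ i, ∫ t, (f.1 t i * inner ℝ ((pderiv i v).1 t) (w.1 t) +
      f.1 t i * inner ℝ ((pderiv i w).1 t) (v.1 t) +
      (pderiv i f).1 t i * inner ℝ (v.1 t) (w.1 t)) = 0 := by
    intro i
    refine integral_deriv_eq_zero (i := i) (g := fun t => f.1 t i * inner ℝ (v.1 t) (w.1 t))
      (fun t => ?_) ((continuous_coord f i).mul (v.1.continuous.inner w.1.continuous))
      (((hc i).add (hc' i)).add (hc'' i))
    have h := (hasDerivAt_coord f i i t).mul ((hasDerivAt_field v i t).inner ℝ (hasDerivAt_field w i t))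
    refine h.congr_deriv ?_
    simp only [AddCircle.coe_zero, Pi.single_zero, add_zero]
    rw [real_inner_comm (v.1 t) ((pderiv i w).1 t)]
    ring
  have hsum := Finset.sum_congr rfl fun i (_ : i ∈ Finset.univ) => hi i
  have hint : ∀ i, Integrable fun t => f.1 t i * inner ℝ ((pderiv i v).1 t) (w.1 t) +
      f.1 t i * inner ℝ ((pderiv i w).1 t) (v.1 t) +
      (pderiv i f).1 t i * inner ℝ (v.1 t) (w.1 t) := fun i =>
    integrable_of_continuous (((hc i).add (hc' i)).add (hc'' i))
  rw [← integral_finsetSum _ fun i _ => hint i] at hsum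
  have hpt : ∀ t, ∑ i, (f.1 t i * inner ℝ ((pderiv i v).1 t) (w.1 t) +
      f.1 t i * inner ℝ ((pderiv i w).1 t) (v.1 t) +
      (pderiv i f).1 t i * inner ℝ (v.1 t) (w.1 t)) =
      ∑ i, f.1 t i * inner ℝ ((pderiv i v).1 t) (w.1 t) +
      ∑ i, f.1 t i * inner ℝ ((pderiv i w).1 t) (v.1 t) := by
    intro t
    rw [Finset.sum_add_distrib, Finset.sum_add_distrib, ← Finset.sum_mul, hf t, zero_mul, add_zero]
  simp only [hpt, Finset.sum_const_zero] at hsum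
  rw [integral_add (integrable_of_continuous (continuous_finsetSum _ fun i _ => hc i))
    (integrable_of_continuous (continuous_finsetSum _ fun i _ => hc' i))] at hsum
  rw [e, e]
  linarith

theorem tendsto_tri {u : L2 d L} {R : ℝ} (hR : 0 ≤ R) (hu : ∀ᵐ t, ‖u t‖ ≤ R)
    {g : Fin d → L2 d L} {w : L2 d L} {gn : ℕ → Fin d → L2 d L} {wn : ℕ → L2 d L}
    (hg : Tendsto gn atTop (𝓝 g)) (hw : Tendsto wn atTop (𝓝 w)) :
    Tendsto (fun n => tri u (gn n) (wn n)) atTop (𝓝 (tri u g w)) := by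
  have hp : ∀ w, L2Pair u w := fun w => l2Pair_of_bound hu w
  rw [tendsto_iff_norm_sub_tendsto_zero]
  have hN : Continuous fun g : Fin d → L2 d L => √(∑ i, ‖g i‖ ^ 2) := by fun_prop
  have h1 : Tendsto (fun n => R * ‖wn n‖ * √(∑ i, ‖(gn n - g) i‖ ^ 2)) atTop (𝓝 0) := by
    have h2 := (hN.tendsto 0).comp (tendsto_sub_nhds_zero_iff.2 hg)
    have h3 := (hw.norm.const_mul R).mul h2
    simpa using h3
  have h2 : Tendsto (fun n => R * ‖wn n - w‖ * √(∑ i, ‖g i‖ ^ 2)) atTop (𝓝 0) := by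
    have h3 := ((tendsto_iff_norm_sub_tendsto_zero.1 hw).const_mul R).mul_const (√(∑ i, ‖g i‖ ^ 2))
    simpa using h3
  have h3 := h1.add h2
  rw [add_zero] at h3
  refine squeeze_zero (fun n => norm_nonneg _) (fun n => ?_) h3
  have e : tri u (gn n) (wn n) - tri u g w = tri u (gn n - g) (wn n) + tri u g (wn n - w) := by
    rw [tri_sub_mid (hp _), tri_sub_right (hp _) (hp _)]; ring
  rw [e]
  exact (norm_add_le _ _).trans (add_le_add (abs_tri_le_of_bound_left hR hu _ _)
    (abs_tri_le_of_bound_left hR hu _ _))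

/-- With a bounded first argument the form is continuous in the gradient and in the last argument
for L², so truncating v and w suffices. -/
theorem tri_antisymm_left_smooth {f : smoothFields d L} (hf : f ∈ solenoidal d L) {v w : H d L}
    (hv : v ∈ V d L) (hw : w ∈ V d L) :
    tri (toL2 f) (grad (v : L2 d L)) (w : L2 d L) = -tri (toL2 f) (grad (w : L2 d L)) (v : L2 d L) := by
  obtain ⟨R, hR, hb⟩ := ae_bound_toL2 f
  have hlim : ∀ v w : H d L, v ∈ V d L → Tendsto (fun n : ℕ => tri (toL2 f)
      (fun i => toL2 (pderiv i (trunc n (v : L2 d L)))) (toL2 (trunc n (w : L2 d L)))) atTop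
      (𝓝 (tri (toL2 f) (grad (v : L2 d L)) (w : L2 d L))) := by
    intro v w hv
    refine tendsto_tri hR hb (tendsto_pi_nhds.2 fun i => ?_) (tendsto_trunc _)
    simp only [pderiv_trunc fun k => fc_grad hv i k]
    exact tendsto_trunc _
  refine tendsto_nhds_unique (hlim v w hv) ?_
  exact (hlim w v hw).neg.congr fun n => (tri_antisymm_smooth hf _ _).symm

theorem memLp_of_memLtilde {p : ℝ} {u : H d L} (hu : MemLtilde p u) :
    MemLp (u : L2 d L) (ENNReal.ofReal p) volume := by
  obtain ⟨f, -, hf⟩ := hu 1 one_pos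
  have h1 : MemLp (fun t => f.1 t) (ENNReal.ofReal p) (volume : Measure (Torus d L)) :=
    f.1.continuous.memLp_of_hasCompactSupport (HasCompactSupport.of_compactSpace _)
  have h2 : MemLp (fun t => (u : L2 d L) t - f.1 t) (ENNReal.ofReal p) volume :=
    ⟨(Lp.aestronglyMeasurable _).sub h1.1, hf.trans ENNReal.one_lt_top⟩
  have h3 := h2.add h1
  refine h3.ae_eq (Eventually.of_forall fun t => ?_)
  simp

theorem memLp_four_of_memLtilde {p : ℝ} (hp : 4 ≤ p) {u : H d L} (hu : MemLtilde p u) :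
    MemLp (u : L2 d L) 4 volume :=
  (memLp_of_memLtilde hu).mono_exponent (by
    rw [show (4 : ℝ≥0∞) = ENNReal.ofReal 4 by norm_num]; exact ENNReal.ofReal_le_ofReal hp)

instance : ENNReal.HolderTriple 4 4 2 := ⟨by
  rw [← two_mul, ← ENNReal.toReal_eq_toReal_iff' (by finiteness) (by finiteness)]
  norm_num⟩

theorem l2Pair_of_memLp_four {u w : L2 d L} (hu : MemLp u 4 volume) (hw : MemLp w 4 volume) :
    L2Pair u w := hw.norm.mul (p := 4) (q := 4) hu.norm

theorem abs_tri_le_four {u w : L2 d L} (hu : MemLp u 4 volume) (hw : MemLp w 4 volume)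
    (g : Fin d → L2 d L) :
    |tri u g w| ≤ (eLpNorm u 4 volume).toReal * (eLpNorm w 4 volume).toReal *
      √(∑ i, ‖g i‖ ^ 2) := by
  have hp := l2Pair_of_memLp_four hu hw
  have h := abs_tri_le (u := u) (w := w) hp (Eventually.of_forall fun t => le_rfl) g
  refine h.trans (mul_le_mul_of_nonneg_right ?_ (Real.sqrt_nonneg _))
  have h1 : √(∫ t, (‖u t‖ * ‖w t‖) ^ 2) = (eLpNorm (fun t => ‖u t‖ * ‖w t‖) 2 volume).toReal := by
    rw [hp.eLpNorm_eq_integral_rpow_norm (by norm_num) (by norm_num), ENNReal.toReal_ofReal (by positivity),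
      Real.sqrt_eq_rpow]
    simp
  rw [h1, ← ENNReal.toReal_mul]
  refine ENNReal.toReal_mono (ENNReal.mul_ne_top hu.2.ne hw.2.ne) ?_
  have h2 := eLpNorm_smul_le_mul_eLpNorm (p := 4) (q := 4) (r := 2) hw.1.norm hu.1.norm
  rw [eLpNorm_norm, eLpNorm_norm] at h2
  exact h2

/-- Here only u is approximated, in L^p and hence in L⁴, by the solenoidal fields that membership in
L̃^p provides; v and w stay fixed. This avoids approximating one field simultaneously in H¹ and L^p.
-/
theorem tri_antisymm {p : ℝ} (hp : 4 ≤ p) {u v w : H d L} (hu : MemLtilde p u) (hv : v ∈ V d L)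
    (hw : w ∈ V d L) (hv4 : MemLp (v : L2 d L) 4 volume) (hw4 : MemLp (w : L2 d L) 4 volume) :
    tri (u : L2 d L) (grad (v : L2 d L)) (w : L2 d L) =
      -tri (u : L2 d L) (grad (w : L2 d L)) (v : L2 d L) := by
  have hu4 := memLp_four_of_memLtilde hp hu
  set A := (eLpNorm (w : L2 d L) 4 volume).toReal * √(∑ i, ‖grad (v : L2 d L) i‖ ^ 2) +
    (eLpNorm (v : L2 d L) 4 volume).toReal * √(∑ i, ‖grad (w : L2 d L) i‖ ^ 2) with hA
  have hA0 : 0 ≤ A := by positivity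
  set V : ℝ≥0∞ := volume (Set.univ : Set (Torus d L)) ^ (1 / (4 : ℝ≥0∞).toReal - 1 / (ENNReal.ofReal p).toReal) with hV
  have hVtop : V ≠ ⊤ := by
    rw [hV]
    refine ENNReal.rpow_ne_top_of_nonneg ?_ (measure_ne_top _ _)
    rw [ENNReal.toReal_ofReal (by linarith), sub_nonneg]
    rw [one_div, one_div]
    exact inv_anti₀ (by norm_num) (by simpa using hp)
  have key : ∀ ε : ℝ, 0 < ε → |tri (u : L2 d L) (grad (v : L2 d L)) (w : L2 d L) +
      tri (u : L2 d L) (grad (w : L2 d L)) (v : L2 d L)| ≤ ε * V.toReal * A := by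
    intro ε hε
    obtain ⟨f, hf, hfe⟩ := hu (ENNReal.ofReal ε) (ENNReal.ofReal_pos.2 hε)
    obtain ⟨R, hR, hb⟩ := ae_bound_toL2 f
    have hf4 : MemLp (toL2 f : L2 d L) 4 volume := by
      have h1 : MemLp (fun t => f.1 t) 4 (volume : Measure (Torus d L)) :=
        f.1.continuous.memLp_of_hasCompactSupport (HasCompactSupport.of_compactSpace _)
      exact MemLp.ae_eq ((toL2_ae f).mono fun t ht => ht.symm) h1
    have hd4 : MemLp ((u : L2 d L) - toL2 f : L2 d L) 4 volume :=
      MemLp.ae_eq (Lp.coeFn_sub _ _).symm (hu4.sub hf4)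
    have hn : (eLpNorm ((u : L2 d L) - toL2 f : L2 d L) 4 volume).toReal ≤ ε * V.toReal := by
      have h1 : eLpNorm ((u : L2 d L) - toL2 f : L2 d L) 4 volume =
          eLpNorm (fun t => (u : L2 d L) t - f.1 t) 4 volume := by
        refine eLpNorm_congr_ae ?_
        filter_upwards [Lp.coeFn_sub (u : L2 d L) (toL2 f), toL2_ae f] with t h1 h2
        rw [h1, Pi.sub_apply, h2]
      have h2 := eLpNorm_le_eLpNorm_mul_rpow_measure_univ (μ := (volume : Measure (Torus d L)))
        (p := 4) (q := ENNReal.ofReal p) (f := fun t => (u : L2 d L) t - f.1 t)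
        (by rw [show (4 : ℝ≥0∞) = ENNReal.ofReal 4 by norm_num]; exact ENNReal.ofReal_le_ofReal hp)
        ((Lp.aestronglyMeasurable _).sub f.1.continuous.aestronglyMeasurable)
      rw [h1]
      have h3 := h2.trans (mul_le_mul_left hfe.le V)
      have h4 := ENNReal.toReal_mono (ENNReal.mul_ne_top ENNReal.ofReal_ne_top hVtop) h3
      rwa [ENNReal.toReal_mul, ENNReal.toReal_ofReal hε.le] at h4
    have hanti := tri_antisymm_left_smooth hf hv hw
    have e1 := tri_sub_left (l2Pair_of_memLp_four hu4 hw4) (l2Pair_of_memLp_four hf4 hw4) (grad (v : L2 d L))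
    have e2 := tri_sub_left (l2Pair_of_memLp_four hu4 hv4) (l2Pair_of_memLp_four hf4 hv4) (grad (w : L2 d L))
    have e3 : tri (u : L2 d L) (grad (v : L2 d L)) (w : L2 d L) +
      tri (u : L2 d L) (grad (w : L2 d L)) (v : L2 d L) =
      tri ((u : L2 d L) - toL2 f) (grad (v : L2 d L)) (w : L2 d L) +
      tri ((u : L2 d L) - toL2 f) (grad (w : L2 d L)) (v : L2 d L) := by
      rw [e1, e2, hanti]; ring
    rw [e3]
    have b1 := abs_tri_le_four hd4 hw4 (grad (v : L2 d L))
    have b2 := abs_tri_le_four hd4 hv4 (grad (w : L2 d L))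
    refine (abs_add_le _ _).trans ((add_le_add b1 b2).trans ?_)
    rw [mul_assoc, mul_assoc, ← mul_add]
    exact mul_le_mul_of_nonneg_right hn hA0
  have hz : |tri (u : L2 d L) (grad (v : L2 d L)) (w : L2 d L) +
      tri (u : L2 d L) (grad (w : L2 d L)) (v : L2 d L)| ≤ 0 := by
    have hlim : Tendsto (fun n : ℕ => 1 / ((n : ℝ) + 1) * V.toReal * A) atTop (𝓝 0) := by
      have := ((tendsto_one_div_add_atTop_nhds_zero_nat (𝕜 := ℝ)).mul_const V.toReal).mul_const A
      simpa using this
    exact ge_of_tendsto' hlim fun n => key _ (by positivity)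
  have := abs_nonpos_iff.1 hz
  linarith

end Forms

/-! ### Monotonicity of the nonlinear terms up to a multiple of the identity. -/

section Monotonicity

open Filter

variable {d : ℕ} {L : ℝ} [Fact (0 < L)]

/-- Both factors are dominated by powers of max(1, x, y). On the torus, of finite measure, this
makes every mixed power of total degree at most c integrable. -/
theorem rpow_mul_rpow_le {x y a b c : ℝ} (hx : 0 ≤ x) (hy : 0 ≤ y) (ha : 0 ≤ a) (hb : 0 ≤ b)
    (h : a + b ≤ c) : x ^ a * y ^ b ≤ 1 + x ^ c + y ^ c := by
  set m := max 1 (max x y) with hm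
  have hm1 : 1 ≤ m := le_max_left _ _
  have hxm : x ≤ m := (le_max_left _ _).trans (le_max_right _ _)
  have hym : y ≤ m := (le_max_right _ _).trans (le_max_right _ _)
  have hm0 : 0 < m := by linarith
  have hxc : 0 ≤ x ^ c := by positivity
  have hyc : 0 ≤ y ^ c := by positivity
  calc x ^ a * y ^ b ≤ m ^ a * m ^ b :=
        mul_le_mul (Real.rpow_le_rpow hx hxm ha) (Real.rpow_le_rpow hy hym hb) (by positivity)
          (by positivity)
    _ = m ^ (a + b) := (Real.rpow_add hm0 _ _).symm
    _ ≤ m ^ c := Real.rpow_le_rpow_of_exponent_le hm1 h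
    _ ≤ 1 + x ^ c + y ^ c := by
        rcases max_choice 1 (max x y) with h1 | h1
        · rw [hm, h1, Real.one_rpow]; linarith
        · rcases max_choice x y with h2 | h2
          · rw [hm, h1, h2]; linarith
          · rw [hm, h1, h2]; linarith

theorem aestronglyMeasurable_norm_rpow (u : L2 d L) (a : ℝ) :
    AEStronglyMeasurable (fun t => ‖u t‖ ^ a) volume :=
  ((Lp.aestronglyMeasurable u).norm.aemeasurable.pow_const a).aestronglyMeasurable

theorem integrable_norm_rpow_of_memLp {c : ℝ} (hc : 0 < c) {u : L2 d L}
    (hu : MemLp u (ENNReal.ofReal c) volume) : Integrable fun t => ‖u t‖ ^ c := by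
  have h := hu.integrable_norm_rpow (by simpa using hc) ENNReal.ofReal_ne_top
  rwa [ENNReal.toReal_ofReal hc.le] at h

theorem integrable_rpow_mul_rpow {c a b : ℝ} (hc : 0 < c) (ha : 0 ≤ a) (hb : 0 ≤ b)
    (h : a + b ≤ c) {u w : L2 d L} (hu : MemLp u (ENNReal.ofReal c) volume)
    (hw : MemLp w (ENNReal.ofReal c) volume) : Integrable fun t => ‖u t‖ ^ a * ‖w t‖ ^ b := by
  refine (((integrable_const (1 : ℝ)).add (integrable_norm_rpow_of_memLp hc hu)).add
    (integrable_norm_rpow_of_memLp hc hw)).mono' ((aestronglyMeasurable_norm_rpow u a).mul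
      (aestronglyMeasurable_norm_rpow w b)) (Eventually.of_forall fun t => ?_)
  rw [Real.norm_of_nonneg (by positivity)]
  exact rpow_mul_rpow_le (norm_nonneg _) (norm_nonneg _) ha hb h

theorem aestronglyMeasurable_powField {p : ℝ} (hp : 1 ≤ p) (u : L2 d L) :
    AEStronglyMeasurable (fun t => powField p (u t)) volume :=
  (continuous_powField hp).comp_aestronglyMeasurable (Lp.aestronglyMeasurable u)

theorem integrable_inner_powField {c p : ℝ} (hp : 1 ≤ p) (hpc : p + 1 ≤ c) {u w : L2 d L}
    (hu : MemLp u (ENNReal.ofReal c) volume) (hw : MemLp w (ENNReal.ofReal c) volume) :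
    Integrable fun t => inner ℝ (powField p (u t)) (w t) := by
  refine (integrable_rpow_mul_rpow (a := p) (b := 1) (by linarith) (by linarith) zero_le_one hpc
    hu hw).mono' ((aestronglyMeasurable_powField hp u).inner (Lp.aestronglyMeasurable w))
    (Eventually.of_forall fun t => ?_)
  rw [Real.rpow_one, ← norm_powField hp]
  exact norm_inner_le_norm _ _

theorem memLp_powField_of_bound {p R : ℝ} (hp : 1 ≤ p) {u : L2 d L} (hu : ∀ᵐ t, ‖u t‖ ≤ R) :
    MemLp (fun t => powField p (u t)) 2 volume := by
  refine MemLp.of_bound (aestronglyMeasurable_powField hp u) (R ^ p) (hu.mono fun t ht => ?_)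
  rw [norm_powField hp]
  exact Real.rpow_le_rpow (norm_nonneg _) ht (by linarith)

theorem powerForm_eq (p : ℝ) (u w : H d L) :
    powerForm p u w = ∫ t, inner ℝ (powField p ((u : L2 d L) t)) ((w : L2 d L) t) := by
  simp only [powerForm, powField, real_inner_smul_left]

/-- The pairing of `(u · ∇) u + β |u|^{r-1} u + γ |u|^{q-1} u` with `w`. -/
def nform (β γ r q : ℝ) (u w : H d L) : ℝ :=
  trilinear u u w + β * powerForm r u w + γ * powerForm q u w

theorem MemLtilde.add {p : ℝ} (hp : 1 ≤ p) {u v : H d L} (hu : MemLtilde p u)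
    (hv : MemLtilde p v) : MemLtilde p (u + v) := by
  intro ε hε
  obtain ⟨f, hf, hf'⟩ := hu (ε / 2) (ENNReal.half_pos hε.ne')
  obtain ⟨g, hg, hg'⟩ := hv (ε / 2) (ENNReal.half_pos hε.ne')
  refine ⟨f + g, add_mem hf hg, ?_⟩
  have e : (fun t => ((u + v : H d L) : L2 d L) t - (f + g).1 t) =ᵐ[volume]
      (fun t => (u : L2 d L) t - f.1 t) + fun t => (v : L2 d L) t - g.1 t := by
    filter_upwards [Lp.coeFn_add (u : L2 d L) (v : L2 d L)] with t ht
    rw [Submodule.coe_add, ht, Pi.add_apply, Pi.add_apply, Submodule.coe_add,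
      ContinuousMap.add_apply]
    abel
  rw [eLpNorm_congr_ae e]
  refine (eLpNorm_add_le ((Lp.aestronglyMeasurable _).sub f.1.continuous.aestronglyMeasurable)
    ((Lp.aestronglyMeasurable _).sub g.1.continuous.aestronglyMeasurable) ?_).trans_lt ?_
  · rw [← ENNReal.ofReal_one]; exact ENNReal.ofReal_le_ofReal hp
  · exact (ENNReal.add_lt_add hf' hg').trans_eq (ENNReal.add_halves ε)

theorem MemLtilde.neg {p : ℝ} {u : H d L} (hu : MemLtilde p u) : MemLtilde p (-u) := by
  intro ε hε
  obtain ⟨f, hf, hf'⟩ := hu ε hε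
  refine ⟨(-1 : ℝ) • f, Submodule.smul_mem _ _ hf, ?_⟩
  have e : (fun t => ((-u : H d L) : L2 d L) t - ((-1 : ℝ) • f).1 t) =ᵐ[volume]
      -(fun t => (u : L2 d L) t - f.1 t) := by
    filter_upwards [Lp.coeFn_neg (u : L2 d L)] with t ht
    rw [Submodule.coe_neg, ht, Pi.neg_apply, Pi.neg_apply, Submodule.coe_smul,
      ContinuousMap.smul_apply]
    module
  rwa [eLpNorm_congr_ae e, eLpNorm_neg]

theorem add_mem_VL {p : ℝ} (hp : 1 ≤ p) {u v : H d L} (hu : u ∈ VL d L p) (hv : v ∈ VL d L p) :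
    u + v ∈ VL d L p := ⟨add_mem_V hu.1 hv.1, hu.2.add hp hv.2⟩

theorem sub_mem_VL {p : ℝ} (hp : 1 ≤ p) {u v : H d L} (hu : u ∈ VL d L p) (hv : v ∈ VL d L p) :
    u - v ∈ VL d L p :=
  ⟨sub_mem_V hu.1 hv.1, by rw [sub_eq_add_neg]; exact hu.2.add hp hv.2.neg⟩

/-- The difference of the convective terms, tested with the difference of the fields. -/
theorem trilinear_sub_trilinear {p : ℝ} (hp : 4 ≤ p) {Y Z : H d L} (hY : Y ∈ VL d L p)
    (hZ : Z ∈ VL d L p) :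
    trilinear Y Y (Y - Z) - trilinear Z Z (Y - Z) =
      -tri ((Y - Z : H d L) : L2 d L) (grad ((Y - Z : H d L) : L2 d L)) (Z : L2 d L) := by
  have hW := sub_mem_VL (by linarith) hY hZ
  have hY4 := memLp_four_of_memLtilde hp hY.2
  have hZ4 := memLp_four_of_memLtilde hp hZ.2
  have hW4 := memLp_four_of_memLtilde hp hW.2
  rw [trilinear_eq_tri (l2Pair_of_memLp_four hY4 hW4), trilinear_eq_tri (l2Pair_of_memLp_four hZ4 hW4)]
  have e1 := tri_sub_mid (l2Pair_of_memLp_four hY4 hW4) (grad (Y : L2 d L)) (grad (Z : L2 d L))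
  rw [← grad_sub hY.1 hZ.1] at e1
  have e2 := tri_sub_left (l2Pair_of_memLp_four hY4 hW4) (l2Pair_of_memLp_four hZ4 hW4)
    (grad (Z : L2 d L))
  rw [← Submodule.coe_sub] at e2
  -- Antisymmetry gives b(Y,W,W) = 0 and b(W,Z,W) = -b(W,W,Z), where W = Y - Z.
  have e3 := tri_antisymm hp hY.2 hW.1 hW.1 hW4 hW4
  have e4 := tri_antisymm hp hW.2 hZ.1 hW.1 hZ4 hW4
  linarith

theorem stokesForm_self_nonneg (u : H d L) : 0 ≤ stokesForm u u := by
  rw [stokesForm_self]; exact Finset.sum_nonneg fun i _ => by positivity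

theorem sqrt_mul_sqrt_le {μ a b : ℝ} (hμ : 0 < μ) (ha : 0 ≤ a) (hb : 0 ≤ b) :
    √a * √b ≤ μ * b + 1 / (4 * μ) * a := by
  have : 0 ≤ (2 * μ * √b - √a) ^ 2 / (4 * μ) := by positivity
  have e : (2 * μ * √b - √a) ^ 2 / (4 * μ) = μ * √b ^ 2 + 1 / (4 * μ) * √a ^ 2 - √a * √b := by
    field_simp; ring
  rw [e, Real.sq_sqrt ha, Real.sq_sqrt hb] at this
  linarith

theorem trilinear_sub_trilinear_ge {μ p : ℝ} (hμ : 0 < μ) (hp : 4 ≤ p) {Y Z : H d L}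
    (hY : Y ∈ VL d L p) (hZ : Z ∈ VL d L p) :
    -(μ * stokesForm (Y - Z) (Y - Z)) -
        1 / (4 * μ) * ∫ t, ‖(Z : L2 d L) t‖ ^ 2 * ‖((Y - Z : H d L) : L2 d L) t‖ ^ 2 ≤
      trilinear Y Y (Y - Z) - trilinear Z Z (Y - Z) := by
  rw [trilinear_sub_trilinear hp hY hZ]
  have hW := sub_mem_VL (by linarith) hY hZ
  set W : H d L := Y - Z
  have h1 := abs_tri_le (u := (W : L2 d L)) (w := (Z : L2 d L))
    (l2Pair_of_memLp_four (memLp_four_of_memLtilde hp hW.2)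
      (memLp_four_of_memLtilde hp hZ.2)) (Eventually.of_forall fun t => le_rfl)
    (grad (W : L2 d L))
  rw [← stokesForm_self, integral_congr_ae (g := fun t => ‖(Z : L2 d L) t‖ ^ 2 *
    ‖(W : L2 d L) t‖ ^ 2) (Eventually.of_forall fun t => by simp only []; ring)] at h1
  have h3 := sqrt_mul_sqrt_le (a := ∫ t, ‖(Z : L2 d L) t‖ ^ 2 * ‖(W : L2 d L) t‖ ^ 2) hμ
    (integral_nonneg fun t => by positivity) (stokesForm_self_nonneg W)
  have h4 := (le_abs_self _).trans (h1.trans h3)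
  linarith

theorem powerForm_sub_powerForm {c p : ℝ} (hp : 1 ≤ p) (hpc : p + 1 ≤ c) {Y Z : H d L}
    {w : H d L} (hY : MemLp (Y : L2 d L) (ENNReal.ofReal c) volume)
    (hZ : MemLp (Z : L2 d L) (ENNReal.ofReal c) volume)
    (hw : MemLp (w : L2 d L) (ENNReal.ofReal c) volume) :
    (Integrable fun t => inner ℝ (powField p ((Y : L2 d L) t) - powField p ((Z : L2 d L) t))
      ((w : L2 d L) t)) ∧
    powerForm p Y w - powerForm p Z w = ∫ t, inner ℝ (powField p ((Y : L2 d L) t) -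
      powField p ((Z : L2 d L) t)) ((w : L2 d L) t) := by
  have h1 := integrable_inner_powField hp hpc hY hw
  have h2 := integrable_inner_powField hp hpc hZ hw
  simp only [inner_sub_left]
  exact ⟨h1.sub h2, by rw [powerForm_eq, powerForm_eq, integral_sub h1 h2]⟩

/-- The convective difference is at least -μ‖∇W‖² - (1/4μ) ∫|Z|²|W|², with W = Y - Z; the last
integral and the γ term are absorbed pointwise by the damping. The constants are chosen before d and
L, so they depend on μ, β, γ, r, q only. -/
theorem exists_monotone {μ β γ r q : ℝ} (hμ : 0 < μ) (hβ : 0 < β) (hq : 1 ≤ q) (hqr : q < r)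
    (hr : 3 < r ∨ r = 3 ∧ 1 < 2 * β * μ) :
    ∃ k : ℝ, 0 < k ∧ ∃ δ : ℝ, 0 < δ ∧ ∀ (d : ℕ) (L : ℝ) [Fact (0 < L)] (Y Z : H d L),
      Y ∈ VL d L (r + 1) → Z ∈ VL d L (r + 1) →
      δ * ∫ t, (‖(Y : L2 d L) t‖ ^ (r - 1) + ‖(Z : L2 d L) t‖ ^ (r - 1)) *
          ‖((Y - Z : H d L) : L2 d L) t‖ ^ 2 ≤
        μ * stokesForm (Y - Z) (Y - Z) +
          (nform β γ r q Y (Y - Z) - nform β γ r q Z (Y - Z)) + k * ‖Y - Z‖ ^ 2 := by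
  -- 1/(4μ) is the cost in Young's inequality of spending all of μ‖∇W‖²; β/2 is the strong
  -- monotonicity constant of the damping. For r = 3, 1/(4μ) < β/2 is 2βμ > 1.
  obtain ⟨δ, hδ, k, hk, habs⟩ := exists_absorb (A := 1 / (4 * μ)) (B := |γ| * q) (b := β / 2)
    (q := q) (r := r) (by positivity) (by positivity) (by positivity) hq hqr (by
      rcases hr with h | ⟨h, h'⟩
      · exact Or.inl h
      · refine Or.inr ⟨h, ?_⟩
        rw [div_lt_div_iff₀ (by positivity) (by positivity)]
        linarith)
  have hr3 : 3 ≤ r := by rcases hr with h | ⟨h, -⟩ <;> linarith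
  -- The scalar inequality is used at |Y| and at |Z|, and each use costs k.
  refine ⟨2 * k, by positivity, δ, hδ, fun d L _ Y Z hY hZ => ?_⟩
  have hW := sub_mem_VL (by linarith) hY hZ
  have hYr := memLp_of_memLtilde hY.2
  have hZr := memLp_of_memLtilde hZ.2
  have hWr := memLp_of_memLtilde hW.2
  set W : H d L := Y - Z with hWdef
  have hWae : ∀ᵐ t, (W : L2 d L) t = (Y : L2 d L) t - (Z : L2 d L) t := by
    filter_upwards [Lp.coeFn_sub (Y : L2 d L) (Z : L2 d L)] with t ht
    rw [hWdef, Submodule.coe_sub, ht, Pi.sub_apply]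
  obtain ⟨ir, er⟩ := powerForm_sub_powerForm (p := r) (by linarith) le_rfl hYr hZr hWr
  obtain ⟨iq, eq⟩ := powerForm_sub_powerForm (p := q) hq (by linarith) hYr hZr hWr
  have iW := integrable_norm_sq (W : L2 d L)
  have i0 : ∀ {y : L2 d L} {a : ℝ}, MemLp y (ENNReal.ofReal (r + 1)) volume → 0 ≤ a → a ≤ r - 1 →
      Integrable fun t => ‖y t‖ ^ a * ‖(W : L2 d L) t‖ ^ 2 := by
    intro y a hy ha har
    have := integrable_rpow_mul_rpow (a := a) (b := 2) (c := r + 1) (by linarith) ha (by norm_num)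
      (by linarith) hy hWr
    simpa only [Real.rpow_two] using this
  have iY := i0 (a := r - 1) hYr (by linarith) le_rfl
  have iZ := i0 (a := r - 1) hZr (by linarith) le_rfl
  have iZ2 := i0 (a := 2) hZr (by norm_num) (by linarith)
  simp only [Real.rpow_two] at iZ2
  have iYZ : Integrable fun t => (‖(Y : L2 d L) t‖ ^ (r - 1) + ‖(Z : L2 d L) t‖ ^ (r - 1)) *
      ‖(W : L2 d L) t‖ ^ 2 := by
    simp only [add_mul]; exact iY.add iZ
  have htri := trilinear_sub_trilinear_ge hμ (p := r + 1) (by linarith) hY hZ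
  have hpt : ∀ᵐ t, δ * ((‖(Y : L2 d L) t‖ ^ (r - 1) + ‖(Z : L2 d L) t‖ ^ (r - 1)) *
        ‖(W : L2 d L) t‖ ^ 2) + 1 / (4 * μ) * (‖(Z : L2 d L) t‖ ^ 2 * ‖(W : L2 d L) t‖ ^ 2) ≤
      β * inner ℝ (powField r ((Y : L2 d L) t) - powField r ((Z : L2 d L) t)) ((W : L2 d L) t) +
      γ * inner ℝ (powField q ((Y : L2 d L) t) - powField q ((Z : L2 d L) t)) ((W : L2 d L) t) +
      2 * k * ‖(W : L2 d L) t‖ ^ 2 := by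
    filter_upwards [hWae] with t ht
    rw [ht]
    set y := (Y : L2 d L) t
    set z := (Z : L2 d L) t
    have h1 := inner_powField_sub_ge (p := r) (by linarith) y z
    have h2 : |inner ℝ (powField q y - powField q z) (y - z)| ≤
        q * (‖y‖ ^ (q - 1) + ‖z‖ ^ (q - 1)) * ‖y - z‖ ^ 2 :=
      (abs_real_inner_le_norm _ _).trans (by
        have := mul_le_mul_of_nonneg_right (norm_powField_sub_le hq y z) (norm_nonneg (y - z))
        linarith)
    have h3 : γ * inner ℝ (powField q y - powField q z) (y - z) ≥
        -(|γ| * (q * (‖y‖ ^ (q - 1) + ‖z‖ ^ (q - 1)) * ‖y - z‖ ^ 2)) := by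
      refine neg_le_of_abs_le ?_
      rw [abs_mul]
      exact mul_le_mul_of_nonneg_left h2 (abs_nonneg _)
    have h4 := mul_le_mul_of_nonneg_right (habs ‖y‖ (norm_nonneg _)) (sq_nonneg ‖y - z‖)
    have h5 := mul_le_mul_of_nonneg_right (habs ‖z‖ (norm_nonneg _)) (sq_nonneg ‖y - z‖)
    have h6 : 0 ≤ 1 / (4 * μ) * ‖y‖ ^ 2 * ‖y - z‖ ^ 2 := by positivity
    have h7 := mul_le_mul_of_nonneg_left h1 hβ.le
    linarith
  have hint := integral_mono_ae ((iYZ.const_mul δ).add (iZ2.const_mul (1 / (4 * μ))))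
    (((ir.const_mul β).add (iq.const_mul γ)).add (iW.const_mul (2 * k))) hpt
  rw [integral_add' (iYZ.const_mul δ) (iZ2.const_mul (1 / (4 * μ))),
    integral_add' ((ir.const_mul β).add (iq.const_mul γ)) (iW.const_mul (2 * k)),
    integral_add' (ir.const_mul β) (iq.const_mul γ), integral_const_mul, integral_const_mul,
    integral_const_mul, integral_const_mul, integral_const_mul, ← er, ← eq, integral_norm_sq] at hint
  have hn : ‖(W : L2 d L)‖ = ‖W‖ := rfl
  rw [hn] at hint
  unfold nform
  linarith

end Monotonicity

/-! ### The nonlinear terms on bounded fields: representation in ℍ, local Lipschitz bounds,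
continuity. -/

section Regularised

open Filter

variable {d : ℕ} {L : ℝ} [Fact (0 < L)] {β γ r q : ℝ}

theorem inner_leray (x : L2 d L) (w : H d L) : inner ℝ (leray x) w = inner ℝ x (w : L2 d L) :=
  Submodule.inner_orthogonalProjectionOnto_eq_of_mem_right w x

/-- For a bounded field with square integrable gradient the convective and power terms lie in L², so
the Leray projection of their sum represents the form. -/
theorem exists_inner_eq_nform (hr : 1 ≤ r) (hq : 1 ≤ q) {u : H d L}
    (hu : ∃ R : ℝ, 0 < R ∧ ∀ᵐ t, ‖(u : L2 d L) t‖ ≤ R) :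
    ∃ h : H d L, ∀ w, inner ℝ h w = nform β γ r q u w := by
  obtain ⟨R, hR, hb⟩ := hu
  have m1 : MemLp (conv (u : L2 d L) (grad (u : L2 d L))) 2 volume := by
    refine ((memLp_gnorm (grad (u : L2 d L))).const_mul R).mono (aestronglyMeasurable_conv _ _) ?_
    filter_upwards [hb] with t ht
    refine (norm_conv_le _ _ t).trans ((mul_le_mul_of_nonneg_right ht (gnorm_nonneg _ t)).trans
      (le_abs_self _))
  have m2 := memLp_powField_of_bound hr hb
  have m3 := memLp_powField_of_bound hq hb
  refine ⟨leray (m1.toLp + β • m2.toLp + γ • m3.toLp), fun w => ?_⟩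
  have hin : ∀ {f : Torus d L → E d} (hf : MemLp f 2 volume),
      inner ℝ hf.toLp (w : L2 d L) = ∫ t, inner ℝ (f t) ((w : L2 d L) t) := by
    intro f hf
    rw [L2.inner_def]
    exact integral_congr_ae (hf.coeFn_toLp.mono fun t ht => by simp only [ht])
  rw [inner_leray, inner_add_left, inner_add_left, real_inner_smul_left, real_inner_smul_left,
    hin, hin, hin, nform, powerForm_eq, powerForm_eq, trilinear_eq_tri (l2Pair_of_bound hb _), tri]

variable (β γ r q) in
open Classical in
/-- The element of `ℍ` representing `nform β γ r q u`, for bounded `u ∈ 𝕍`. -/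
def nonlin (u : H d L) : H d L :=
  if h : ∃ h : H d L, ∀ w, inner ℝ h w = nform β γ r q u w then h.choose else 0

theorem inner_nonlin (hd : d ≤ 3) (hr : 1 ≤ r) (hq : 1 ≤ q) {u : H d L} (hu : u ∈ DA d L)
    (w : H d L) : inner ℝ (nonlin β γ r q u) w = nform β γ r q u w := by
  have h := exists_inner_eq_nform (β := β) (γ := γ) hr hq (exists_ae_bound hd hu)
  rw [nonlin, dif_pos h]
  exact h.choose_spec w

theorem abs_powerForm_sub_le {p R : ℝ} (hp : 1 ≤ p) {u v : H d L}
    (hu : ∀ᵐ t, ‖(u : L2 d L) t‖ ≤ R) (hv : ∀ᵐ t, ‖(v : L2 d L) t‖ ≤ R) (w : H d L) :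
    |powerForm p u w - powerForm p v w| ≤ p * (2 * R ^ (p - 1)) * ‖u - v‖ * ‖w‖ := by
  have hR : 0 ≤ R := by
    obtain ⟨t, ht⟩ := hu.exists
    exact (norm_nonneg _).trans ht
  have m : ∀ {u : H d L}, (∀ᵐ t, ‖(u : L2 d L) t‖ ≤ R) →
      Integrable fun t => inner ℝ (powField p ((u : L2 d L) t)) ((w : L2 d L) t) := fun hu =>
    ((memLp_powField_of_bound hp hu).norm.integrable_mul (Lp.memLp (w : L2 d L)).norm).mono
      ((memLp_powField_of_bound hp hu).1.inner (Lp.aestronglyMeasurable _))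
      (Eventually.of_forall fun t => (norm_inner_le_norm _ _).trans (le_abs_self _))
  rw [powerForm_eq, powerForm_eq, ← integral_sub (m hu) (m hv), ← Real.norm_eq_abs]
  have h2 : ENNReal.ofReal 2 = 2 := by norm_num
  have hcs := integral_mul_norm_le_Lp_mul_Lq (μ := (volume : Measure (Torus d L)))
    Real.HolderConjugate.two_two (f := ((u - v : H d L) : L2 d L)) (g := (w : L2 d L))
    (by rw [h2]; exact Lp.memLp _) (by rw [h2]; exact Lp.memLp _)
  simp only [Real.rpow_two, ← Real.sqrt_eq_rpow, integral_norm_sq,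
    Real.sqrt_sq (norm_nonneg _)] at hcs
  have hi : Integrable fun t => ‖((u - v : H d L) : L2 d L) t‖ * ‖(w : L2 d L) t‖ :=
    (Lp.memLp _).norm.integrable_mul (Lp.memLp _).norm
  refine (norm_integral_le_of_norm_le (hi.const_mul (p * (2 * R ^ (p - 1)))) ?_).trans ?_
  · filter_upwards [hu, hv, Lp.coeFn_sub (u : L2 d L) (v : L2 d L)] with t h1 h2 h3
    rw [← inner_sub_left, Submodule.coe_sub, h3, Pi.sub_apply]
    refine (norm_inner_le_norm _ _).trans ?_
    rw [← mul_assoc]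
    refine mul_le_mul_of_nonneg_right ((norm_powField_sub_le hp _ _).trans ?_) (norm_nonneg _)
    have h4 := Real.rpow_le_rpow (norm_nonneg _) h1 (by linarith : 0 ≤ p - 1)
    have h5 := Real.rpow_le_rpow (norm_nonneg _) h2 (by linarith : 0 ≤ p - 1)
    exact mul_le_mul_of_nonneg_right (mul_le_mul_of_nonneg_left (by linarith) (by linarith))
      (norm_nonneg _)
  · rw [integral_const_mul]
    have := mul_le_mul_of_nonneg_left hcs (by positivity : 0 ≤ p * (2 * R ^ (p - 1)))
    simpa only [mul_assoc, Submodule.coe_norm] using this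

/-- The convective difference is b(u-v,u,w) + b(v,u-v,w). The first term is left unestimated because
its uses differ: on truncations u - v is bounded in sup norm, while in the passage to the limit w
is. -/
theorem abs_nform_sub_le (hr : 1 ≤ r) (hq : 1 ≤ q) {R : ℝ} {u v : H d L}
    (huV : u ∈ V d L) (hvV : v ∈ V d L)
    (hu : ∀ᵐ t, ‖(u : L2 d L) t‖ ≤ R) (hv : ∀ᵐ t, ‖(v : L2 d L) t‖ ≤ R) (w : H d L) :
    |nform β γ r q u w - nform β γ r q v w| ≤
      |tri ((u - v : H d L) : L2 d L) (grad (u : L2 d L)) (w : L2 d L)| +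
      R * ‖w‖ * √(stokesForm (u - v) (u - v)) +
      (|β| * (r * (2 * R ^ (r - 1))) + |γ| * (q * (2 * R ^ (q - 1)))) * ‖u - v‖ * ‖w‖ := by
  have hR : 0 ≤ R := by
    obtain ⟨t, ht⟩ := hu.exists
    exact (norm_nonneg _).trans ht
  have pu := l2Pair_of_bound hu (w : L2 d L)
  have pv := l2Pair_of_bound hv (w : L2 d L)
  have e1 := tri_sub_left pu pv (grad (u : L2 d L))
  have e2 := tri_sub_mid pv (grad (u : L2 d L)) (grad (v : L2 d L))
  rw [← grad_sub huV hvV] at e2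
  rw [← Submodule.coe_sub] at e1
  have b2 := abs_tri_le_of_bound_left hR hv (grad ((u - v : H d L) : L2 d L)) (w : L2 d L)
  rw [← stokesForm_self] at b2
  have b3 := abs_powerForm_sub_le hr hu hv w
  have b4 := abs_powerForm_sub_le hq hu hv w
  have b3' := mul_le_mul_of_nonneg_left b3 (abs_nonneg β)
  have b4' := mul_le_mul_of_nonneg_left b4 (abs_nonneg γ)
  rw [← abs_mul] at b3' b4'
  rw [nform, nform, trilinear_eq_tri pu, trilinear_eq_tri pv]
  have e : tri (u : L2 d L) (grad (u : L2 d L)) (w : L2 d L) + β * powerForm r u w +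
      γ * powerForm q u w - (tri (v : L2 d L) (grad (v : L2 d L)) (w : L2 d L) +
      β * powerForm r v w + γ * powerForm q v w) =
      tri ((u - v : H d L) : L2 d L) (grad (u : L2 d L)) (w : L2 d L) +
      tri (v : L2 d L) (grad ((u - v : H d L) : L2 d L)) (w : L2 d L) +
      β * (powerForm r u w - powerForm r v w) + γ * (powerForm q u w - powerForm q v w) := by
    rw [e1, e2]; ring
  rw [e]
  refine (abs_add_le _ _).trans ?_
  refine (add_le_add_left (abs_add_le _ _) _).trans ?_
  refine (add_le_add_left (add_le_add_left (abs_add_le _ _) _) _).trans ?_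
  have hn : ‖(w : L2 d L)‖ = ‖w‖ := rfl
  rw [hn] at b2
  linarith

theorem abs_nform_le (hr : 1 ≤ r) (hq : 1 ≤ q) {R : ℝ} (hR : 0 ≤ R) {u : H d L}
    (huV : u ∈ V d L) (hu : ∀ᵐ t, ‖(u : L2 d L) t‖ ≤ R) (w : H d L) :
    |nform β γ r q u w| ≤ (2 * (R * √(stokesForm u u)) +
      (|β| * (r * (2 * R ^ (r - 1))) + |γ| * (q * (2 * R ^ (q - 1)))) * ‖u‖) * ‖w‖ := by
  have h0 : (0 : H d L) ∈ V d L := by simpa using smul_mem_V 0 huV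
  have hz : ∀ᵐ t, ‖((0 : H d L) : L2 d L) t‖ ≤ R := by
    filter_upwards [Lp.coeFn_zero (E d) 2 (volume : Measure (Torus d L))] with t ht
    rw [Submodule.coe_zero, ht]; simpa using hR
  have h := abs_nform_sub_le (β := β) (γ := γ) hr hq huV h0 hu hz w
  have hn : nform β γ r q (0 : H d L) w = 0 := by
    have g0 : grad ((0 : H d L) : L2 d L) = 0 := by simpa using grad_smul 0 huV
    rw [nform, trilinear, powerForm_eq, powerForm_eq, g0]
    have z : ∀ p : ℝ, ∫ t, inner ℝ (powField p (((0 : H d L) : L2 d L) t)) ((w : L2 d L) t) = 0 := by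
      intro p
      refine integral_eq_zero_of_ae ?_
      filter_upwards [Lp.coeFn_zero (E d) 2 (volume : Measure (Torus d L))] with t ht
      rw [Submodule.coe_zero, ht]
      simp [powField]
    have z' : ∀ i j, ∫ t, ((0 : H d L) : L2 d L) t i * ((0 : Fin d → L2 d L) i) t j *
        (w : L2 d L) t j = 0 := by
      intro i j
      refine integral_eq_zero_of_ae ?_
      filter_upwards [Lp.coeFn_zero (E d) 2 (volume : Measure (Torus d L))] with t ht
      rw [Submodule.coe_zero, ht]
      simp
    simp only [z, z', Finset.sum_const_zero, mul_zero, add_zero]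
  rw [hn] at h
  simp only [sub_zero] at h
  have h2 := abs_tri_le_of_bound_left hR hu (grad (u : L2 d L)) (w : L2 d L)
  rw [← stokesForm_self] at h2
  have hw : ‖(w : L2 d L)‖ = ‖w‖ := rfl
  rw [hw] at h2
  linarith

/-- The form at the fixed field u is continuous in the test function through its representative in
ℍ; replacing u by un costs quantities that vanish when un converges in H¹ with a common sup bound.
-/
theorem tendsto_nform (hr : 1 ≤ r) (hq : 1 ≤ q) {R : ℝ} {u w : H d L} {un wn : ℕ → H d L}
    (huV : u ∈ V d L) (hunV : ∀ n, un n ∈ V d L)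
    (hu : ∀ᵐ t, ‖(u : L2 d L) t‖ ≤ R) (hun : ∀ n, ∀ᵐ t, ‖(un n : L2 d L) t‖ ≤ R)
    (hwn : ∀ n, ∀ᵐ t, ‖(wn n : L2 d L) t‖ ≤ R)
    (h1 : Tendsto un atTop (𝓝 u)) (h2 : Tendsto wn atTop (𝓝 w))
    (h3 : Tendsto (fun n => stokesForm (un n - u) (un n - u)) atTop (𝓝 0)) :
    Tendsto (fun n => nform β γ r q (un n) (wn n)) atTop (𝓝 (nform β γ r q u w)) := by
  have hR : 0 ≤ R := by
    obtain ⟨t, ht⟩ := hu.exists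
    exact (norm_nonneg _).trans ht
  obtain ⟨h, hh⟩ := exists_inner_eq_nform (β := β) (γ := γ) hr hq (u := u)
    ⟨R + 1, by linarith, hu.mono fun t ht => by linarith⟩
  have hlim : Tendsto (fun n => nform β γ r q u (wn n)) atTop (𝓝 (nform β γ r q u w)) := by
    simp only [← hh]
    exact tendsto_const_nhds.inner h2
  set C := |β| * (r * (2 * R ^ (r - 1))) + |γ| * (q * (2 * R ^ (q - 1)))
  have hdiff : Tendsto (fun n => nform β γ r q u (wn n) - nform β γ r q (un n) (wn n)) atTop
      (𝓝 0) := by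
    have hn1 : Tendsto (fun n => ‖u - un n‖) atTop (𝓝 0) := by
      simp only [norm_sub_rev u]
      exact tendsto_iff_norm_sub_tendsto_zero.1 h1
    have hst : Tendsto (fun n => √(stokesForm (u - un n) (u - un n))) atTop (𝓝 0) := by
      have e : ∀ n, stokesForm (u - un n) (u - un n) = stokesForm (un n - u) (un n - u) := by
        intro n
        rw [stokesForm_self, stokesForm_self, grad_sub huV (hunV n), grad_sub (hunV n) huV]
        simp only [Pi.sub_apply, norm_sub_rev]
      simp only [e]
      simpa using h3.sqrt
    have t1 : Tendsto (fun n => R * ‖u - un n‖ * √(stokesForm u u) +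
        R * ‖wn n‖ * √(stokesForm (u - un n) (u - un n)) + C * ‖u - un n‖ * ‖wn n‖) atTop (𝓝 0) := by
      have := (((hn1.const_mul R).mul_const (√(stokesForm u u))).add
        ((h2.norm.const_mul R).mul hst)).add ((hn1.const_mul C).mul h2.norm)
      simpa using this
    refine squeeze_zero_norm (fun n => ?_) t1
    refine (abs_nform_sub_le hr hq huV (hunV n) hu (hun n) (wn n)).trans ?_
    have := abs_tri_le_of_bound_right hR (hwn n) (grad (u : L2 d L)) ((u - un n : H d L) : L2 d L)
    rw [← stokesForm_self] at this
    have hn : ‖((u - un n : H d L) : L2 d L)‖ = ‖u - un n‖ := rfl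
    rw [hn] at this
    linarith
  have := hlim.sub hdiff
  simpa using this

end Regularised

/-! ### Penalised Galerkin approximations: solvability and the energy estimate. -/

section Approximation

open Filter

variable {d : ℕ} {L : ℝ} [Fact (0 < L)] {μ β γ r q k δ c l : ℝ}

variable (d L μ β γ r q k δ) in
/-- The quantitative monotonicity of `μ A` plus the nonlinear terms. -/
def NonlinMonotone : Prop := ∀ Y Z : H d L, Y ∈ VL d L (r + 1) → Z ∈ VL d L (r + 1) →
  δ * ∫ t, (‖(Y : L2 d L) t‖ ^ (r - 1) + ‖(Z : L2 d L) t‖ ^ (r - 1)) *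
      ‖((Y - Z : H d L) : L2 d L) t‖ ^ 2 ≤
    μ * stokesForm (Y - Z) (Y - Z) +
      (nform β γ r q Y (Y - Z) - nform β γ r q Z (Y - Z)) + k * ‖Y - Z‖ ^ 2

theorem NonlinMonotone.nonneg (hM : NonlinMonotone d L μ β γ r q k δ) (hδ : 0 ≤ δ) {Y Z : H d L}
    (hY : Y ∈ VL d L (r + 1)) (hZ : Z ∈ VL d L (r + 1)) :
    0 ≤ μ * stokesForm (Y - Z) (Y - Z) +
      (nform β γ r q Y (Y - Z) - nform β γ r q Z (Y - Z)) + k * ‖Y - Z‖ ^ 2 :=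
  (mul_nonneg hδ (integral_nonneg fun t => by positivity)).trans (hM Y Z hY hZ)

theorem norm_le_of_inner_le {X : Type*} [NormedAddCommGroup X] [InnerProductSpace ℝ X] {a : X}
    {M : ℝ} (hM : 0 ≤ M) (h : ∀ v : X, inner ℝ a v ≤ M * ‖v‖) : ‖a‖ ≤ M := by
  have h1 := h a
  rw [real_inner_self_eq_norm_sq, sq] at h1
  rcases (norm_nonneg a).eq_or_lt with h0 | h0
  · rw [← h0]; exact hM
  · exact le_of_mul_le_mul_right h1 h0

theorem stokesForm_PH_le (n : ℕ) (v : H d L) :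
    √(stokesForm (PH n v) (PH n v)) ≤ √(∑ k ∈ box d n, ksq L k) * ‖v‖ := by
  have hs : 0 ≤ ∑ k ∈ box d n, ksq L k := Finset.sum_nonneg fun k _ => ksq_nonneg k
  refine Real.sqrt_le_iff.2 ⟨by positivity, ?_⟩
  rw [mul_pow, Real.sq_sqrt hs]
  refine (stokesForm_self_le (PH_mem_DA n v)).trans ?_
  have := mul_le_mul (norm_stokes_PH_le_sum n v) (norm_PH_le n v) (norm_nonneg _) (by positivity)
  linarith

variable (μ β γ r q c l) in
/-- `y` solves the Galerkin approximation, penalised with parameter `l`. -/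
def IsApprox (ye : H d L) (K : Set (H d L)) (f : H d L) (n : ℕ) (y : H d L) : Prop :=
  PH n y = y ∧ ∀ z, PH n z = z → μ * inner ℝ (stokes y) z + nform β γ r q (PH n (y + ye)) z +
    c * inner ℝ y z + l⁻¹ * inner ℝ (y - metricProj K y) z = inner ℝ f z

variable (μ β γ r q c l) in
/-- The operator of the penalised Galerkin approximation, on all of `ℍ`. -/
def approxOp (ye : H d L) (K : Set (H d L)) (n : ℕ) (y : H d L) : H d L :=
  -- The term c • y is deliberately not truncated: it makes the map strongly monotone on all of ℍ,
  -- and it forces the solution into the range of the truncation.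
  μ • stokes (PH n y) + PH n (nonlin β γ r q (PH n (y + ye))) + c • y +
    l⁻¹ • PH n (PH n y - metricProj K (PH n y))

theorem inner_approxOp (hd : d ≤ 3) (hr : 1 ≤ r) (hq : 1 ≤ q) (ye : H d L) (K : Set (H d L))
    (n : ℕ) (y w : H d L) :
    inner ℝ (approxOp μ β γ r q c l ye K n y) w = μ * inner ℝ (stokes (PH n y)) w +
      nform β γ r q (PH n (y + ye)) (PH n w) + c * inner ℝ y w +
      l⁻¹ * inner ℝ (PH n y - metricProj K (PH n y)) (PH n w) := by
  rw [approxOp, inner_add_left, inner_add_left, inner_add_left, inner_smul_leftH, inner_smul_leftH,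
    inner_smul_leftH, inner_PH_left, inner_PH_left, inner_nonlin hd hr hq (PH_mem_DA _ _)]

/-- Self-adjointness moves the truncations onto the test vector, so that the nonlinear monotonicity
applies to truncated fields and costs k‖PH n (x - y)‖² ≤ k‖x - y‖². The penalty is monotone. -/
theorem approxOp_mono (hd : d ≤ 3) (hr : 1 ≤ r) (hq : 1 ≤ q) (hδ : 0 ≤ δ) (hk : 0 ≤ k)
    (hl : 0 < l) (hM : NonlinMonotone d L μ β γ r q k δ) {K : Set (H d L)} (hK : IsAdmissible K)
    (ye : H d L) (n : ℕ) (x y : H d L) : (c - k) * ‖x - y‖ ^ 2 ≤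
      inner ℝ (approxOp μ β γ r q c l ye K n x - approxOp μ β γ r q c l ye K n y) (x - y) := by
  rw [inner_sub_left, inner_approxOp hd hr hq, inner_approxOp hd hr hq]
  have hY := mem_VL_of_mem_DA hd (PH_mem_DA n (x + ye)) (r + 1)
  have hZ := mem_VL_of_mem_DA hd (PH_mem_DA n (y + ye)) (r + 1)
  have h1 := hM.nonneg hδ hY hZ
  have e1 : PH n (x + ye) - PH n (y + ye) = PH n (x - y) := by rw [← map_sub]; congr 1; abel
  rw [e1] at h1
  have e2 : stokes (PH n (x - y)) = stokes (PH n x) - stokes (PH n y) := by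
    rw [map_sub]; exact (sub_mem_DA (PH_mem_DA n x) (PH_mem_DA n y)).2
  have e3 : stokesForm (PH n (x - y)) (PH n (x - y)) =
      inner ℝ (stokes (PH n x)) (x - y) - inner ℝ (stokes (PH n y)) (x - y) := by
    rw [← inner_stokes (PH_mem_DA n _) (PH_mem_DA n _).1, ← inner_PH_left, PH_stokes_PH, e2,
      inner_sub_left]
  have h2 := inner_sub_metricProj_sub_nonneg hK.isClosed hK.convex hK.nonempty (PH n x) (PH n y)
  rw [← map_sub, inner_sub_left] at h2
  have h3 := mul_nonneg (inv_nonneg.2 hl.le) h2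
  have h4 : ‖PH n (x - y)‖ ^ 2 ≤ ‖x - y‖ ^ 2 :=
    pow_le_pow_left₀ (norm_nonneg _) (norm_PH_le n _) 2
  have h5 := mul_le_mul_of_nonneg_left h4 hk
  have h6 : inner ℝ x (x - y) - inner ℝ y (x - y) = ‖x - y‖ ^ 2 := by
    rw [← inner_sub_left, real_inner_self_eq_norm_sq]
  rw [e3] at h1
  have h7 : c * inner ℝ x (x - y) - c * inner ℝ y (x - y) = c * ‖x - y‖ ^ 2 := by
    rw [← mul_sub, h6]
  linarith

theorem ae_norm_PH_le (n : ℕ) : ∃ C : ℝ, 0 < C ∧ ∀ u : H d L,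
    ∀ᵐ t, ‖(PH n u : L2 d L) t‖ ≤ C * ‖u‖ := by
  obtain ⟨C, hC, h⟩ := exists_trunc_apply_bound (d := d) (L := L) n
  refine ⟨C, hC, fun u => ?_⟩
  rw [coe_PH]
  filter_upwards [toL2_ae (trunc n (u : L2 d L))] with t ht
  rw [ht]
  exact (h u t).1

theorem norm_yosida_sub_le {K : Set (H d L)} (hK : IsAdmissible K) (x y : H d L) :
    ‖x - metricProj K x - (y - metricProj K y)‖ ≤ 2 * ‖x - y‖ := by
  have h1 : x - metricProj K x - (y - metricProj K y) =
      (x - y) - (metricProj K x - metricProj K y) := by abel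
  have h2 := norm_metricProj_sub_le hK.isClosed hK.convex hK.nonempty x y
  rw [h1]
  exact (norm_sub_le _ _).trans (by linarith)

theorem lipschitz_arith {C S ρ N a X Y w v w' v' A : ℝ} (hC : 0 ≤ C) (hS : 0 ≤ S) (hρ : 0 ≤ ρ)
    (hN : 0 ≤ N) (hX : 0 ≤ X) (hw : 0 ≤ w) (hv : 0 ≤ v) (hv' : 0 ≤ v')
    (h1 : X ≤ S * a) (h2 : Y ≤ S * w) (h3 : v' ≤ v) (h4 : w' ≤ w)
    (h : A ≤ C * w * v' * X + ρ * v' * Y + N * w' * v') :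
    A ≤ (C * (S * a) + ρ * S + N) * w * v := by
  have b4 : C * w * v' * X ≤ C * w * v * (S * a) :=
    mul_le_mul (mul_le_mul_of_nonneg_left h3 (by positivity)) h1 hX (by positivity)
  have b5 : ρ * v' * Y ≤ ρ * v * (S * w) :=
    (mul_le_mul_of_nonneg_left h2 (by positivity)).trans
      (mul_le_mul_of_nonneg_right (mul_le_mul_of_nonneg_left h3 hρ) (by positivity))
  have b6 : N * w' * v' ≤ N * w * v :=
    mul_le_mul (mul_le_mul_of_nonneg_left h4 hN) h3 hv' (by positivity)
  linarith

/-- On the range of a truncation the sup norm and the gradient norm are controlled by the norm of ℍ,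
with constants depending on n. -/
theorem nform_PH_lipschitz (hr : 1 ≤ r) (hq : 1 ≤ q) (ye : H d L) (n : ℕ) {R : ℝ} (hR : 0 ≤ R) :
    ∃ M : ℝ, 0 ≤ M ∧ ∀ x y v : H d L, ‖x‖ ≤ R → ‖y‖ ≤ R →
      nform β γ r q (PH n (x + ye)) (PH n v) - nform β γ r q (PH n (y + ye)) (PH n v) ≤
        M * ‖x - y‖ * ‖v‖ := by
  obtain ⟨C, hC, hb⟩ := ae_norm_PH_le (d := d) (L := L) n
  set S := ∑ k ∈ box d n, ksq L k with hS
  set ρ := C * (R + ‖ye‖) with hρ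
  have hρ0 : 0 ≤ ρ := by positivity
  set N := |β| * (r * (2 * ρ ^ (r - 1))) + |γ| * (q * (2 * ρ ^ (q - 1))) with hN
  have hN0 : 0 ≤ N := by positivity
  refine ⟨C * (√S * (R + ‖ye‖)) + ρ * √S + N, by positivity, fun x y v hx hy => ?_⟩
  have hx' : ‖x + ye‖ ≤ R + ‖ye‖ := (norm_add_le _ _).trans (by linarith)
  have hy' : ‖y + ye‖ ≤ R + ‖ye‖ := (norm_add_le _ _).trans (by linarith)
  have e1 : PH n (x + ye) - PH n (y + ye) = PH n (x - y) := by rw [← map_sub]; congr 1; abel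
  have hv := norm_PH_le n v
  have hwn := norm_PH_le n (x - y)
  have b2 := abs_nform_sub_le (β := β) (γ := γ) hr hq (R := ρ) (PH_mem_DA n (x + ye)).1
    (PH_mem_DA n (y + ye)).1
    ((hb (x + ye)).mono fun t ht => ht.trans (mul_le_mul_of_nonneg_left hx' hC.le))
    ((hb (y + ye)).mono fun t ht => ht.trans (mul_le_mul_of_nonneg_left hy' hC.le)) (PH n v)
  rw [e1, ← hN] at b2
  have b3 := abs_tri_le_of_bound_left (by positivity) (hb (x - y))
    (grad (PH n (x + ye) : L2 d L)) (PH n v : L2 d L)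
  rw [← stokesForm_self] at b3
  have hcn : ‖(PH n v : L2 d L)‖ = ‖PH n v‖ := rfl
  rw [hcn] at b3
  have hsx := (stokesForm_PH_le n (x + ye)).trans (mul_le_mul_of_nonneg_left hx' (Real.sqrt_nonneg _))
  have hsw := stokesForm_PH_le n (x - y)
  exact lipschitz_arith hC.le (Real.sqrt_nonneg _) hρ0 hN0 (Real.sqrt_nonneg _) (norm_nonneg _)
    (norm_nonneg _) (norm_nonneg _) hsx hsw hv hwn
    (((le_abs_self _).trans b2).trans (add_le_add_left (add_le_add_left b3 _) _))

theorem approxOp_lipschitz (hd : d ≤ 3) (hr : 1 ≤ r) (hq : 1 ≤ q) (hμ : 0 ≤ μ) (hc : 0 ≤ c)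
    (hl : 0 < l) {K : Set (H d L)} (hK : IsAdmissible K) (ye : H d L) (n : ℕ) (R : ℝ) :
    ∃ M : ℝ, ∀ x y, ‖x‖ ≤ R → ‖y‖ ≤ R →
      ‖approxOp μ β γ r q c l ye K n x - approxOp μ β γ r q c l ye K n y‖ ≤ M * ‖x - y‖ := by
  rcases lt_or_ge R 0 with hR | hR
  · exact ⟨0, fun x y hx => absurd (hx.trans_lt hR) (norm_nonneg x).not_gt⟩
  obtain ⟨M, hM0, hM⟩ := nform_PH_lipschitz (β := β) (γ := γ) hr hq ye n hR
  set S := ∑ k ∈ box d n, ksq L k with hS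
  have hS0 : 0 ≤ S := Finset.sum_nonneg fun k _ => ksq_nonneg k
  refine ⟨μ * S + M + c + l⁻¹ * 2, fun x y hx hy => ?_⟩
  refine norm_le_of_inner_le (by positivity) fun v => ?_
  rw [inner_sub_left, inner_approxOp hd hr hq, inner_approxOp hd hr hq]
  have b2 := hM x y v hx hy
  have b1 : inner ℝ (stokes (PH n x)) v - inner ℝ (stokes (PH n y)) v ≤ S * ‖x - y‖ * ‖v‖ := by
    rw [← inner_sub_left, ← (sub_mem_DA (PH_mem_DA n x) (PH_mem_DA n y)).2, ← map_sub]
    exact (real_inner_le_norm _ _).trans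
      (mul_le_mul_of_nonneg_right (norm_stokes_PH_le_sum n _) (norm_nonneg v))
  have b7 : inner ℝ x v - inner ℝ y v ≤ ‖x - y‖ * ‖v‖ := by
    rw [← inner_sub_left]; exact real_inner_le_norm _ _
  have b8 : inner ℝ (PH n x - metricProj K (PH n x)) (PH n v) -
      inner ℝ (PH n y - metricProj K (PH n y)) (PH n v) ≤ 2 * ‖x - y‖ * ‖v‖ := by
    rw [← inner_sub_left]
    have h1 := norm_yosida_sub_le hK (PH n x) (PH n y)
    rw [← map_sub] at h1
    exact (real_inner_le_norm _ _).trans (mul_le_mul (h1.trans (mul_le_mul_of_nonneg_left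
      (norm_PH_le n _) zero_le_two)) (norm_PH_le n v) (norm_nonneg _)
      (mul_nonneg zero_le_two (norm_nonneg _)))
  have b1' := mul_le_mul_of_nonneg_left b1 hμ
  have b7' := mul_le_mul_of_nonneg_left b7 hc
  have b8' := mul_le_mul_of_nonneg_left b8 (inv_nonneg.2 hl.le)
  linarith

theorem exists_isApprox (hd : d ≤ 3) (hr : 1 ≤ r) (hq : 1 ≤ q) (hμ : 0 ≤ μ) (hδ : 0 ≤ δ)
    (hk : 0 ≤ k) (hkc : k < c) (hl : 0 < l) (hM : NonlinMonotone d L μ β γ r q k δ)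
    {K : Set (H d L)} (hK : IsAdmissible K) (ye f : H d L) (n : ℕ) :
    ∃ y, IsApprox μ β γ r q c l ye K f n y := by
  have hc : 0 < c := hk.trans_lt hkc
  obtain ⟨y, hy⟩ := exists_eq_of_stronglyMonotone (sub_pos.2 hkc)
    (approxOp_mono hd hr hq hδ hk hl hM hK ye n)
    (approxOp_lipschitz hd hr hq hμ hc.le hl hK ye n) (PH n f)
  -- Solving the equation for c • y exhibits it as a combination of truncated vectors.
  have hy' : PH n y = y := by
    have h1 : c • y = PH n f - μ • stokes (PH n y) - PH n (nonlin β γ r q (PH n (y + ye))) -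
        l⁻¹ • PH n (PH n y - metricProj K (PH n y)) := by
      rw [← hy, approxOp]; abel
    have h2 : PH n (c • y) = c • y := by
      rw [h1, map_sub, map_sub, map_sub, map_smul, map_smul, PH_stokes_PH, PH_PH, PH_PH, PH_PH]
    rw [map_smul] at h2
    exact smul_right_injective _ hc.ne' h2
  refine ⟨y, hy', fun z hz => ?_⟩
  have h := inner_approxOp (μ := μ) (β := β) (γ := γ) (c := c) (l := l) hd hr hq ye K n y z
  rw [hy, hy', inner_PH_left, hz] at h
  exact h.symm

/-- The `L^{r+1}` norm is controlled by the dissipation and a bound on the background field. -/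
theorem exists_integral_rpow_le (hr : 3 ≤ r) {R : ℝ} (hR : 0 < R) :
    ∃ C : ℝ, 0 < C ∧ ∀ u e : H d L, MemLp (u : L2 d L) (ENNReal.ofReal (r + 1)) volume →
      MemLp (e : L2 d L) (ENNReal.ofReal (r + 1)) volume → (∀ᵐ t, ‖(e : L2 d L) t‖ ≤ R) →
      ∫ t, ‖(u : L2 d L) t‖ ^ (r + 1) ≤ 4 * (∫ t, (‖(u : L2 d L) t‖ ^ (r - 1) +
        ‖(e : L2 d L) t‖ ^ (r - 1)) * ‖((u - e : H d L) : L2 d L) t‖ ^ 2) + C := by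
  -- In |u|^{r+1} ≤ |u|^{r-1}(2|u-e|² + 2R²) this ε makes 2R²|u|^{r-1} cost half of |u|^{r+1};
  -- absorbing that half doubles the factor 2 to 4.
  obtain ⟨D, hD, hpow⟩ := exists_rpow_le_mul_rpow_add (a := r - 1) (b := r + 1)
    (ε := 1 / (4 * R ^ 2)) (by linarith) (by linarith) (by positivity)
  refine ⟨4 * R ^ 2 * D * volume.real (Set.univ : Set (Torus d L)) + 1, by positivity,
    fun u e mu me he => ?_⟩
  have ht2 : ∀ᵐ t, ((u - e : H d L) : L2 d L) t = (u : L2 d L) t - (e : L2 d L) t :=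
    Lp.coeFn_sub (u : L2 d L) (e : L2 d L)
  have my : MemLp ((u - e : H d L) : L2 d L) (ENNReal.ofReal (r + 1)) volume :=
    (mu.sub me).ae_eq (ht2.mono fun t ht => ht.symm)
  set y : H d L := u - e
  have i1 : Integrable fun t => (‖(u : L2 d L) t‖ ^ (r - 1) + ‖(e : L2 d L) t‖ ^ (r - 1)) *
      ‖(y : L2 d L) t‖ ^ 2 := by
    simp only [add_mul, ← Real.rpow_two]
    exact (integrable_rpow_mul_rpow (c := r + 1) (by linarith) (by linarith) (by norm_num)
      (by linarith) mu my).add (integrable_rpow_mul_rpow (c := r + 1) (by linarith)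
      (by linarith) (by norm_num) (by linarith) me my)
  have i2 := integrable_norm_rpow_of_memLp (by linarith) mu
  have hpt : ∀ᵐ t, ‖(u : L2 d L) t‖ ^ (r + 1) ≤
      4 * ((‖(u : L2 d L) t‖ ^ (r - 1) + ‖(e : L2 d L) t‖ ^ (r - 1)) * ‖(y : L2 d L) t‖ ^ 2) +
        4 * R ^ 2 * D := by
    filter_upwards [he, ht2] with t ht1 ht2
    rw [ht2]
    generalize (u : L2 d L) t = a at *
    generalize (e : L2 d L) t = b at *
    have a1 : ‖a‖ ≤ ‖a - b‖ + ‖b‖ := by simpa using norm_add_le (a - b) b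
    have a2 := hpow _ (norm_nonneg a)
    have a3 : 0 ≤ ‖a‖ ^ (r - 1) := by positivity
    have a5 : ‖a‖ ^ (r + 1) = ‖a‖ ^ (r - 1) * ‖a‖ ^ 2 := by
      rw [← Real.rpow_two, ← Real.rpow_add' (norm_nonneg _) (by linarith)]; congr 1; ring
    have a6 : ‖a‖ ^ 2 ≤ 2 * ‖a - b‖ ^ 2 + 2 * R ^ 2 := by
      have := pow_le_pow_left₀ (norm_nonneg a) (a1.trans (add_le_add_right ht1 _)) 2
      linarith [sq_nonneg (‖a - b‖ - R)]
    have a7 := mul_le_mul_of_nonneg_left a6 a3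
    have a8 := mul_le_mul_of_nonneg_left a2 (by positivity : 0 ≤ 2 * R ^ 2)
    have a9 : 2 * R ^ 2 * (1 / (4 * R ^ 2) * ‖a‖ ^ (r + 1) + D) =
        ‖a‖ ^ (r + 1) / 2 + 2 * R ^ 2 * D := by field_simp; ring
    rw [a9] at a8
    have a10 : 0 ≤ ‖b‖ ^ (r - 1) * ‖a - b‖ ^ 2 := by positivity
    linarith
  have h8 := integral_mono_ae i2 ((i1.const_mul 4).add (integrable_const (4 * R ^ 2 * D))) hpt
  rw [integral_add' (i1.const_mul 4) (integrable_const _), integral_const_mul, integral_const,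
    smul_eq_mul] at h8
  linarith

/-- The energy estimate. -/
theorem exists_energy_bound (hd : d ≤ 3) (hr : 3 ≤ r) (hq : 1 ≤ q) {K : Set (H d L)}
    (hK : IsAdmissible K) {ye : H d L} (hye : ye ∈ DA d L) (f : H d L) {R : ℝ} (hR : 0 ≤ R)
    (he : ∀ n, ∀ᵐ t, ‖(PH n ye : L2 d L) t‖ ≤ R) (hM : NonlinMonotone d L μ β γ r q k δ) :
    ∃ F : ℝ, 0 ≤ F ∧ ∀ (l : ℝ) (n : ℕ) (y : H d L), 0 < l → IsApprox μ β γ r q c l ye K f n y →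
      δ * (∫ t, (‖(PH n (y + ye) : L2 d L) t‖ ^ (r - 1) + ‖(PH n ye : L2 d L) t‖ ^ (r - 1)) *
        ‖((PH n (y + ye) - PH n ye : H d L) : L2 d L) t‖ ^ 2) + (c - k) * ‖y‖ ^ 2 +
        l⁻¹ * (‖y - metricProj K y‖ ^ 2 / 2) ≤ F * ‖y‖ := by
  set N := |β| * (r * (2 * R ^ (r - 1))) + |γ| * (q * (2 * R ^ (q - 1))) with hN
  have hN0 : 0 ≤ N := by positivity
  refine ⟨‖f‖ + (2 * (R * √(‖stokes ye‖ * ‖ye‖)) + N * ‖ye‖), by positivity, fun l n y hl hy => ?_⟩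
  -- Monotonicity is used between the truncations of y + yₑ and yₑ, whose difference is y. The
  -- nonlinear terms at the truncation of yₑ are bounded uniformly in n and enter F.
  have hue : PH n (y + ye) - PH n ye = y := by rw [← map_sub, add_sub_cancel_right, hy.1]
  have heD : PH n ye ∈ DA d L := PH_mem_DA _ _
  have hyD : y ∈ DA d L := by rw [← hy.1]; exact PH_mem_DA _ _
  have h1 := hM _ _ (mem_VL_of_mem_DA hd (PH_mem_DA n (y + ye)) (r + 1))
    (mem_VL_of_mem_DA hd heD (r + 1))
  rw [hue] at h1 ⊢
  have h2 := hy.2 y hy.1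
  rw [inner_stokes hyD hyD.1, real_inner_self_eq_norm_sq] at h2
  have h3 : |nform β γ r q (PH n ye) y| ≤
      (2 * (R * √(‖stokes ye‖ * ‖ye‖)) + N * ‖ye‖) * ‖y‖ := by
    refine (abs_nform_le (by linarith) hq hR heD.1 (he n) y).trans ?_
    have h4 : √(stokesForm (PH n ye) (PH n ye)) ≤ √(‖stokes ye‖ * ‖ye‖) := Real.sqrt_le_sqrt
      ((stokesForm_self_le heD).trans (mul_le_mul (norm_stokes_PH_le hye n) (norm_PH_le n ye)
        (norm_nonneg _) (norm_nonneg _)))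
    exact mul_le_mul_of_nonneg_right (add_le_add (mul_le_mul_of_nonneg_left
      (mul_le_mul_of_nonneg_left h4 hR) zero_le_two)
      (mul_le_mul_of_nonneg_left (norm_PH_le n ye) hN0)) (norm_nonneg _)
  -- The gradient inequality for the squared distance, evaluated at 0 ∈ K where the distance
  -- vanishes.
  have h4 : ‖y - metricProj K y‖ ^ 2 / 2 ≤ inner ℝ (y - metricProj K y) y := by
    have h5 := inner_sub_metricProj_le_half hK.isClosed hK.convex hK.nonempty y 0
    have h6 := norm_sub_metricProj_le hK.isClosed hK.convex (0 : H d L) hK.zero_mem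
    rw [sub_zero, norm_zero] at h6
    rw [le_antisymm h6 (norm_nonneg _), zero_sub, inner_neg_right] at h5
    linarith
  have h5 := mul_le_mul_of_nonneg_left h4 (inv_nonneg.2 hl.le)
  have h6 := real_inner_le_norm f y
  have h7 := neg_le_of_abs_le h3
  linarith

/-- The first a priori estimate. -/
theorem exists_approx_bound (hd : d ≤ 3) (hr : 3 ≤ r) (hq : 1 ≤ q) (hδ : 0 < δ)
    (hkc : k < c) (hM : NonlinMonotone d L μ β γ r q k δ)
    {K : Set (H d L)} (hK : IsAdmissible K) {ye : H d L} (hye : ye ∈ DA d L) (f : H d L) :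
    ∃ C : ℝ, 0 < C ∧ ∀ (l : ℝ) (n : ℕ) (y : H d L), 0 < l → IsApprox μ β γ r q c l ye K f n y →
      ‖y‖ ≤ C ∧ ‖y - metricProj K y‖ ^ 2 ≤ C * l ∧
      ∫ t, ‖(PH n (y + ye) : L2 d L) t‖ ^ (r + 1) ≤ C := by
  obtain ⟨R, hR, hb⟩ := exists_sup_bound (d := d) (L := L) hd (‖ye‖ + ‖stokes ye‖)
  have he : ∀ n, ∀ᵐ t, ‖(PH n ye : L2 d L) t‖ ≤ R := fun n =>
    (hb (PH n ye) (PH_mem_DA n ye)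
      ((norm_PH_le n ye).trans (by linarith [norm_nonneg (stokes ye)]))
      ((norm_stokes_PH_le hye n).trans (by linarith [norm_nonneg ye]))).1
  obtain ⟨F, hF0, hF⟩ := exists_energy_bound (c := c) hd hr hq hK hye f hR.le he hM
  obtain ⟨D, hD, hint⟩ := exists_integral_rpow_le (d := d) (L := L) hr hR
  have hck : 0 < c - k := sub_pos.2 hkc
  set B := F / (c - k) with hB
  have hB0 : 0 ≤ B := by positivity
  have hFB0 : 0 ≤ F * B := mul_nonneg hF0 hB0
  have hFBδ : 0 ≤ F * B / δ := div_nonneg hFB0 hδ.le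
  refine ⟨B + 2 * (F * B) + (4 * (F * B / δ) + D), by linarith, fun l n y hl hy => ?_⟩
  have key := hF l n y hl hy
  have hu := memLp_of_memLtilde (mem_VL_of_mem_DA hd (PH_mem_DA n (y + ye)) (r + 1)).2
  have hv := memLp_of_memLtilde (mem_VL_of_mem_DA hd (PH_mem_DA n ye) (r + 1)).2
  have hi := hint _ _ hu hv (he n)
  set I := ∫ t, (‖(PH n (y + ye) : L2 d L) t‖ ^ (r - 1) + ‖(PH n ye : L2 d L) t‖ ^ (r - 1)) *
        ‖((PH n (y + ye) - PH n ye : H d L) : L2 d L) t‖ ^ 2 with hI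
  have hI0 : 0 ≤ I := integral_nonneg fun t => by positivity
  have hl0 : 0 ≤ l⁻¹ * (‖y - metricProj K y‖ ^ 2 / 2) := by positivity
  have hδI : 0 ≤ δ * I := mul_nonneg hδ.le hI0
  have hcy : 0 ≤ (c - k) * ‖y‖ ^ 2 := by positivity
  have hyB : ‖y‖ ≤ B := by
    rw [hB, le_div_iff₀ hck]
    rcases (norm_nonneg y).eq_or_lt with h0 | h0
    · rw [← h0, zero_mul]; exact hF0
    · refine le_of_mul_le_mul_right ?_ h0
      linarith
  have hFB : F * ‖y‖ ≤ F * B := mul_le_mul_of_nonneg_left hyB hF0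
  have hIle : I ≤ F * B / δ := by rw [le_div_iff₀ hδ]; linarith
  have hs : ‖y - metricProj K y‖ ^ 2 ≤ 2 * (F * B) * l := by
    have h8 : l⁻¹ * (‖y - metricProj K y‖ ^ 2 / 2) ≤ F * B := by linarith
    rw [inv_mul_le_iff₀ hl] at h8
    linarith
  exact ⟨by linarith, hs.trans (mul_le_mul_of_nonneg_right (by linarith) hl.le), by linarith⟩

end Approximation

/-! ### The nonlinear terms tested with the Stokes operator, and their growth in the dissipation. -/

section StokesEstimate

open Filter

variable {d : ℕ} {L : ℝ} [Fact (0 < L)] {μ β γ r q k δ c l : ℝ}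

theorem toH_ae (f : solenoidal d L) : ∀ᵐ t, (toH f : L2 d L) t = f.1.1 t := toL2_ae f.1

theorem abs_integral_inner_le {F : Torus d L → E d} (hF : MemLp F 2 volume) (w : L2 d L) :
    |∫ t, inner ℝ (F t) (w t)| ≤ √(∫ t, ‖F t‖ ^ 2) * ‖w‖ := by
  have h2 : ENNReal.ofReal 2 = 2 := by norm_num
  have hcs := integral_mul_norm_le_Lp_mul_Lq (μ := (volume : Measure (Torus d L)))
    Real.HolderConjugate.two_two (f := F) (g := w)
    (by rw [h2]; exact hF) (by rw [h2]; exact Lp.memLp _)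
  simp only [Real.rpow_two, ← Real.sqrt_eq_rpow, integral_norm_sq,
    Real.sqrt_sq (norm_nonneg _)] at hcs
  refine le_trans ?_ hcs
  rw [← Real.norm_eq_abs]
  exact norm_integral_le_of_norm_le (hF.norm.integrable_mul (Lp.memLp w).norm)
    (Eventually.of_forall fun t => norm_inner_le_norm _ _)

theorem continuous_norm_rpow (f : smoothFields d L) {p : ℝ} (hp : 0 ≤ p) :
    Continuous fun t => ‖f.1 t‖ ^ p :=
  f.1.continuous.norm.rpow_const fun _ => Or.inr hp

theorem abs_powerForm_toH_le {p : ℝ} (hp : 1 ≤ p) (f : solenoidal d L) (w : H d L) :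
    |powerForm p (toH f) w| ≤ √(∫ t, ‖f.1.1 t‖ ^ (2 * p)) * ‖w‖ := by
  have e : powerForm p (toH f) w = ∫ t, inner ℝ (powField p (f.1.1 t)) ((w : L2 d L) t) := by
    rw [powerForm_eq]
    exact integral_congr_ae ((toH_ae f).mono fun t ht => by simp only [ht])
  have hm : MemLp (fun t => powField p (f.1.1 t)) 2 (volume : Measure (Torus d L)) :=
    ((continuous_powField hp).comp f.1.1.continuous).memLp_of_hasCompactSupport
      (HasCompactSupport.of_compactSpace _)
  have h := abs_integral_inner_le hm (w : L2 d L)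
  have e2 : ∀ t, ‖powField p (f.1.1 t)‖ ^ 2 = ‖f.1.1 t‖ ^ (2 * p) := by
    intro t
    rw [norm_powField hp, ← Real.rpow_two, ← Real.rpow_mul (norm_nonneg _), mul_comm]
  simp only [e2] at h
  rw [e]
  exact h

theorem gnorm_grad_toH (f : solenoidal d L) :
    ∀ᵐ t, gnorm (grad (toH f : L2 d L)) t ^ 2 = gradSq f.1 t := by
  have h : ∀ᵐ t, ∀ i, grad (toH f : L2 d L) i t = (pderiv i f.1).1 t :=
    ae_all_iff.2 fun i => by rw [grad_toH]; exact toL2_ae _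
  filter_upwards [h] with t ht
  rw [gnorm_sq, gradSq]
  simp only [ht]

theorem stokesForm_toH (f : solenoidal d L) : stokesForm (toH f) (toH f) = dissip 1 f.1 := by
  rw [stokesForm_self, ← integral_gnorm_sq, dissip]
  refine integral_congr_ae ((gnorm_grad_toH f).mono fun t ht => ?_)
  simp [ht]

theorem abs_trilinear_toH_le (f : solenoidal d L) (w : H d L) :
    |trilinear (toH f) (toH f) w| ≤ √(dissip 3 f.1) * ‖w‖ := by
  obtain ⟨R, -, hb⟩ := ae_bound_toL2 f.1
  have hb' : ∀ᵐ t, ‖(toH f : L2 d L) t‖ ≤ R := hb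
  rw [trilinear_eq_tri (l2Pair_of_bound hb' _)]
  have hm : MemLp (conv (toH f : L2 d L) (grad (toH f : L2 d L))) 2 volume := by
    refine ((memLp_gnorm (grad (toH f : L2 d L))).const_mul R).mono
      (aestronglyMeasurable_conv _ _) ?_
    filter_upwards [hb'] with t ht
    exact (norm_conv_le _ _ t).trans ((mul_le_mul_of_nonneg_right ht (gnorm_nonneg _ t)).trans
      (le_abs_self _))
  refine (abs_integral_inner_le hm (w : L2 d L)).trans
    (mul_le_mul_of_nonneg_right (Real.sqrt_le_sqrt ?_) (norm_nonneg _))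
  refine integral_mono_ae ((memLp_two_iff_integrable_sq_norm hm.1).1 hm)
    (integrable_of_continuous (continuous_dissip (by norm_num) f.1)) ?_
  filter_upwards [toH_ae f, gnorm_grad_toH f] with t h1 h2
  have := pow_le_pow_left₀ (norm_nonneg _)
    (norm_conv_le (toH f : L2 d L) (grad (toH f : L2 d L)) t) 2
  rw [mul_pow, h1, h2] at this
  norm_num
  exact this

/-- A pointwise inequality between powers of `|f|` integrates to one between dissipations. -/
theorem dissip_absorb {A B b : ℝ} (hq : 1 ≤ q) (hr : 1 ≤ r)
    (h : ∀ s : ℝ, 0 ≤ s → A * s ^ 2 + B * s ^ (q - 1) + δ * s ^ (r - 1) ≤ b * s ^ (r - 1) + k)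
    (f : smoothFields d L) :
    A * dissip 3 f + B * dissip q f + δ * dissip r f ≤ b * dissip r f + k * dissip 1 f := by
  have i : ∀ {p : ℝ}, 1 ≤ p → Integrable fun t => ‖f.1 t‖ ^ (p - 1) * gradSq f t := fun hp =>
    integrable_of_continuous (continuous_dissip hp f)
  have i3 := i (p := 3) (by norm_num)
  have hint := integral_mono (((i3.const_mul A).add ((i hq).const_mul B)).add ((i hr).const_mul δ))
    (((i hr).const_mul b).add ((i le_rfl).const_mul k)) fun t => by
      have := mul_le_mul_of_nonneg_right (h ‖f.1 t‖ (norm_nonneg _)) (gradSq_nonneg f t)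
      simp only [Pi.add_apply, sub_self, Real.rpow_zero, one_mul]
      rw [show (3 : ℝ) - 1 = 2 by norm_num, Real.rpow_two]
      linarith
  rw [integral_add' ((i3.const_mul A).add ((i hq).const_mul B)) ((i hr).const_mul δ),
    integral_add' (i3.const_mul A) ((i hq).const_mul B),
    integral_add' ((i hr).const_mul b) ((i le_rfl).const_mul k), integral_const_mul,
    integral_const_mul, integral_const_mul, integral_const_mul, integral_const_mul] at hint
  exact hint

theorem integral_rpow_le_add {p p' : ℝ} (hp : 0 ≤ p) (hpp : p ≤ p') (f : smoothFields d L) :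
    ∫ t, ‖f.1 t‖ ^ p ≤ volume.real (Set.univ : Set (Torus d L)) + ∫ t, ‖f.1 t‖ ^ p' := by
  have i : ∀ {p : ℝ}, 0 ≤ p → Integrable fun t => ‖f.1 t‖ ^ p := fun hp =>
    integrable_of_continuous (continuous_norm_rpow f hp)
  have h := integral_mono (i hp) ((integrable_const (1 : ℝ)).add (i (hp.trans hpp))) fun t => by
    have := rpow_mul_rpow_le (norm_nonneg (f.1 t)) le_rfl hp le_rfl (b := 0) (c := p') (by linarith)
    rcases eq_or_lt_of_le (hp.trans hpp) with h0 | h0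
    · rw [← h0] at hpp ⊢
      rw [le_antisymm hpp hp]
      simp
    · rw [Real.rpow_zero, mul_one, Real.zero_rpow h0.ne', add_zero] at this
      exact this
  rw [integral_add' (integrable_const _) (i (hp.trans hpp)), integral_const, smul_eq_mul,
    mul_one] at h
  exact h

/-- For smooth solenoidal fields Au = -Δu without projection, so the damping is tested with the
Laplacian itself and can be integrated by parts. -/
theorem powerForm_stokes (p : ℝ) (f : solenoidal d L) :
    powerForm p (toH f) (stokes (toH f)) =
      -∫ t, inner ℝ (powField p (f.1.1 t)) ((lap f.1).1 t) := by
  rw [powerForm_eq, (toH_mem_DA f).2, ← integral_neg]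
  refine integral_congr_ae ?_
  filter_upwards [toH_ae f, toL2_ae (lap f.1), Lp.coeFn_neg (toL2 (lap f.1) : L2 d L)] with t h1 h2 h3
  rw [h1, h3, Pi.neg_apply, h2, inner_neg_right]

/-- The nonlinear terms tested with the Stokes operator. -/
theorem exists_nform_stokes_ge (hμ : 0 < μ) (hβ : 0 < β) (hq : 1 ≤ q) (hqr : q < r)
    (hr : 3 < r ∨ r = 3 ∧ 1 < 2 * β * μ) :
    ∃ δ : ℝ, 0 < δ ∧ ∃ k : ℝ, 0 < k ∧ ∀ (M : ℝ) (f : solenoidal d L),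
      ∫ t, ‖f.1.1 t‖ ^ (r + 1) ≤ M →
      δ * dissip r f.1 - μ / 2 * ‖stokes (toH f)‖ ^ 2 - k * dissip 1 f.1 -
        |γ| * √(volume.real (Set.univ : Set (Torus d L)) + M) * ‖stokes (toH f)‖ ≤
      nform β γ r q (toH f) (stokes (toH f)) := by
  -- Only half of μ‖Au‖² may be spent on the convective term, which costs 1/(2μ); the damping now
  -- offers the full β. For r = 3 the condition is again 2βμ > 1.
  obtain ⟨δ, hδ, k, hk, habs⟩ := exists_absorb (A := 1 / (2 * μ)) (B := |γ| * q) (b := β)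
    (q := q) (r := r) (by positivity) (by positivity) hβ hq hqr (by
      rcases hr with h | ⟨h, h'⟩
      · exact Or.inl h
      · refine Or.inr ⟨h, ?_⟩
        rw [div_lt_iff₀ (by positivity)]
        linarith)
  have hr3 : 3 ≤ r := by rcases hr with h | ⟨h, -⟩ <;> linarith
  refine ⟨δ, hδ, k, hk, fun M f hM => ?_⟩
  have h1 := dissip_absorb hq (by linarith) habs f.1
  have h2 := abs_trilinear_toH_le f (stokes (toH f))
  have h3 := sqrt_mul_sqrt_le (μ := μ / 2) (a := dissip 3 f.1) (b := ‖stokes (toH f)‖ ^ 2)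
    (by positivity) (dissip_nonneg _ _) (sq_nonneg _)
  rw [Real.sqrt_sq (norm_nonneg _), show 4 * (μ / 2) = 2 * μ by ring] at h3
  have h4 := (dissip_bounds (p := r) (by linarith) f.1).1
  rw [← powerForm_stokes] at h4
  have h4' := mul_le_mul_of_nonneg_left h4 hβ.le
  have h5 : -(|γ| * q * dissip q f.1) -
      |γ| * √(volume.real (Set.univ : Set (Torus d L)) + M) * ‖stokes (toH f)‖ ≤
      γ * powerForm q (toH f) (stokes (toH f)) := by
    have hD := dissip_nonneg q f.1
    -- For q > 2 integration by parts bounds the γ term by its dissipation. For q ≤ 2 that is not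
    -- available, but then 2q ≤ 4 ≤ r + 1 and the energy bound controls |u|^q in L².
    rcases lt_or_ge 2 q with h | h
    · have h6 := dissip_bounds h f.1
      rw [← powerForm_stokes] at h6
      have h7 : |γ * powerForm q (toH f) (stokes (toH f))| ≤ |γ| * (q * dissip q f.1) := by
        rw [abs_mul]
        exact mul_le_mul_of_nonneg_left (abs_le.2 ⟨by linarith [h6.1, mul_nonneg (by linarith : 0 ≤ q) hD], h6.2⟩)
          (abs_nonneg _)
      have h8 := neg_le_of_abs_le h7
      have : 0 ≤ |γ| * √(volume.real (Set.univ : Set (Torus d L)) + M) * ‖stokes (toH f)‖ := by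
        positivity
      linarith
    · have h6 := abs_powerForm_toH_le hq f (stokes (toH f))
      have h7 : √(∫ t, ‖f.1.1 t‖ ^ (2 * q)) ≤ √(volume.real (Set.univ : Set (Torus d L)) + M) :=
        Real.sqrt_le_sqrt ((integral_rpow_le_add (p' := r + 1) (by linarith) (by linarith) f.1).trans
          (by linarith))
      have h8 : |γ * powerForm q (toH f) (stokes (toH f))| ≤
          |γ| * √(volume.real (Set.univ : Set (Torus d L)) + M) * ‖stokes (toH f)‖ := by
        rw [abs_mul, mul_assoc]
        exact mul_le_mul_of_nonneg_left (h6.trans (mul_le_mul_of_nonneg_right h7 (norm_nonneg _)))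
          (abs_nonneg _)
      have h9 := neg_le_of_abs_le h8
      have : 0 ≤ |γ| * q * dissip q f.1 := by positivity
      linarith
  have h6 := neg_le_of_abs_le (h2.trans h3)
  rw [nform]
  linarith

theorem sqrt_le_mul_add {ε x : ℝ} (hε : 0 < ε) (hx : 0 ≤ x) : √x ≤ ε * x + 1 / (4 * ε) := by
  simpa using sqrt_mul_sqrt_le (b := x) hε zero_le_one hx

theorem sqrt_add_le {a b : ℝ} (ha : 0 ≤ a) (hb : 0 ≤ b) : √(a + b) ≤ √a + √b := by
  refine Real.sqrt_le_iff.2 ⟨by positivity, ?_⟩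
  have := mul_nonneg (Real.sqrt_nonneg a) (Real.sqrt_nonneg b)
  linarith [Real.sq_sqrt ha, Real.sq_sqrt hb]

theorem sqrt_cube (t : ℝ) (ht : 0 ≤ t) : √(t ^ 3) = t ^ (3 / 2 : ℝ) := by
  rw [Real.sqrt_eq_rpow, ← Real.rpow_natCast, ← Real.rpow_mul ht]
  norm_num

/-- The higher `L^p` norm is sublinear in the dissipation. -/
theorem exists_sqrt_integral_rpow_le (hd : d = 2 ∨ d = 3) (hr : 3 ≤ r) (M : ℝ) {ε : ℝ}
    (hε : 0 < ε) : ∃ C : ℝ, 0 ≤ C ∧ ∀ f : smoothFields d L, ∫ t, ‖f.1 t‖ ^ (r + 1) ≤ M →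
      √(∫ t, ‖f.1 t‖ ^ (2 * r)) ≤ ε * (dissip r f + dissip 1 f) + C := by
  -- With R = r this bounds the square root of ∫|u|^{2r} by the power 3/4 of the dissipation, which
  -- is sublinear.
  obtain ⟨C, hC, hS⟩ := exists_integral_norm_rpow_le (L := L) hd (R := r) (by linarith)
  set S := √(volume.real (Set.univ : Set (Torus d L)) + M) with hSdef
  have hS0 : 0 ≤ S := Real.sqrt_nonneg _
  set ε' := ε / (2 * (√(C * S) + 1)) with hε'
  -- The exponents are those of S + √X, whose square is linear in the dissipation X; ε' is chosen so
  -- that √(CS) · 2ε' ≤ ε.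
  obtain ⟨D, hD, hpow⟩ := exists_rpow_le_mul_rpow_add (a := 3 / 2) (b := 2) (ε := ε')
    (by norm_num) (by norm_num) (by positivity)
  refine ⟨√(C * S) * (ε' * (2 * S ^ 2) + D), by positivity, fun f hf => ?_⟩
  have hX0 : 0 ≤ dissip r f + dissip 1 f := add_nonneg (dissip_nonneg _ _) (dissip_nonneg _ _)
  set X := dissip r f + dissip 1 f with hX
  have h1 : √(∫ t, ‖f.1 t‖ ^ r) ≤ S := Real.sqrt_le_sqrt
    ((integral_rpow_le_add (p' := r + 1) (by linarith) (by linarith) f).trans (by linarith))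
  have h2 : √(dissip (r - 1) f) ≤ √X := by
    have := dissip_absorb (A := 0) (B := 1) (δ := 0) (b := 1) (k := 1) (q := r - 1) (r := r)
      (by linarith) (by linarith) (fun s hs => by
        have := rpow_mul_rpow_le (a := r - 1 - 1) (b := 0) (c := r - 1) hs le_rfl (by linarith)
          le_rfl (by linarith)
        rw [Real.rpow_zero, mul_one, Real.zero_rpow (by linarith : r - 1 ≠ 0), add_zero] at this
        linarith) f
    exact Real.sqrt_le_sqrt (by linarith)
  have h3 : ∫ t, ‖f.1 t‖ ^ (2 * r) ≤ C * S * (S + √X) ^ 3 :=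
    (hS f).trans (mul_le_mul (mul_le_mul_of_nonneg_left h1 hC.le)
      (pow_le_pow_left₀ (by positivity) (add_le_add h1 h2) 3) (by positivity) (by positivity))
  have h4 := hpow (S + √X) (by positivity)
  rw [Real.rpow_two] at h4
  have h5 : (S + √X) ^ 2 ≤ 2 * S ^ 2 + 2 * X := by
    have := Real.sq_sqrt hX0
    have := sq_nonneg (S - √X)
    linarith
  have hε'0 : 0 < ε' := by positivity
  have h6 := h4.trans (add_le_add_left (mul_le_mul_of_nonneg_left h5 hε'0.le) D)
  have h7 := mul_le_mul_of_nonneg_left h6 (Real.sqrt_nonneg (C * S))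
  have h8 : √(C * S) * (ε' * (2 * X)) ≤ ε * X := by
    have : √(C * S) * (2 * ε') ≤ ε := by
      rw [hε', ← mul_div_assoc, mul_div_mul_left _ _ two_ne_zero, ← mul_div_assoc,
        div_le_iff₀ (by positivity)]
      have := Real.sqrt_nonneg (C * S)
      linarith
    have := mul_le_mul_of_nonneg_right this hX0
    linarith
  calc √(∫ t, ‖f.1 t‖ ^ (2 * r)) ≤ √(C * S * (S + √X) ^ 3) := Real.sqrt_le_sqrt h3
    _ = √(C * S) * (S + √X) ^ (3 / 2 : ℝ) := by
      rw [Real.sqrt_mul (by positivity), sqrt_cube _ (by positivity)]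
    _ ≤ _ := by linarith

/-- The nonlinear terms tested with an arbitrary element of `ℍ`. -/
theorem exists_abs_nform_le (hd : d = 2 ∨ d = 3) (hr : 3 ≤ r) (hq : 1 ≤ q) (hqr : q < r) (M : ℝ)
    {ε : ℝ} (hε : 0 < ε) : ∃ C : ℝ, 0 ≤ C ∧ ∀ (f : solenoidal d L) (w : H d L),
      ∫ t, ‖f.1.1 t‖ ^ (r + 1) ≤ M →
      |nform β γ r q (toH f) w| ≤ (ε * (dissip r f.1 + dissip 1 f.1) + C) * ‖w‖ := by
  -- Half of ε is reserved for the two power terms together, the other half for the convective term.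
  obtain ⟨C, hC, hS⟩ := exists_sqrt_integral_rpow_le (L := L) hd hr M (ε := ε / (2 * (|β| + |γ| + 1)))
    (by positivity)
  set m := volume.real (Set.univ : Set (Torus d L)) with hm
  refine ⟨1 / (4 * (ε / 2)) + (|β| + |γ|) * C + |γ| * √m, by positivity, fun f w hf => ?_⟩
  have hX0 : 0 ≤ dissip r f.1 + dissip 1 f.1 := add_nonneg (dissip_nonneg _ _) (dissip_nonneg _ _)
  have h1 : dissip 3 f.1 ≤ dissip r f.1 + dissip 1 f.1 := by
    have := dissip_absorb (A := 1) (B := 0) (δ := 0) (b := 1) (k := 1) (q := q) (r := r)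
      hq (by linarith) (fun s hs => by
        have := rpow_mul_rpow_le (a := 2) (b := 0) (c := r - 1) hs le_rfl (by linarith)
          le_rfl (by linarith)
        rw [Real.rpow_zero, mul_one, Real.zero_rpow (by linarith : r - 1 ≠ 0), add_zero,
          Real.rpow_two] at this
        linarith) f.1
    linarith
  set X := dissip r f.1 + dissip 1 f.1 with hX
  have h2 := (Real.sqrt_le_sqrt h1).trans (sqrt_le_mul_add (ε := ε / 2) (by positivity) hX0)
  have h3 := hS f.1 hf
  have h4 : √(∫ t, ‖f.1.1 t‖ ^ (2 * q)) ≤ √m + √(∫ t, ‖f.1.1 t‖ ^ (2 * r)) :=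
    (Real.sqrt_le_sqrt (integral_rpow_le_add (p' := 2 * r) (by linarith) (by linarith) f.1)).trans
      (sqrt_add_le measureReal_nonneg (integral_nonneg fun t => by positivity))
  have h5 : |nform β γ r q (toH f) w| ≤ (√(dissip 3 f.1) + |β| * √(∫ t, ‖f.1.1 t‖ ^ (2 * r)) +
      |γ| * √(∫ t, ‖f.1.1 t‖ ^ (2 * q))) * ‖w‖ := by
    rw [nform]
    refine (abs_add_le _ _).trans ((add_le_add_left (abs_add_le _ _) _).trans ?_)
    rw [abs_mul, abs_mul]
    have a1 := abs_trilinear_toH_le f w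
    have a2 := mul_le_mul_of_nonneg_left (abs_powerForm_toH_le (by linarith : 1 ≤ r) f w) (abs_nonneg β)
    have a3 := mul_le_mul_of_nonneg_left (abs_powerForm_toH_le hq f w) (abs_nonneg γ)
    linarith
  refine h5.trans (mul_le_mul_of_nonneg_right ?_ (norm_nonneg _))
  have h6 : (|β| + |γ|) * (ε / (2 * (|β| + |γ| + 1)) * X) ≤ ε / 2 * X := by
    have : (|β| + |γ|) * (ε / (2 * (|β| + |γ| + 1))) ≤ ε / 2 := by
      rw [← mul_div_assoc, div_le_div_iff₀ (by positivity) two_pos]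
      nlinarith [abs_nonneg β, abs_nonneg γ]
    have := mul_le_mul_of_nonneg_right this hX0
    linarith
  have h7 := mul_le_mul_of_nonneg_left h3 (abs_nonneg β)
  have h8 := mul_le_mul_of_nonneg_left (h4.trans (add_le_add_right h3 _)) (abs_nonneg γ)
  linarith

end StokesEstimate

/-! ### The estimate in D(A) and the passage to the limit. -/

section Limit

open Filter

variable {d : ℕ} {L : ℝ} [Fact (0 < L)] {μ β γ r q k δ c l : ℝ}

theorem le_of_sq_le_mul_add {a M N : ℝ} (hM : 0 ≤ M) (hN : 0 ≤ N) (h : a ^ 2 ≤ M * a + N) :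
    a ≤ M + N + 1 := by
  by_contra! hlt
  have h1 : 1 < a := by linarith
  have h2 : (M + N + 1) * a ≤ a * a := mul_le_mul_of_nonneg_right hlt.le (by linarith)
  have h3 : N * 1 ≤ N * a := mul_le_mul_of_nonneg_left h1.le hN
  linarith

/-- The algebra of the D(A) estimate, with u the truncation of y + yₑ. Here a, a', e, e' stand for
the norms of Ay, Au, Ayₑ and of A applied to the truncated yₑ; X and Y are the dissipations of u
with exponents r and 1; N₁ and N₂ are the nonlinear terms tested with Au and with A of the truncated
yₑ; G bounds ‖u‖. The weight δ / (e + 1) makes the X-terms cancel, and Y ≤ a' G is only linear in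
a'. -/
theorem stokes_arith {μ δ k e E D F G a a' e' X Y N₁ N₂ : ℝ} (hμ : 0 < μ) (hδ : 0 ≤ δ)
    (hk : 0 ≤ k) (he : 0 ≤ e) (hE : 0 ≤ E) (hD : 0 ≤ D) (hF : 0 ≤ F) (hG : 0 ≤ G)
    (ha' : 0 ≤ a') (hX : 0 ≤ X) (hY : 0 ≤ Y) (h : μ * a ^ 2 + (N₁ - N₂) ≤ F * a)
    (h1 : δ * X - μ / 2 * a' ^ 2 - k * Y - E * a' ≤ N₁)
    (h2 : N₂ ≤ (δ / (e + 1) * (X + Y) + D) * e') (h3 : Y ≤ a' * G) (h4 : a' ≤ a + e)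
    (h5 : e' ≤ e) : a ≤ 2 / μ * (μ * e + (k + δ) * G + E + F) +
      2 / μ * (μ / 2 * e ^ 2 + (k + δ) * G * e + E * e + D * e) + 1 := by
  have h12 : (δ / (e + 1) * (X + Y) + D) * e' ≤ δ * (X + Y) + D * e := by
    have : δ / (e + 1) * e ≤ δ := by
      rw [div_mul_eq_mul_div, div_le_iff₀ (by positivity)]; linarith
    have h13 := mul_le_mul_of_nonneg_right this (add_nonneg hX hY)
    have h14 := mul_le_mul_of_nonneg_left h5
      (by positivity : 0 ≤ δ / (e + 1) * (X + Y) + D)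
    linarith
  have h14 : Y ≤ (a + e) * G := h3.trans (mul_le_mul_of_nonneg_right h4 hG)
  have h15 : μ / 2 * a' ^ 2 ≤ μ / 2 * (a + e) ^ 2 :=
    mul_le_mul_of_nonneg_left (pow_le_pow_left₀ ha' h4 2) (by positivity)
  have h16 : E * a' ≤ E * (a + e) := mul_le_mul_of_nonneg_left h4 hE
  have h17 : (k + δ) * Y ≤ (k + δ) * ((a + e) * G) := mul_le_mul_of_nonneg_left h14 (by positivity)
  have h18 : μ / 2 * a ^ 2 ≤ (μ * e + (k + δ) * G + E + F) * a +
      (μ / 2 * e ^ 2 + (k + δ) * G * e + E * e + D * e) := by linarith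
  refine le_of_sq_le_mul_add (by positivity) (by positivity) ?_
  have h19 := mul_le_mul_of_nonneg_left h18 (by positivity : 0 ≤ 2 / μ)
  have h20 : 2 / μ * (μ / 2 * a ^ 2) = a ^ 2 := by field_simp
  rw [h20] at h19
  linarith

/-- The second a priori estimate, in `D(A)`. -/
theorem exists_stokes_bound (hd : d = 2 ∨ d = 3) (hμ : 0 < μ) (hβ : 0 < β) (hq : 1 ≤ q)
    (hqr : q < r) (hr : 3 < r ∨ r = 3 ∧ 1 < 2 * β * μ) (hc : 0 ≤ c)
    {K : Set (H d L)} (hK : IsAdmissible K) {ye : H d L} (hye : ye ∈ DA d L) (f : H d L) (B : ℝ) :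
    ∃ C : ℝ, ∀ (l : ℝ) (n : ℕ) (y : H d L), 0 < l → IsApprox μ β γ r q c l ye K f n y →
      ‖y‖ ≤ B → ∫ t, ‖(PH n (y + ye) : L2 d L) t‖ ^ (r + 1) ≤ B → ‖stokes y‖ ≤ C := by
  have hr3 : 3 ≤ r := by rcases hr with h | ⟨h, -⟩ <;> linarith
  have hd3 : d ≤ 3 := by omega
  obtain ⟨δ, hδ, k, hk, hA⟩ := exists_nform_stokes_ge (d := d) (L := L) (γ := γ) hμ hβ hq hqr hr
  set e := ‖stokes ye‖ with he
  have he0 : 0 ≤ e := norm_nonneg _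
  obtain ⟨D, hD, hB⟩ := exists_abs_nform_le (d := d) (L := L) (β := β) (γ := γ) hd hr3 hq hqr B
    (ε := δ / (e + 1)) (by positivity)
  set E := |γ| * √(volume.real (Set.univ : Set (Torus d L)) + B) with hE
  have hE0 : 0 ≤ E := by positivity
  have hF0 := norm_nonneg f
  set G := |B| + ‖ye‖ with hG
  have hG0 : 0 ≤ G := by positivity
  refine ⟨2 / μ * (μ * e + (k + δ) * G + E + ‖f‖) +
    2 / μ * (μ / 2 * e ^ 2 + (k + δ) * G * e + E * e + D * e) + 1,
    fun l n y hl hy hyB hint => ?_⟩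
  have hyD : y ∈ DA d L := by rw [← hy.1]; exact PH_mem_DA _ _
  have hu : PH n (y + ye) = y + PH n ye := by rw [map_add, hy.1]
  -- Ay is an admissible test function because A commutes with the truncation. The penalty then
  -- contributes a nonnegative term, by the resolvent condition on K.
  have h1 := hy.2 (stokes y) (by rw [← hy.1]; exact PH_stokes_PH n y)
  rw [real_inner_self_eq_norm_sq] at h1
  have h2 := hK.inner_sub_metricProj_stokes_nonneg hyD
  have h3 : 0 ≤ inner ℝ y (stokes y) := by
    rw [real_inner_comm, inner_stokes hyD hyD.1]; exact stokesForm_self_nonneg y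
  have h4 := real_inner_le_norm f (stokes y)
  have hsu : stokes (PH n (y + ye)) = stokes y + stokes (PH n ye) := by
    rw [hu]; exact (add_mem_DA hyD (PH_mem_DA n ye)).2
  have hint' : ∫ t, ‖(truncS n (y + ye)).1.1 t‖ ^ (r + 1) ≤ B := by
    refine le_of_eq_of_le (integral_congr_ae ?_) hint
    filter_upwards [toH_ae (truncS n (y + ye))] with t ht
    rw [PH_apply, ht]
  have h5 := hA B (truncS n (y + ye)) hint'
  have h6 := hB (truncS n (y + ye)) (stokes (PH n ye)) hint'
  have h7 : dissip 1 (truncS n (y + ye)).1 ≤ ‖stokes (PH n (y + ye))‖ * G := by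
    rw [← stokesForm_toH, ← PH_apply]
    refine (stokesForm_self_le (PH_mem_DA _ _)).trans
      (mul_le_mul_of_nonneg_left ?_ (norm_nonneg _))
    refine (norm_PH_le _ _).trans ((norm_add_le _ _).trans (add_le_add_left ?_ _))
    exact hyB.trans (le_abs_self B)
  rw [← PH_apply] at h5 h6
  -- The nonlinearity is evaluated at u, the truncation of y + yₑ, but tested with Ay. Only the
  -- pairing with Au has a sign, hence the splitting.
  have hlin : nform β γ r q (PH n (y + ye)) (stokes y) =
      nform β γ r q (PH n (y + ye)) (stokes (PH n (y + ye))) -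
        nform β γ r q (PH n (y + ye)) (stokes (PH n ye)) := by
    have hD' := PH_mem_DA n (y + ye)
    rw [← inner_nonlin hd3 (by linarith) hq hD', ← inner_nonlin hd3 (by linarith) hq hD',
      ← inner_nonlin hd3 (by linarith) hq hD', ← inner_sub_right, hsu, add_sub_cancel_right]
  have h8 : ‖stokes (PH n (y + ye))‖ ≤ ‖stokes y‖ + e := by
    rw [hsu]
    exact (norm_add_le _ _).trans (add_le_add_right (norm_stokes_PH_le hye n) _)
  have h9 := norm_stokes_PH_le hye n
  have hdr := dissip_nonneg r (truncS n (y + ye)).1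
  have hd1 := dissip_nonneg 1 (truncS n (y + ye)).1
  rw [hlin] at h1
  have h10 := mul_nonneg (inv_nonneg.2 hl.le) h2
  have h11 := mul_nonneg hc h3
  exact stokes_arith hμ hδ.le hk.le he0 hE0 hD hF0 hG0 (norm_nonneg _) hdr hd1
    (by linarith) h5 ((le_abs_self _).trans h6) h7 h8 h9

/-- Interpolation, ‖∇v‖² ≤ ‖Av‖ ‖v‖: convergence in ℍ with bounded Stokes norms gives convergence of
the gradients. -/
theorem tendsto_stokesForm_sub {M : ℝ} {un : ℕ → H d L} {u : H d L} (hun : ∀ n, un n ∈ DA d L)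
    (hu : u ∈ DA d L) (hM : ∀ n, ‖stokes (un n)‖ ≤ M) (h : Tendsto un atTop (𝓝 u)) :
    Tendsto (fun n => stokesForm (un n - u) (un n - u)) atTop (𝓝 0) := by
  have h1 : Tendsto (fun n => (M + ‖stokes u‖) * ‖un n - u‖) atTop (𝓝 0) := by
    simpa using (tendsto_iff_norm_sub_tendsto_zero.1 h).const_mul (M + ‖stokes u‖)
  refine squeeze_zero (fun n => stokesForm_self_nonneg _) (fun n => ?_) h1
  have h2 := sub_mem_DA (hun n) hu
  refine (stokesForm_self_le h2.1).trans (mul_le_mul_of_nonneg_right ?_ (norm_nonneg _))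
  rw [h2.2]
  exact (norm_sub_le _ _).trans (by linarith [hM n])

theorem tendsto_grad {un : ℕ → H d L} {u : H d L} (hun : ∀ n, un n ∈ V d L) (hu : u ∈ V d L)
    (h : Tendsto (fun n => stokesForm (un n - u) (un n - u)) atTop (𝓝 0)) (i : Fin d) :
    Tendsto (fun n => grad (un n : L2 d L) i) atTop (𝓝 (grad (u : L2 d L) i)) := by
  rw [tendsto_iff_norm_sub_tendsto_zero]
  have h1 : Tendsto (fun n => √(stokesForm (un n - u) (un n - u))) atTop (𝓝 0) := by
    simpa using h.sqrt
  refine squeeze_zero (fun n => norm_nonneg _) (fun n => ?_) h1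
  refine Real.le_sqrt_of_sq_le ?_
  rw [stokesForm_self, grad_sub (hun n) hu]
  exact Finset.single_le_sum (f := fun i => ‖(grad (un n : L2 d L) - grad (u : L2 d L)) i‖ ^ 2)
    (fun _ _ => by positivity) (Finset.mem_univ i)

theorem tendsto_stokesForm {un wn : ℕ → H d L} {u w : H d L} (hun : ∀ n, un n ∈ V d L)
    (hu : u ∈ V d L) (hwn : ∀ n, wn n ∈ V d L) (hw : w ∈ V d L)
    (h : Tendsto (fun n => stokesForm (un n - u) (un n - u)) atTop (𝓝 0))
    (h' : Tendsto (fun n => stokesForm (wn n - w) (wn n - w)) atTop (𝓝 0)) :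
    Tendsto (fun n => stokesForm (un n) (wn n)) atTop (𝓝 (stokesForm u w)) :=
  tendsto_finsetSum _ fun i _ => (tendsto_grad hun hu h i).inner (tendsto_grad hwn hw h' i)

/-- The penalisation is harmless on truncations of elements of `K ∩ D(A)`. -/
theorem exists_penalty_le {K : Set (H d L)} (hK : IsAdmissible K) {x : H d L} (hx : x ∈ DA d L)
    (hxK : x ∈ K) : ∃ C : ℝ, ∀ (n : ℕ) (y : H d L), (1 / ((n : ℝ) + 1))⁻¹ *
      inner ℝ (y - metricProj K y) (PH n x - y) ≤ C * (1 / ((n : ℝ) + 1)) := by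
  have hL : 0 < L := Fact.out
  set κ := (2 * Real.pi / L) ^ 2 with hκ
  have hκ0 : 0 < κ := by have := Real.pi_pos; positivity
  refine ⟨(‖stokes x‖ / κ) ^ 2, fun n y => ?_⟩
  -- The pairing is at most half the squared distance from PH n x to K, hence at most ‖x - PH n x‖².
  -- For x in D(A) this is O((n+1)⁻²), which beats the penalty factor n + 1.
  have h1 := inner_sub_metricProj_le_half hK.isClosed hK.convex hK.nonempty y (PH n x)
  have h2 := norm_sub_metricProj_le hK.isClosed hK.convex (PH n x) hxK
  rw [norm_sub_rev (PH n x) x] at h2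
  have h3 := norm_sub_PH_le hx n
  have hn : (1 : ℝ) ≤ (n : ℝ) + 1 := by have := Nat.cast_nonneg (α := ℝ) n; linarith
  have h4 : ‖x - PH n x‖ ≤ ‖stokes x‖ / κ * (1 / ((n : ℝ) + 1)) := by
    rw [div_mul_div_comm, mul_one, le_div_iff₀ (by positivity)]
    refine le_trans ?_ h3
    have h5 : κ * ((n : ℝ) + 1) ≤ κ * ((n : ℝ) + 1) ^ 2 :=
      mul_le_mul_of_nonneg_left (by nlinarith) hκ0.le
    have := mul_le_mul_of_nonneg_right h5 (norm_nonneg (x - PH n x))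
    linarith
  have h5 := pow_le_pow_left₀ (norm_nonneg _) (h2.trans h4) 2
  have h6 : inner ℝ (y - metricProj K y) (PH n x - y) ≤
      (‖stokes x‖ / κ * (1 / ((n : ℝ) + 1))) ^ 2 := by
    have := sq_nonneg ‖y - metricProj K y‖
    have := sq_nonneg ‖PH n x - metricProj K (PH n x)‖
    linarith
  refine (mul_le_mul_of_nonneg_left h6 (by positivity)).trans (le_of_eq ?_)
  field_simp

/-- The variational form of f ∈ μAy + N(y + yₑ) + cy + ∂I_K(y), N being the nonlinear part; the
constant term N(yₑ) is left to the right-hand side f. It is used with the given K for the range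
condition, and with K = ℍ for regularity. -/
theorem exists_variational (hd : d = 2 ∨ d = 3) (hμ : 0 < μ) (hβ : 0 < β) (hq : 1 ≤ q)
    (hqr : q < r) (hr : 3 < r ∨ r = 3 ∧ 1 < 2 * β * μ) (hδ : 0 < δ) (hk : 0 ≤ k) (hkc : k < c)
    (hM : NonlinMonotone d L μ β γ r q k δ) {K : Set (H d L)} (hK : IsAdmissible K) {ye : H d L}
    (hye : ye ∈ DA d L) (f : H d L) :
    ∃ y ∈ DA d L, y ∈ K ∧ ∀ x ∈ K,
      0 ≤ inner ℝ (μ • stokes y + nonlin β γ r q (y + ye) + c • y - f) (x - y) := by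
  have hr3 : 3 ≤ r := by rcases hr with h | ⟨h, -⟩ <;> linarith
  have hd3 : d ≤ 3 := by omega
  have hr1 : 1 ≤ r := by linarith
  obtain ⟨B, hB, h1⟩ := exists_approx_bound (c := c) hd3 hr3 hq hδ hkc hM hK hye f
  obtain ⟨C, h2⟩ := exists_stokes_bound (γ := γ) hd hμ hβ hq hqr hr (hk.trans hkc.le) hK hye f B
  have hl : ∀ n : ℕ, 0 < 1 / ((n : ℝ) + 1) := fun n => by positivity
  choose yn hyn using fun n : ℕ =>
    exists_isApprox hd3 hr1 hq hμ.le hδ.le hk hkc (hl n) hM hK ye f n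
  have hynD : ∀ n, yn n ∈ DA d L := fun n => by rw [← (hyn n).1]; exact PH_mem_DA _ _
  have hb1 := fun n => h1 _ n (yn n) (hl n) (hyn n)
  have hb2 := fun n => h2 _ n (yn n) (hl n) (hyn n) (hb1 n).1 (hb1 n).2.2
  have hC0 : 0 ≤ C := (norm_nonneg _).trans (hb2 0)
  obtain ⟨y, hyD, φ, hφ, hlim⟩ := exists_subseq_of_stokes_le (M := B + C) hynD
    (fun n => (hb1 n).1.trans (by linarith)) (fun n => (hb2 n).trans (by linarith))
  have hφ0 : Tendsto (fun n => 1 / ((φ n : ℝ) + 1)) atTop (𝓝 0) :=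
    tendsto_one_div_add_atTop_nhds_zero_nat.comp hφ.tendsto_atTop
  -- The squared distances to K are bounded by a multiple of the penalty parameter, so y is also the
  -- limit of the projections.
  have hyK : y ∈ K := by
    have h3 : Tendsto (fun n => ‖yn (φ n) - metricProj K (yn (φ n))‖) atTop (𝓝 0) := by
      have h4 : Tendsto (fun n => √(B * (1 / ((φ n : ℝ) + 1)))) atTop (𝓝 0) := by
        simpa using (hφ0.const_mul B).sqrt
      exact squeeze_zero (fun n => norm_nonneg _)
        (fun n => Real.le_sqrt_of_sq_le (hb1 (φ n)).2.1) h4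
    have h4 := hlim.sub (tendsto_zero_iff_norm_tendsto_zero.2 h3)
    simp only [Function.comp_apply, sub_sub_cancel, sub_zero] at h4
    exact hK.isClosed.mem_of_tendsto h4
      (Eventually.of_forall fun n => metricProj_mem hK.isClosed hK.convex hK.nonempty _)
  have huD := add_mem_DA hyD hye
  have key : ∀ x ∈ K, x ∈ DA d L →
      0 ≤ inner ℝ (μ • stokes y + nonlin β γ r q (y + ye) + c • y - f) (x - y) := by
    intro x hxK hxD
    obtain ⟨P, hP⟩ := exists_penalty_le hK hxD hxK
    set un : ℕ → H d L := fun n => PH (φ n) (yn (φ n) + ye) with hun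
    set wn : ℕ → H d L := fun n => PH (φ n) x - yn (φ n) with hwn
    have hunD : ∀ n, un n ∈ DA d L := fun n => PH_mem_DA _ _
    have hwnD : ∀ n, wn n ∈ DA d L ∧ stokes (wn n) = stokes (PH (φ n) x) - stokes (yn (φ n)) :=
      fun n => sub_mem_DA (PH_mem_DA _ _) (hynD _)
    have hun_lim : Tendsto un atTop (𝓝 (y + ye)) := by
      have h3 := hlim.add ((tendsto_PH ye).comp hφ.tendsto_atTop)
      refine h3.congr fun n => ?_
      simp only [hun, Function.comp_apply, map_add, (hyn (φ n)).1]
    have hwn_lim : Tendsto wn atTop (𝓝 (x - y)) :=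
      ((tendsto_PH x).comp hφ.tendsto_atTop).sub hlim
    have hun_st : ∀ n, ‖stokes (un n)‖ ≤ C + ‖stokes ye‖ := fun n => by
      have h3 := add_mem_DA (hynD (φ n)) hye
      refine (norm_stokes_PH_le h3.1 _).trans ?_
      rw [h3.2]
      exact (norm_add_le _ _).trans (by linarith [hb2 (φ n)])
    have hwn_st : ∀ n, ‖stokes (wn n)‖ ≤ ‖stokes x‖ + C := fun n => by
      rw [(hwnD n).2]
      exact (norm_sub_le _ _).trans (add_le_add (norm_stokes_PH_le hxD _) (hb2 _))
    have hun_n : ∀ n, ‖un n‖ ≤ B + ‖ye‖ := fun n =>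
      (norm_PH_le _ _).trans ((norm_add_le _ _).trans (by linarith [(hb1 (φ n)).1]))
    have hwn_n : ∀ n, ‖wn n‖ ≤ ‖x‖ + B := fun n =>
      (norm_sub_le _ _).trans (add_le_add (norm_PH_le _ _) (hb1 _).1)
    have hxyD := sub_mem_DA hxD hyD
    have n1 := norm_nonneg x
    have n2 := norm_nonneg ye
    have n3 := norm_nonneg (stokes x)
    have n4 := norm_nonneg (stokes ye)
    obtain ⟨R₁, hR₁, hs⟩ := exists_sup_bound (d := d) (L := L) hd3
      (B + C + ‖ye‖ + ‖x‖ + ‖stokes x‖ + ‖stokes ye‖)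
    obtain ⟨R₂, hR₂, hs'⟩ := exists_ae_bound hd3 huD.1
    have l1 := tendsto_stokesForm_sub hunD huD.1 hun_st hun_lim
    have l2 := tendsto_stokesForm_sub (fun n => (hwnD n).1) hxyD.1 hwn_st hwn_lim
    have l3 := tendsto_stokesForm_sub (fun n => hynD (φ n)) hyD (fun n => hb2 (φ n)) hlim
    have l4 := tendsto_nform (β := β) (γ := γ) (R := max R₁ R₂) hr1 hq huD.1.1 (fun n => (hunD n).1)
      (hs'.mono fun t ht => ht.trans (le_max_right _ _))
      (fun n => ((hs (un n) (hunD n) ((hun_n n).trans (by linarith))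
        ((hun_st n).trans (by linarith))).1).mono fun t ht => ht.trans (le_max_left _ _))
      (fun n => ((hs (wn n) (hwnD n).1 ((hwn_n n).trans (by linarith))
        ((hwn_st n).trans (by linarith))).1).mono fun t ht => ht.trans (le_max_left _ _))
      hun_lim hwn_lim l1
    have l5 := tendsto_stokesForm (fun n => (hynD (φ n)).1) hyD.1 (fun n => (hwnD n).1.1)
      hxyD.1.1 l3 l2
    have l6 : Tendsto (fun n => inner ℝ (yn (φ n)) (wn n)) atTop (𝓝 (inner ℝ y (x - y))) :=
      hlim.inner hwn_lim
    have l7 : Tendsto (fun n => inner ℝ f (wn n)) atTop (𝓝 (inner ℝ f (x - y))) :=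
      tendsto_const_nhds.inner hwn_lim
    have l8 := ((((l5.const_mul μ).add l4).add (l6.const_mul c)).sub l7).add (hφ0.const_mul P)
    -- The approximate equation tested with PH x - yn equates these terms to minus the penalty,
    -- which is at least -P / (φ n + 1).
    have h3 := ge_of_tendsto' l8 (b := 0) fun n => by
      have h4 := (hyn (φ n)).2 (wn n) (by simp only [hwn, map_sub, PH_PH, (hyn (φ n)).1])
      rw [inner_stokes (hynD (φ n)) (hwnD n).1.1] at h4
      have h5 := hP (φ n) (yn (φ n))
      simp only [hun]
      linarith
    rw [inner_sub_left, inner_add_left, inner_add_left, inner_smul_leftH, inner_smul_leftH,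
      inner_nonlin hd3 hr1 hq huD.1, inner_stokes hyD hxyD.1.1]
    linarith
  refine ⟨y, hyD, hyK, fun x hx => ?_⟩
  -- So far x had to lie in D(A); resolvents of x stay in K, lie in D(A) and converge to x.
  have hn : ∀ n : ℕ, (0 : ℝ) < 1 / (n + 1) := fun n => by positivity
  have h3 : Tendsto (fun n : ℕ => inner ℝ (μ • stokes y + nonlin β γ r q (y + ye) + c • y - f)
      (resolv (1 / (n + 1)) x - y)) atTop
      (𝓝 (inner ℝ (μ • stokes y + nonlin β γ r q (y + ye) + c • y - f) (x - y))) :=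
    tendsto_const_nhds.inner ((tendsto_resolv x).sub_const y)
  exact ge_of_tendsto' h3 fun n => key _ (hK.resolv_mem (hn n) hx) (resolv_spec (hn n) x).1

end Limit

/-! ### The operator 𝔊: its domain, monotonicity and range. -/

section Operator

variable {d : ℕ} {L : ℝ} [Fact (0 < L)] {μ α β γ r q κ k δ c : ℝ}

theorem stokesForm_sub_left {u v : H d L} (hu : u ∈ V d L) (hv : v ∈ V d L) (w : H d L) :
    stokesForm (u - v) w = stokesForm u w - stokesForm v w := by
  simp only [stokesForm, grad_sub hu hv, Pi.sub_apply, inner_sub_left, Finset.sum_sub_distrib]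

theorem mem_opG_iff {ye : H d L} {K : Set (H d L)} {y : H d L} {F : VL d L (r + 1) → ℝ} :
    F ∈ opG μ α β γ r q κ ye K y ↔ y ∈ VL d L (r + 1) ∧
      ∃ ξ ∈ subdifferential (indicatorFn K) y, ∀ v : VL d L (r + 1), F v =
        μ * stokesForm y v + (nform β γ r q (y + ye) v - nform β γ r q ye v) +
          (α + κ) * inner ℝ y (v : H d L) + inner ℝ ξ (v : H d L) := by
  have e : ∀ (ξ : H d L) (v : VL d L (r + 1)), μ * stokesForm y v + convTilde ye y v +
      α * inner ℝ y (v : H d L) + β * powerTilde r ye y v + γ * powerTilde q ye y v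
      + inner ℝ ξ (v : H d L) + κ * inner ℝ y (v : H d L) =
      μ * stokesForm y v + (nform β γ r q (y + ye) v - nform β γ r q ye v) +
          (α + κ) * inner ℝ y (v : H d L) + inner ℝ ξ (v : H d L) := by
    intro ξ v
    rw [convTilde, powerTilde, powerTilde, nform, nform]
    ring
  simp only [opG, Set.mem_ofPred_eq, funext_iff, e]

theorem subdifferential_indicatorFn_nonempty_iff {K : Set (H d L)} (hK : K.Nonempty) (y : H d L) :
    (subdifferential (indicatorFn K) y).Nonempty ↔ y ∈ K := by
  constructor
  · rintro ⟨ξ, hξ⟩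
    exact ((mem_subdifferential_indicatorFn hK).1 hξ).1
  · exact fun hy => ⟨0, (mem_subdifferential_indicatorFn hK).2 ⟨hy, fun z _ => by simp⟩⟩

variable (μ β γ r q c) in
/-- The single-valued part `μ A y + B̃ y + c y + β C̃₁ y + γ C̃₂ y` of the operator. -/
def regularPart (ye y : H d L) : H d L :=
  μ • stokes y + (nonlin β γ r q (y + ye) - nonlin β γ r q ye) + c • y

theorem inner_regularPart (hd : d ≤ 3) (hr : 1 ≤ r) (hq : 1 ≤ q) {ye y v : H d L}
    (hye : ye ∈ DA d L) (hy : y ∈ DA d L) (hv : v ∈ V d L) :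
    inner ℝ (regularPart μ β γ r q c ye y) v = μ * stokesForm y v +
      (nform β γ r q (y + ye) v - nform β γ r q ye v) + c * inner ℝ y v := by
  rw [regularPart, inner_add_left, inner_add_left, inner_sub_left, inner_smul_leftH,
    inner_smul_leftH, inner_nonlin hd hr hq (add_mem_DA hy hye).1, inner_nonlin hd hr hq hye,
    inner_stokes hy hv]

/-- Both fields are shifted by yₑ, which leaves their difference unchanged, and the constant terms
at yₑ cancel. -/
theorem NonlinMonotone.le (hM : NonlinMonotone d L μ β γ r q k δ) (hδ : 0 ≤ δ) (hr : 0 ≤ r)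
    {ye y z : H d L} (hye : ye ∈ VL d L (r + 1)) (hy : y ∈ VL d L (r + 1))
    (hz : z ∈ VL d L (r + 1)) :
    (c - k) * ‖y - z‖ ^ 2 ≤
      (μ * stokesForm y (y - z) + (nform β γ r q (y + ye) (y - z) - nform β γ r q ye (y - z)) +
        c * inner ℝ y (y - z)) -
      (μ * stokesForm z (y - z) + (nform β γ r q (z + ye) (y - z) - nform β γ r q ye (y - z)) +
        c * inner ℝ z (y - z)) := by
  have h := hM.nonneg hδ (add_mem_VL (by linarith) hy hye) (add_mem_VL (by linarith) hz hye)
  rw [add_sub_add_right_eq_sub, stokesForm_sub_left hy.1 hz.1] at h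
  have h2 : inner ℝ y (y - z) - inner ℝ z (y - z) = ‖y - z‖ ^ 2 := by
    rw [← inner_sub_left, real_inner_self_eq_norm_sq]
  have h3 : c * inner ℝ y (y - z) - c * inner ℝ z (y - z) = c * ‖y - z‖ ^ 2 := by
    rw [← mul_sub, h2]
  linarith

/-- Regularity by uniqueness: the strong solution of an unconstrained problem is compared with y in
the weak formulation on 𝕍 ∩ L̃^{r+1}, where the quantitative monotonicity holds. -/
theorem domG_eq (hd : d = 2 ∨ d = 3) (hμ : 0 < μ) (hβ : 0 < β) (hq : 1 ≤ q)
    (hqr : q < r) (hr : 3 < r ∨ r = 3 ∧ 1 < 2 * β * μ) (hδ : 0 < δ) (hk : 0 ≤ k)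
    (hkc : k < α + κ) (hM : NonlinMonotone d L μ β γ r q k δ) {K : Set (H d L)}
    (hK : IsAdmissible K) {ye : H d L} (hye : ye ∈ DA d L) :
    domG μ α β γ r q κ ye K = DA d L ∩ K := by
  have hr3 : 3 ≤ r := by rcases hr with h | ⟨h, -⟩ <;> linarith
  have hd3 : d ≤ 3 := by omega
  have hr1 : 1 ≤ r := by linarith
  ext y
  constructor
  · rintro ⟨⟨F, hF⟩, hsub⟩
    obtain ⟨hyV, ξ, hξ, -⟩ := mem_opG_iff.1 hF
    have hyK := ((mem_subdifferential_indicatorFn hK.nonempty).1 hξ).1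
    -- Since 0 belongs to the normal cone at y, the single-valued part is itself a value of 𝔊 at y.
    -- All values are in ℍ by definition of the domain, hence so is this one.
    obtain ⟨h, hh⟩ := hsub (mem_opG_iff.2 ⟨hyV, 0,
      (mem_subdifferential_indicatorFn hK.nonempty).2 ⟨hyK, fun z _ => by simp⟩, fun v => rfl⟩)
    -- Without constraint the variational inequality is an equation; the nonlinear term at yₑ is
    -- added to h because `exists_variational` does not subtract it.
    obtain ⟨z, hzD, -, hz⟩ := exists_variational hd hμ hβ hq hqr hr hδ hk hkc hM isAdmissible_univ
      hye (h + nonlin β γ r q ye)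
    have hzV := mem_VL_of_mem_DA hd3 hzD (r + 1)
    have hw := sub_mem_VL (by linarith) hyV hzV
    have e1 := congrFun hh ⟨y - z, hw⟩
    have e2 := hz y trivial
    have e3 := hM.le (c := α + κ) hδ.le (by linarith) (mem_VL_of_mem_DA hd3 hye (r + 1)) hyV hzV
    rw [← inner_regularPart hd3 hr1 hq hye hzD hw.1] at e3
    have e4 : μ • stokes z + nonlin β γ r q (z + ye) + (α + κ) • z - (h + nonlin β γ r q ye) =
        regularPart μ β γ r q (α + κ) ye z - h := by rw [regularPart]; abel
    rw [e4, inner_sub_left] at e2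
    simp only [embed, inner_zero_left, add_zero] at e1
    have e6 : (α + κ - k) * ‖y - z‖ ^ 2 ≤ 0 := by linarith
    have e7 : ‖y - z‖ ^ 2 ≤ 0 := nonpos_of_mul_nonpos_right e6 (sub_pos.2 hkc)
    have e8 : y = z := sub_eq_zero.1 (norm_eq_zero.1 (by nlinarith [norm_nonneg (y - z)]))
    exact ⟨e8 ▸ hzD, hyK⟩
  · rintro ⟨hyD, hyK⟩
    have hyV := mem_VL_of_mem_DA hd3 hyD (r + 1)
    refine ⟨⟨_, mem_opG_iff.2 ⟨hyV, 0, (mem_subdifferential_indicatorFn hK.nonempty).2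
      ⟨hyK, fun z _ => by simp⟩, fun v => rfl⟩⟩, fun F hF => ?_⟩
    obtain ⟨-, ξ, -, hF⟩ := mem_opG_iff.1 hF
    refine ⟨regularPart μ β γ r q (α + κ) ye y + ξ, funext fun v => ?_⟩
    rw [hF, embed, inner_add_left, inner_regularPart hd3 hr1 hq hye hyD v.2.1]

theorem isMonotoneGraph_graphG (hd : d = 2 ∨ d = 3) (hr : 3 ≤ r) (hδ : 0 ≤ δ)
    (hkc : k < α + κ) (hM : NonlinMonotone d L μ β γ r q k δ) {K : Set (H d L)}
    (hK : IsAdmissible K) {ye : H d L} (hye : ye ∈ DA d L) :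
    IsMonotoneGraph (graphG μ α β γ r q κ ye K) := by
  have hd3 : d ≤ 3 := by omega
  rintro ⟨y, h⟩ ⟨-, hy⟩ ⟨z, g⟩ ⟨-, hz⟩
  obtain ⟨hyV, ξ, hξ, hy⟩ := mem_opG_iff.1 hy
  obtain ⟨hzV, η, hη, hz⟩ := mem_opG_iff.1 hz
  obtain ⟨hyK, hξ⟩ := (mem_subdifferential_indicatorFn hK.nonempty).1 hξ
  obtain ⟨hzK, hη⟩ := (mem_subdifferential_indicatorFn hK.nonempty).1 hη
  have hw := sub_mem_VL (by linarith) hyV hzV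
  have e1 := hy ⟨y - z, hw⟩
  have e2 := hz ⟨y - z, hw⟩
  have e3 := hM.le (c := α + κ) hδ (by linarith) (mem_VL_of_mem_DA hd3 hye (r + 1)) hyV hzV
  have e4 := hξ z hzK
  have e5 := hη y hyK
  rw [← neg_sub, inner_neg_right] at e5
  simp only [embed] at e1 e2
  have e6 : 0 ≤ (α + κ - k) * ‖y - z‖ ^ 2 := mul_nonneg (sub_nonneg.2 hkc.le) (sq_nonneg _)
  simp only [inner_sub_left]
  linarith

/-- The identity is put into the zeroth-order coefficient, now α + κ + 1. The residual of the
variational inequality is then the required element of the normal cone. -/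
theorem exists_mem_graphG_add_eq (hd : d = 2 ∨ d = 3) (hμ : 0 < μ) (hβ : 0 < β) (hq : 1 ≤ q)
    (hqr : q < r) (hr : 3 < r ∨ r = 3 ∧ 1 < 2 * β * μ) (hδ : 0 < δ) (hk : 0 ≤ k)
    (hkc : k < α + κ) (hM : NonlinMonotone d L μ β γ r q k δ) {K : Set (H d L)}
    (hK : IsAdmissible K) {ye : H d L} (hye : ye ∈ DA d L) (f : H d L) :
    ∃ p ∈ graphG μ α β γ r q κ ye K, p.2 + p.1 = f := by
  have hr3 : 3 ≤ r := by rcases hr with h | ⟨h, -⟩ <;> linarith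
  have hd3 : d ≤ 3 := by omega
  obtain ⟨y, hyD, hyK, hy⟩ := exists_variational (c := α + κ + 1) hd hμ hβ hq hqr hr hδ hk
    (by linarith) hM hK hye (f + nonlin β γ r q ye)
  refine ⟨(y, f - y), ⟨?_, mem_opG_iff.2 ⟨mem_VL_of_mem_DA hd3 hyD (r + 1),
    f - y - regularPart μ β γ r q (α + κ) ye y, ?_, fun v => ?_⟩⟩, sub_add_cancel _ _⟩
  · rw [domG_eq hd hμ hβ hq hqr hr hδ hk hkc hM hK hye]
    exact ⟨hyD, hyK⟩
  · refine (mem_subdifferential_indicatorFn hK.nonempty).2 ⟨hyK, fun z hz => ?_⟩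
    have e : μ • stokes y + nonlin β γ r q (y + ye) + (α + κ + 1) • y - (f + nonlin β γ r q ye) =
        -(f - y - regularPart μ β γ r q (α + κ) ye y) := by
      rw [regularPart, add_smul _ (1 : ℝ), one_smul]; abel
    have h := hy z hz
    rwa [e, inner_neg_left, ← inner_neg_right, neg_sub] at h
  · rw [inner_sub_left (f - y), inner_regularPart hd3 (by linarith) hq hye hyD v.2.1, embed]
    ring

end Operator

end CBFeD

end

theorem propositionA2 (d : ℕ) (μ β γ r q : ℝ) (hμ : 0 < μ) (hβ : 0 < β)
    (hq : 1 ≤ q) (hqr : q < r)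
    (hdr : ((d = 2 ∨ d = 3) ∧ 3 < r) ∨ (d = 3 ∧ r = 3 ∧ 1 < 2 * β * μ)) :
    ∃ κ₀ : ℝ, 0 < κ₀ ∧
      ∀ (L : ℝ) [Fact (0 < L)] (α : ℝ), 0 < α →
      ∀ ye ∈ CBFeD.DA d L, ∀ K : Set (CBFeD.H d L), CBFeD.IsAdmissible K →
      ∀ κ : ℝ, κ₀ ≤ κ →
        CBFeD.IsMaximalMonotoneGraph (CBFeD.graphG μ α β γ r q κ ye K) ∧
        CBFeD.domG μ α β γ r q κ ye K =
          CBFeD.DA d L ∩ {y | (CBFeD.subdifferential (CBFeD.indicatorFn K) y).Nonempty} ∧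
        CBFeD.domG μ α β γ r q κ ye K = CBFeD.DA d L ∩ K := by
  have hd : d = 2 ∨ d = 3 := by tauto
  have hr : 3 < r ∨ r = 3 ∧ 1 < 2 * β * μ := by tauto
  have hr3 : 3 ≤ r := by rcases hr with h | ⟨h, -⟩ <;> linarith
  obtain ⟨k, hk, δ, hδ, hM⟩ := CBFeD.exists_monotone (γ := γ) hμ hβ hq hqr hr
  refine ⟨k, hk, fun L _ α hα ye hye K hK κ hκ => ?_⟩
  -- Since α > 0 the inequality is strict already for κ = k, which lets κ₀ = k be independent of α.
  have hkc : k < α + κ := by linarith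
  have hdom := CBFeD.domG_eq hd hμ hβ hq hqr hr hδ hk.le hkc (hM d L) hK hye
  refine ⟨CBFeD.isMaximalMonotoneGraph_of_range
    (CBFeD.isMonotoneGraph_graphG hd hr3 hδ.le hkc (hM d L) hK hye)
    (CBFeD.exists_mem_graphG_add_eq hd hμ hβ hq hqr hr hδ hk.le hkc (hM d L) hK hye), ?_, hdom⟩
  rw [hdom]
  congr 1
  ext y
  exact (CBFeD.subdifferential_indicatorFn_nonempty_iff hK.nonempty y).symm
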